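/- Let $q$ be a power of a prime $p$, let $1\le k<n$ be integers with $\gcd(k,n-k)=1$, let $\ell=q^n$ and let $K=\overline{\mathbb F}_\ell$. Let $x_1,x_2,\dots$ be elements of an algebraically closed field $\Omega\supseteq K$ such that $x_1$ is transcendental over $\mathbb F_\ell$ and, for all $i\ge 1$, $$\sum_{j=0}^{n-k-1}\frac{x_{i+1}^{q^{j}}}{x_i^{q^{k+j}}}+\sum_{j=0}^{k-1}\frac{x_{i+1}^{q^{n-k+j}}}{x_i^{q^{j}}}=1 .$$ Put $z_i=-x_i^{q^n-1}$. For a constant field $C\in\{\mathbb F_\ell,K\}$ let $H_i=C(z_1,\dots,z_i)$, let $N_i\subseteq\Omega$ be the Galois closure of $H_i/H_1$, and note that $N_1=H_1=C(z_1)$. (1) Let $C=K$ and $i\ge 2$, and let $\tilde Q$ be a place of $N_i$ lying above the zero (respectively the pole) of $z_1$. Let $\widehat{N_i}$ be the completion of $N_i$ at $\tilde Q$ and $\widehat{N_1}\subseteq\widehat{N_i}$ the completion of $N_1$ at the restriction of $\tilde Q$. Then there is an intermediate field $L$ of $\widehat{N_i}/\widehat{N_1}$ such that $L/\widehat{N_1}$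 is cyclic of degree $q^k-1$ (respectively $q^{n-k}-1$), and $\widehat{N_i}/L$ is a $2$-bounded $p$-extension, i.e. a Galois extension of $p$-power degree whose ramification index $e$ and different exponent $d$ satisfy $d=2(e-1)$. (2) Let $C\in\{\mathbb F_\ell,K\}$ and $i\ge 1$. Then $N_i/N_1$ is a finite Galois extension and it is weakly ramified: for every place $Q$ of $N_i$ and its restriction $P$ to $N_1$, the second ramification group $G_2(Q|P)=\{\sigma\in\mathrm{Gal}(N_i/N_1): v_Q(\sigma a-a)\ge 3\text{ for all }a\in\mathcal O_Q\}$ is trivial. -/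

import Mathlib

noncomputable section

namespace GaloisTower

/-! ### The tower and its Galois closure -/

section Tower

variable {Ω : Type*} [Field Ω]

/-- The recursive equation
`y / x^(q^k) + y^q / x^(q^(k+1)) + ⋯ + y^(q^(n-k-1)) / x^(q^(n-1))
  + y^(q^(n-k)) / x + y^(q^(n-k+1)) / x^q + ⋯ + y^(q^(n-1)) / x^(q^(k-1)) = 1`.
(It forces `x ≠ 0` and `y ≠ 0`, also with the convention `a / 0 = 0`.) -/
def TowerEquation (q n k : ℕ) (x y : Ω) : Prop :=
  ∑ j ∈ Finset.range (n - k), y ^ q ^ j / x ^ q ^ (k + j) +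
    ∑ j ∈ Finset.range k, y ^ q ^ (n - k + j) / x ^ q ^ j = 1

/-- The elements `z_j = -x_j^(q^n - 1)`. -/
def z (q n : ℕ) (x : ℕ → Ω) (j : ℕ) : Ω := -(x j) ^ (q ^ n - 1)

variable (C : Type*) [Field C] [Algebra C Ω]

/-- The rational function field `N₁ = H₁ = C(z₁)`, for a sequence `z₁, z₂, …` in `Ω` and a constant
field `C`. -/
abbrev baseField (z : ℕ → Ω) : IntermediateField C Ω := IntermediateField.adjoin C {z 1}

/-- The element `z₁` of `N₁`. -/
def baseGen (z : ℕ → Ω) : baseField C z :=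
  ⟨z 1, IntermediateField.subset_adjoin C _ rfl⟩

/-- The field `H_i = C(z₁, …, z_i)`, as an extension of `H₁ = C(z₁)`. -/
abbrev stepField (z : ℕ → Ω) (i : ℕ) : IntermediateField (baseField C z) Ω :=
  IntermediateField.adjoin (baseField C z) (z '' Set.Icc 1 i)

/-- The field `N_i`: the Galois closure of `H_i / H₁` inside `Ω`
(the compositum of all the conjugates of `H_i` over `H₁`). -/
abbrev galoisStep (z : ℕ → Ω) (i : ℕ) : IntermediateField (baseField C z) Ω :=
  IntermediateField.normalClosure (baseField C z) (stepField C z i) Ω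

end Tower

/-! ### Places, ramification groups -/

section Places

/-- `O` is (the valuation ring of) a place of the function field `N` with constant field `C`:
a valuation ring of `N` that contains `C` and is different from `N`. -/
structure IsPlace (C : Type*) {N : Type*} [Field C] [Field N] [Algebra C N]
    (O : ValuationSubring N) : Prop where
  constants_mem : ∀ c : C, algebraMap C N c ∈ O
  ne_top : O ≠ ⊤

open scoped Pointwise in
/-- The `j`-th ramification group (lower numbering) of the place `O` of `N` over its restriction
to `F`: the elements `σ` of the decomposition group with `σ a - a ∈ 𝔪 ^ (j + 1)` for all `a ∈ O`. -/
def ramificationGroup (F : Type*) {N : Type*} [Field F] [Field N] [Algebra F N]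
    (O : ValuationSubring N) (j : ℕ) : Subgroup (O.decompositionSubgroup F) :=
  (IsLocalRing.maximalIdeal O ^ (j + 1)).toAddSubgroup.inertia (O.decompositionSubgroup F)

/-- The extension `N / F` of function fields over `C` is a finite Galois extension and it is weakly
ramified: the second ramification group of each place of `N` is trivial. -/
structure IsWeaklyRamified (C F N : Type*) [Field C] [Field F] [Field N]
    [Algebra C N] [Algebra F N] : Prop where
  finite : FiniteDimensional F N
  isGalois : IsGalois F N
  ramificationGroup_two : ∀ O : ValuationSubring N, IsPlace C O → ramificationGroup F O 2 = ⊥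

end Places

/-! ### Completions -/

section Completion

variable (F : Type*) {N : Type*} [Field F] [Field N] [Algebra F N] (O : ValuationSubring N)

/-- The completion of `N` at the place `O`. -/
abbrev Completed : Type _ := O.valuation.Completion

/-- The canonical embedding of `N` into its completion. -/
def toCompleted : N →+* Completed O :=
  (UniformSpace.Completion.coeRingHom : WithVal O.valuation →+* Completed O).comp
    (WithVal.equiv O.valuation).symm.toRingHom

/-- The ring of integers of the completion of `N` at the place `O`. -/
abbrev completedIntegers : ValuationSubring (Completed O) :=
  (Valued.v : Valuation (Completed O) _).valuationSubring

/-- The completion of `F` at the restriction of the place `O` of `N`, realised as usual as the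
topological closure of `F` in the completion of `N` at `O`. -/
abbrev completedBase : Subfield (Completed O) :=
  ((toCompleted O).comp (algebraMap F N)).fieldRange.topologicalClosure

end Completion

/-! ### Two-bounded `p`-extensions of local fields -/

section TwoBounded

variable (F : Type*) {E : Type*} [Field F] [Field E] [Algebra F E] (B : ValuationSubring E)

/-- The valuation ring `B ∩ F`. -/
abbrev restrictRing : ValuationSubring F := B.comap (algebraMap F E)

/-- `B` as an algebra over `B ∩ F`. -/
instance restrictAlgebra : Algebra (restrictRing F B) B :=
  ((algebraMap F E).restrict (restrictRing F B) B fun _ h => h).toAlgebra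

instance restrictTorsionFree : Module.IsTorsionFree (restrictRing F B) B := by
  have : FaithfulSMul (restrictRing F B) B := by
    rw [faithfulSMul_iff_algebraMap_injective]
    intro a b h
    exact Subtype.ext ((algebraMap F E).injective (congrArg Subtype.val h))
  exact (Module.isTorsionFree_iff_faithfulSMul (R := restrictRing F B) (A := B)).2 this

/-- The extension `E / F` of fields is `2`-bounded at `B`, where `B` is a discrete valuation
ring of `E` which is the only one above `B ∩ F`: the ramification index `e` and the different
exponent `d` satisfy `d = 2 (e - 1)`. -/
def IsTwoBounded : Prop :=
  ∃ _ : IsDiscreteValuationRing B, ∃ e d : ℕ,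
    (IsLocalRing.maximalIdeal B).ramificationIdx (restrictRing F B) = e ∧
    differentIdeal (restrictRing F B) B = IsLocalRing.maximalIdeal B ^ d ∧
    1 ≤ e ∧ d = 2 * (e - 1)

/-- The extension `E / F` of local fields, where `B` is the ring of integers of `E`, is a
`2`-bounded `p`-extension: it is a `2`-bounded Galois extension of degree a power of `p`. -/
structure IsTwoBoundedPExtension (p : ℕ) : Prop where
  finite : FiniteDimensional F E
  isGalois : IsGalois F E
  finrank_eq : ∃ m : ℕ, Module.finrank F E = p ^ m
  twoBounded : IsTwoBounded F B

end TwoBounded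

/-- For the place `O` of `N`, the completion of `N` at `O` and its subfield `F̂` (the completion of
`F`) have an intermediate field `L`, cyclic of degree `m` over `F̂`, such that the completion of `N`
is a `2`-bounded `p`-extension of `L`. -/
def HasCyclicTwoBoundedDecomposition (p m : ℕ) (F : Type*) {N : Type*} [Field F] [Field N]
    [Algebra F N] (O : ValuationSubring N) : Prop :=
  ∃ L : IntermediateField (completedBase F O) (Completed O),
    IsGalois (completedBase F O) L ∧
    IsCyclic Gal(L/(completedBase F O)) ∧
    Module.finrank (completedBase F O) L = m ∧
    IsTwoBoundedPExtension L (completedIntegers O) p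

end GaloisTower

end

/-!
Write `a = n - k` and `b = k`, let `Tr_m(x) = x + x ^ q + ⋯ + x ^ q ^ (m - 1)`, and put
`α = x_{i+1} / x_i ^ q ^ b`, `ζ = z_i`, `β = -ζ α ^ q ^ a`. In these terms the recursion reads
`Tr_a(α) + Tr_b(β) = 1` (`TowerStep`, `TowerEquation.towerStep`). Since `a` and `b` are coprime, the
Euclidean algorithm turns a solution into a single parameter, `α = u + Tr_b(γ)` and
`β = w - Tr_a(γ)` with integers `u`, `w` (`exists_parametrization`), so that a step from `ζ` amounts
to a root `γ` of a polynomial that is linear in `ζ` (`stepPoly`). For the first step this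
polynomial is irreducible over `C(z₁)`; hence `N_i` contains all its roots when `i ≥ 2`, and it is
generated by the conjugates of the `α_j` (`galoisStep_structure`). Everything else is local.

Where `z₁` is a unit, all the `z_j` and `α_j` are units, and an automorphism that acts trivially on
residues fixes `α_j`, by comparison of the linear terms (`TowerStep.map_eq_of_unit`). So `N_i / N_1`
is unramified there.

Above the zero or the pole of `z₁`, the chains `σ(z_1), σ(z_2), …` are studied inside the algebraic
closure of the completion, whose valuation is invariant and whose residues are constants
(`exists_valuation_of_closed`, `HasConstantResidues`). Let `w = 1 / z₁` and `m = q ^ b - 1` at the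
zero, `w = z₁` and `m = q ^ a - 1` at the pole, and let `Y₀ ^ m = 1 + w`. Up to integral elements,
which do not matter by Hensel's lemma, each step is trivial or it is the extension defined by an
equation `Tr_a(t) = f` or `t ^ q ^ a - t = f`, where `f` is an additive polynomial, with constant
coefficients, in the generator found before (`TowerStep.zero_zero`, `TowerStep.zero_pole`,
`TowerStep.pole_pole`). These equations are composed of Artin–Schreier equations, and over an
algebraically closed field of constants, an Artin–Schreier equation with right hand side
`f = ∑ c_i Y ^ p ^ i` can be brought into the form `Y' ^ p - Y' = c Y`. Consequently all the chains
together are governed by one root `Y` of a separable additive polynomial over the constants with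
value `Y₀` (`exists_addRoot_of_chains`, `exists_isLocalGenerator`), and `Y₀` itself is rational up
to a principal unit over the roots of the step polynomial.

This description contains both assertions. Over algebraically closed constants `Y₀` and `Y` lie in
the completion. The value of `w` is the `m`-th power of that of `Y₀`, which is the `p ^ j`-th power
of that of `Y`; so `Y₀` generates a Kummer extension of degree `m`, and above it `Y` generates a
totally ramified Galois extension of degree `p ^ j`, for which the equation of the uniformizer
`Y⁻¹` shows that the different has exponent `2 (p ^ j - 1)` (`isTwoBounded_of_addPoly`,
`IsCompletion.exists_cyclic_twoBounded`). As to weak ramification, an element `σ` of the second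
ramification group fixes `Y₀`, because it multiplies every element of the completion by a principal
unit, and it moves `Y` by a constant. But `Y` is, up to an integral element, a constant multiple of
the inverse of a uniformizer `ϖ`, and `σ` moves `ϖ⁻¹` by an element of the maximal ideal; so the
constant is zero (`map_eq_of_sub_le_pow_three`). If the constants are not algebraically closed, `σ`
is first modified so that it fixes the algebraic closure of the constants
(`exists_algEquiv_constants`).
-/

set_option linter.unusedSectionVars false

noncomputable section

namespace GaloisTower

/-! ### Truncated traces and the steps of the tower -/

section Trace

/-- The truncated trace `x + x ^ q + ⋯ + x ^ q ^ (m - 1)`. -/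
def qTrace {R : Type*} [CommRing R] (q m : ℕ) (x : R) : R := ∑ j ∈ Finset.range m, x ^ q ^ j

variable {R : Type*} [CommRing R] {p r q : ℕ} [Fact p.Prime] [CharP R p]

lemma qpow_add (hq : q = p ^ r) (j : ℕ) (x y : R) : (x + y) ^ q ^ j = x ^ q ^ j + y ^ q ^ j := by
  subst hq; rw [← pow_mul]; exact add_pow_char_pow x y p _

lemma qpow_sub (hq : q = p ^ r) (j : ℕ) (x y : R) : (x - y) ^ q ^ j = x ^ q ^ j - y ^ q ^ j := by
  subst hq; rw [← pow_mul]; exact sub_pow_char_pow x y _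

lemma qpow_ne_zero (hq : q = p ^ r) (j : ℕ) : q ^ j ≠ 0 := by
  subst hq; exact pow_ne_zero _ (pow_ne_zero _ (Fact.out : p.Prime).ne_zero)

omit [CharP R p] in
lemma qpow_zero (hq : q = p ^ r) (j : ℕ) : (0 : R) ^ q ^ j = 0 :=
  zero_pow (qpow_ne_zero hq j)

lemma qpow_neg (hq : q = p ^ r) (j : ℕ) (x : R) : (-x) ^ q ^ j = -x ^ q ^ j := by
  rw [← zero_sub, qpow_sub hq, qpow_zero hq, zero_sub]

lemma qpow_sum (hq : q = p ^ r) (j : ℕ) {ι : Type*} (s : Finset ι) (f : ι → R) :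
    (∑ i ∈ s, f i) ^ q ^ j = ∑ i ∈ s, f i ^ q ^ j := by
  subst hq; rw [← pow_mul]; exact sum_pow_char_pow p _ s f

lemma qpow_intCast (hq : q = p ^ r) (j : ℕ) (u : ℤ) : (u : R) ^ q ^ j = u := by
  subst hq; rw [← pow_mul]
  have := map_intCast (iterateFrobenius R p (r * j)) u
  rwa [iterateFrobenius_def] at this

@[simp] lemma qTrace_one_index (x : R) : qTrace q 1 x = x := by simp [qTrace]

lemma qTrace_add (hq : q = p ^ r) (m : ℕ) (x y : R) :
    qTrace q m (x + y) = qTrace q m x + qTrace q m y := by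
  simp only [qTrace, qpow_add hq, Finset.sum_add_distrib]

lemma qTrace_sub (hq : q = p ^ r) (m : ℕ) (x y : R) :
    qTrace q m (x - y) = qTrace q m x - qTrace q m y := by
  simp only [qTrace, qpow_sub hq, Finset.sum_sub_distrib]

lemma qTrace_zero (hq : q = p ^ r) (m : ℕ) : qTrace q m (0 : R) = 0 := by
  simp [qTrace, qpow_zero hq]

lemma qTrace_neg (hq : q = p ^ r) (m : ℕ) (x : R) : qTrace q m (-x) = -qTrace q m x := by
  simp only [qTrace, qpow_neg hq, Finset.sum_neg_distrib]

/-- The truncated trace of length `a + c` splits into two shorter ones. -/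
lemma qTrace_add_index (hq : q = p ^ r) (a c : ℕ) (x : R) :
    qTrace q (a + c) x = qTrace q a x + (qTrace q c x) ^ q ^ a := by
  rw [qTrace, Finset.sum_range_add, qTrace, qTrace, qpow_sum hq]
  congr 1
  refine Finset.sum_congr rfl fun j _ => ?_
  rw [← pow_mul, ← pow_add, add_comm a j]

lemma qTrace_pow (hq : q = p ^ r) (a c : ℕ) (x : R) :
    (qTrace q c x) ^ q ^ a = qTrace q c (x ^ q ^ a) := by
  rw [qTrace, qpow_sum hq, qTrace]
  refine Finset.sum_congr rfl fun j _ => ?_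
  rw [← pow_mul, ← pow_mul, mul_comm]

/-- The telescoping identity `Tr(x) ^ q - Tr(x) = x ^ q ^ m - x`. -/
lemma qTrace_frobenius_sub (hq : q = p ^ r) (m : ℕ) (x : R) :
    (qTrace q m x) ^ q - qTrace q m x = x ^ q ^ m - x := by
  have h1 := qTrace_add_index hq 1 m x
  have h2 := qTrace_add_index hq m 1 x
  rw [add_comm 1 m, h2] at h1
  simp only [qTrace_one_index, pow_one] at h1
  linear_combination -h1

lemma map_qTrace {S : Type*} [CommRing S] {F : Type*} [FunLike F R S] [RingHomClass F R S]
    (f : F) (q m : ℕ) (x : R) : f (qTrace q m x) = qTrace q m (f x) := by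
  simp [qTrace, map_sum, map_pow]

lemma qTrace_mem {σ : Type*} [SetLike σ R] [SubringClass σ R] {S : σ} {x : R} (hx : x ∈ S)
    (q m : ℕ) : qTrace q m x ∈ S :=
  sum_mem fun _ _ => pow_mem hx _

/-- The solutions of `Tr_a(α) + Tr_b(β) = 1`, for coprime `a` and `b`, are parametrised by a single
variable `γ`: this is the Euclidean algorithm for `X ^ a - 1` and `X ^ b - 1`, where `X` acts as
the `q`-Frobenius. -/
theorem exists_parametrization (hq : q = p ^ r) {a b : ℕ} (ha : 1 ≤ a) (hb : 1 ≤ b)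
    (hab : Nat.gcd a b = 1) {α β : R} (h : qTrace q a α + qTrace q b β = 1) :
    ∃ (γ : R) (u v : ℤ), α = u + qTrace q b γ ∧ β = v - qTrace q a γ ∧
      γ ∈ Subring.closure {α, β} := by
  induction hn : a + b using Nat.strong_induction_on generalizing a b α β with
  | _ n ih =>
    wlog hle : a ≤ b generalizing a b α β with H
    · obtain ⟨γ, u, v, h1, h2, h3⟩ := H hb ha (by rwa [Nat.gcd_comm]) (by rwa [add_comm])
        (by rwa [add_comm]) (by omega)
      refine ⟨-γ, v, u, ?_, ?_, ?_⟩
      · rw [h2, qTrace_neg hq]; ring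
      · rw [h1, qTrace_neg hq]; ring
      · rw [Set.pair_comm]; exact neg_mem h3
    obtain rfl | ha1 := eq_or_ne a 1
    · rw [qTrace_one_index] at h
      refine ⟨-β, 1, 0, ?_, ?_, ?_⟩
      · rw [qTrace_neg hq]; push_cast; linear_combination h
      · simp
      · exact neg_mem (Subring.subset_closure (by simp))
    obtain ⟨c, rfl⟩ := Nat.exists_eq_add_of_le hle
    have hc : 1 ≤ c := by
      rcases Nat.eq_zero_or_pos c with rfl | hc
      · simp at hab; omega
      · exact hc
    have hac : Nat.gcd a c = 1 := by simpa using hab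
    have h' : qTrace q a (α + β ^ q ^ c) + qTrace q c β = 1 := by
      rw [add_comm a c, qTrace_add_index hq, qTrace_pow hq] at h
      rw [qTrace_add hq]; linear_combination h
    obtain ⟨γ, u, v, h1, h2, h3⟩ := ih (a + c) (by omega) ha hc hac h' rfl
    refine ⟨γ, u - v, v, ?_, h2, ?_⟩
    · have h4 : β ^ q ^ c = v - (qTrace q a γ) ^ q ^ c := by
        rw [h2, qpow_sub hq, qpow_intCast hq]
      rw [add_comm a c, qTrace_add_index hq]
      push_cast
      linear_combination h1 - h4
    · refine Subring.closure_le.2 ?_ h3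
      rintro _ (rfl | rfl)
      · exact add_mem (Subring.subset_closure (by simp))
          (pow_mem (Subring.subset_closure (by simp)) _)
      · exact Subring.subset_closure (by simp)

end Trace

section Step

variable {Γ : Type*} [Field Γ]

/-- One step of the tower, in terms of the functions `ζ = z_i`, `ζ' = z_{i+1}` and
`α = x_{i+1} / x_i ^ q ^ b`. -/
structure TowerStep (q a b : ℕ) (ζ α ζ' : Γ) : Prop where
  trace_eq : qTrace q a α + qTrace q b (-(ζ * α ^ q ^ a)) = 1
  next_mul : ζ' * α = -(-(ζ * α ^ q ^ a)) ^ q ^ b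

lemma TowerStep.map {Δ : Type*} [Field Δ] {q a b : ℕ} {ζ α ζ' : Γ}
    (h : TowerStep q a b ζ α ζ') (f : Γ →+* Δ) : TowerStep q a b (f ζ) (f α) (f ζ') where
  trace_eq := by
    simpa only [map_add, map_qTrace, map_neg, map_mul, map_pow, map_one] using
      congrArg f h.trace_eq
  next_mul := by
    simpa only [map_neg, map_mul, map_pow] using congrArg f h.next_mul

variable {p r q : ℕ} [Fact p.Prime] [CharP Γ p] {a b : ℕ} {ζ α ζ' : Γ}

lemma TowerStep.ne_zero (hq : q = p ^ r) (h : TowerStep q a b ζ α ζ') : α ≠ 0 := by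
  rintro rfl
  have := h.trace_eq
  rw [qpow_zero hq, mul_zero, neg_zero, qTrace_zero hq, qTrace_zero hq] at this
  simp at this

/-- The relation `α ^ (q ^ a - 1) = (1 + ζ') / (1 + ζ)`, without denominators. -/
lemma TowerStep.frobenius_eq (hq : q = p ^ r) (h : TowerStep q a b ζ α ζ') :
    α ^ q ^ a * (1 + ζ) = α * (1 + ζ') := by
  set β := -(ζ * α ^ q ^ a) with hβ
  have h1 := qTrace_frobenius_sub hq a α
  have h2 := qTrace_frobenius_sub hq b β
  have h3 := h.trace_eq
  have h4 := h.next_mul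
  rw [← hβ] at h3 h4
  have h5 : (qTrace q a α + qTrace q b β) ^ q = qTrace q a α ^ q + qTrace q b β ^ q := by
    simpa using qpow_add hq 1 (qTrace q a α) (qTrace q b β)
  rw [h3, one_pow] at h5
  linear_combination -h1 - h2 - h3 - h5 - h4 + hβ

lemma TowerStep.next_eq (hq : q = p ^ r) (h : TowerStep q a b ζ α ζ') :
    ζ' = -(-(ζ * α ^ q ^ a)) ^ q ^ b / α := by
  rw [eq_div_iff (h.ne_zero hq), h.next_mul]

lemma TowerStep.pow_sub_one_eq (hq : q = p ^ r) (h : TowerStep q a b ζ α ζ') :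
    α ^ (q ^ a - 1) * (1 + ζ) = 1 + ζ' := by
  have h1 := h.frobenius_eq hq
  have h2 : α ^ q ^ a = α ^ (q ^ a - 1) * α := by
    rw [← pow_succ, Nat.sub_add_cancel (Nat.one_le_iff_ne_zero.2 (qpow_ne_zero hq a))]
  rw [h2] at h1
  exact mul_right_cancel₀ (h.ne_zero hq) (by linear_combination h1)

lemma TowerStep.next_eq_mul (hq : q = p ^ r) (h : TowerStep q a b ζ α ζ') :
    ζ' = ζ ^ q ^ b * α ^ (q ^ (a + b) - 1) := by
  have h1 := h.next_mul
  have h2 : α ^ q ^ (a + b) = α ^ (q ^ (a + b) - 1) * α := by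
    rw [← pow_succ, Nat.sub_add_cancel (Nat.one_le_iff_ne_zero.2 (qpow_ne_zero hq _))]
  rw [qpow_neg hq, neg_neg, mul_pow, ← pow_mul, ← pow_add, h2] at h1
  exact mul_right_cancel₀ (h.ne_zero hq) (by linear_combination h1)

lemma TowerStep.next_ne_zero (hq : q = p ^ r) (h : TowerStep q a b ζ α ζ') (h0 : ζ ≠ 0) :
    ζ' ≠ 0 := by
  rw [h.next_eq_mul hq]
  exact mul_ne_zero (pow_ne_zero _ h0) (pow_ne_zero _ (h.ne_zero hq))

/-- The relation `β ^ (q ^ b - 1) = (1 + 1 / ζ) / (1 + 1 / ζ')` for `β = -ζ α ^ q ^ a`. -/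
lemma TowerStep.beta_pow_eq (hq : q = p ^ r) (h : TowerStep q a b ζ α ζ') (h0 : ζ ≠ 0) :
    (-(ζ * α ^ q ^ a)) ^ (q ^ b - 1) * (1 + ζ'⁻¹) = 1 + ζ⁻¹ := by
  have hζ' := h.next_ne_zero hq h0
  have hα := h.ne_zero hq
  have h1 := h.frobenius_eq hq
  set β := -(ζ * α ^ q ^ a) with hβ
  have hβ0 : β ≠ 0 := neg_ne_zero.2 (mul_ne_zero h0 (pow_ne_zero _ hα))
  have h2 : β ^ q ^ b = β ^ (q ^ b - 1) * β := by
    rw [← pow_succ, Nat.sub_add_cancel (Nat.one_le_iff_ne_zero.2 (qpow_ne_zero hq _))]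
  have h3 := h.next_mul
  rw [← hβ, h2] at h3
  have h4 : β ^ (q ^ b - 1) * (1 + ζ') * ζ = (1 + ζ) * ζ' := by
    apply mul_right_cancel₀ hβ0
    clear_value β
    linear_combination (ζ * ζ') * h1 + ζ * (1 + ζ') * h3 - (ζ' * (1 + ζ)) * hβ
  field_simp
  linear_combination h4

/-- The element `α` lies in every subfield that contains `ζ` and `ζ'`: such a subfield contains
`α ^ (q ^ a - 1)` and `α ^ (q ^ (a + b) - 1)`, hence `α ^ (q - 1)`, and `1 / α` is an expression in
`ζ` and `α ^ (q - 1)`. -/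
theorem TowerStep.mem_of_mem (hq : q = p ^ r) (hab : Nat.gcd a b = 1)
    (h : TowerStep q a b ζ α ζ') (h0 : ζ ≠ 0) (h1 : 1 + ζ ≠ 0) (S : Subfield Γ)
    (hζ : ζ ∈ S) (hζ' : ζ' ∈ S) : α ∈ S := by
  have hα := h.ne_zero hq
  have hA : α ^ (q ^ a - 1) ∈ S := by
    have : α ^ (q ^ a - 1) = (1 + ζ') / (1 + ζ) := by
      rw [eq_div_iff h1, h.pow_sub_one_eq hq]
    rw [this]; exact div_mem (add_mem (one_mem _) hζ') (add_mem (one_mem _) hζ)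
  have hB : α ^ (q ^ (a + b) - 1) ∈ S := by
    have : α ^ (q ^ (a + b) - 1) = ζ' / ζ ^ q ^ b := by
      rw [eq_div_iff (pow_ne_zero _ h0), h.next_eq_mul hq, mul_comm]
    rw [this]; exact div_mem hζ' (pow_mem hζ _)
  have hC : α ^ (q - 1) ∈ S := by
    have hg : Nat.gcd (q ^ a - 1) (q ^ (a + b) - 1) = q - 1 := by
      rw [Nat.pow_sub_one_gcd_pow_sub_one, Nat.gcd_self_add_right, hab, pow_one]
    have := Nat.gcd_eq_gcd_ab (q ^ a - 1) (q ^ (a + b) - 1)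
    rw [hg] at this
    rw [← zpow_natCast, this, zpow_add₀ hα, zpow_mul, zpow_mul, zpow_natCast, zpow_natCast]
    exact mul_mem (zpow_mem hA _) (zpow_mem hB _)
  have hD : ∀ j, α ^ (q ^ j - 1) ∈ S := fun j => by
    obtain ⟨c, hc⟩ := Nat.sub_one_dvd_pow_sub_one q j
    rw [hc, pow_mul]; exact pow_mem hC _
  have hE : ∀ j, α ^ q ^ j = α ^ (q ^ j - 1) * α := fun j => by
    rw [← pow_succ, Nat.sub_add_cancel (Nat.one_le_iff_ne_zero.2 (qpow_ne_zero hq _))]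
  have hF : ∀ j, (-(ζ * α ^ q ^ a)) ^ q ^ j = -ζ ^ q ^ j * α ^ (q ^ (a + j) - 1) * α := fun j => by
    rw [qpow_neg hq, mul_pow, ← pow_mul, ← pow_add, hE (a + j)]; ring
  have hs := h.trace_eq
  simp only [qTrace, hF] at hs
  simp only [hE, ← Finset.sum_mul, ← add_mul] at hs
  rw [eq_inv_of_mul_eq_one_right hs]
  refine inv_mem (add_mem (sum_mem fun j _ => hD j) (sum_mem fun j _ => ?_))
  exact mul_mem (neg_mem (pow_mem hζ _)) (hD _)

omit [Fact p.Prime] [CharP Γ p] in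
/-- The recursive equation of the tower gives a step for `ζ = -x ^ (q ^ n - 1)` and
`ζ' = -y ^ (q ^ n - 1)`. -/
theorem TowerEquation.towerStep [Fact p.Prime] [CharP Γ p] (hq : q = p ^ r) {n k : ℕ}
    (hkn : k < n) {x y : Γ} (h : TowerEquation q n k x y) :
    x ≠ 0 ∧ TowerStep q (n - k) k (-x ^ (q ^ n - 1)) (y / x ^ q ^ k) (-y ^ (q ^ n - 1)) := by
  have hx : x ≠ 0 := by
    rintro rfl
    simp [TowerEquation, qpow_zero hq] at h
  refine ⟨hx, ?_⟩
  have hE : ∀ w : Γ, w ^ q ^ n = w ^ (q ^ n - 1) * w := fun w => by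
    rw [← pow_succ, Nat.sub_add_cancel (Nat.one_le_iff_ne_zero.2 (qpow_ne_zero hq _))]
  have hβ : -(-x ^ (q ^ n - 1) * (y / x ^ q ^ k) ^ q ^ (n - k)) = y ^ q ^ (n - k) / x := by
    rw [div_pow, ← pow_mul, ← pow_add, Nat.add_sub_cancel' hkn.le, hE x]
    field_simp
  refine ⟨?_, ?_⟩
  · rw [hβ, ← h, qTrace, qTrace]
    congr 1 <;> refine Finset.sum_congr rfl fun j _ => ?_
    · rw [div_pow, ← pow_mul, ← pow_add]
    · rw [div_pow, ← pow_mul, ← pow_add]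
  · rw [hβ, div_pow, ← pow_mul, ← pow_add, Nat.sub_add_cancel hkn.le, hE y]
    ring

end Step

/-! ### Artin–Schreier towers of additive polynomials -/

section AddSpan

variable {K Γ : Type*} [Field K] [Field Γ] [Algebra K Γ]

/-- The `K`-space of all `c + f(Y)` with `c ∈ K` and `f` an additive polynomial over `K`. -/
def addSpan (K : Type*) [Field K] [Algebra K Γ] (p : ℕ) (Y : Γ) : Submodule K Γ :=
  Submodule.span K (insert 1 (Set.range fun i : ℕ => Y ^ p ^ i))

/-- `Y` is a root of `f(Y) = Y₀` for a separable additive polynomial `f` over `K` of degree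
`p ^ j`. -/
def IsAddRoot (K : Type*) [Field K] [Algebra K Γ] (p : ℕ) (Y₀ : Γ) (j : ℕ) (Y : Γ) : Prop :=
  ∃ c : ℕ → K, c 0 ≠ 0 ∧ c j ≠ 0 ∧ (∀ i, j < i → c i = 0) ∧
    Y₀ = ∑ i ∈ Finset.range (j + 1), c i • Y ^ p ^ i

variable {p : ℕ}

lemma self_mem_addSpan (Y : Γ) : Y ∈ addSpan K p Y :=
  Submodule.subset_span (Or.inr ⟨0, by simp⟩)

lemma one_mem_addSpan (Y : Γ) : (1 : Γ) ∈ addSpan K p Y :=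
  Submodule.subset_span (Or.inl rfl)

lemma algebraMap_mem_addSpan (Y : Γ) (c : K) : algebraMap K Γ c ∈ addSpan K p Y := by
  rw [Algebra.algebraMap_eq_smul_one]
  exact Submodule.smul_mem _ _ (one_mem_addSpan Y)

lemma intCast_mem_addSpan (Y : Γ) (u : ℤ) : (u : Γ) ∈ addSpan K p Y := by
  simpa using algebraMap_mem_addSpan (K := K) (p := p) Y (u : K)

variable [Fact p.Prime] [CharP Γ p]

lemma pow_mem_addSpan {Y f : Γ} (hf : f ∈ addSpan K p Y) (j : ℕ) : f ^ p ^ j ∈ addSpan K p Y := by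
  induction hf using Submodule.span_induction with
  | mem x hx =>
    rcases hx with rfl | ⟨i, rfl⟩
    · rw [one_pow]; exact one_mem_addSpan Y
    · simp only [← pow_mul, ← pow_add]
      exact Submodule.subset_span (Or.inr ⟨_, rfl⟩)
  | zero =>
    rw [zero_pow (pow_ne_zero _ (Fact.out : p.Prime).ne_zero)]
    exact zero_mem _
  | add x y _ _ hx hy => rw [add_pow_char_pow]; exact add_mem hx hy
  | smul c x _ hx => rw [smul_pow]; exact Submodule.smul_mem _ _ hx

lemma qpow_mem_addSpan {q r : ℕ} (hq : q = p ^ r) {Y f : Γ} (hf : f ∈ addSpan K p Y) (j : ℕ) :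
    f ^ q ^ j ∈ addSpan K p Y := by
  subst hq; rw [← pow_mul]; exact pow_mem_addSpan hf _

lemma qTrace_mem_addSpan {q r : ℕ} (hq : q = p ^ r) {Y f : Γ} (hf : f ∈ addSpan K p Y) (m : ℕ) :
    qTrace q m f ∈ addSpan K p Y :=
  sum_mem fun _ _ => qpow_mem_addSpan hq hf _

lemma addSpan_le {Y Y' : Γ} (h : Y ∈ addSpan K p Y') : addSpan K p Y ≤ addSpan K p Y' := by
  refine Submodule.span_le.2 ?_
  rintro _ (rfl | ⟨i, rfl⟩)
  · exact one_mem_addSpan Y'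
  · exact pow_mem_addSpan h i

/-- An automorphism that fixes `Y` fixes all additive polynomials in `Y`. -/
lemma map_eq_of_mem_addSpan {F : Type*} [FunLike F Γ Γ] [AlgHomClass F K Γ Γ] {σ : F}
    {Y f : Γ} (hσ : σ Y = Y) (hf : f ∈ addSpan K p Y) : σ f = f := by
  induction hf using Submodule.span_induction with
  | mem x hx =>
    rcases hx with rfl | ⟨i, rfl⟩
    · exact map_one σ
    · simp [hσ]
  | zero => exact map_zero σ
  | add x y _ _ hx hy => rw [map_add, hx, hy]
  | smul c x _ hx => rw [map_smul, hx]

lemma IsAddRoot.refl (Y₀ : Γ) : IsAddRoot K p Y₀ 0 Y₀ :=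
  ⟨fun i => if i = 0 then 1 else 0, by simp, by simp, fun i hi => by simp; omega, by simp⟩

/-- Composing an additive polynomial with `(X ^ p - X) / d` gives an additive polynomial. -/
lemma IsAddRoot.step {Y₀ Y Y' : Γ} {j : ℕ} (h : IsAddRoot K p Y₀ j Y) {d : K} (hd : d ≠ 0)
    (hY : Y' ^ p - Y' = d • Y) : IsAddRoot K p Y₀ (j + 1) Y' := by
  obtain ⟨c, h0, hj, hc, rfl⟩ := h
  have hY' : Y = d⁻¹ • (Y' ^ p - Y') := by rw [hY, smul_smul, inv_mul_cancel₀ hd, one_smul]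
  let e : ℕ → K := fun i => c i * d⁻¹ ^ p ^ i
  have he : e (j + 1) = 0 := by simp [e, hc (j + 1) (Nat.lt_succ_self j)]
  refine ⟨fun i => (if i = 0 then 0 else e (i - 1)) - e i, ?_, ?_, ?_, ?_⟩
  · simpa [e] using ⟨h0, hd⟩
  · simp only [Nat.add_one_ne_zero, if_false, Nat.add_sub_cancel, he, sub_zero]
    exact mul_ne_zero hj (pow_ne_zero _ (inv_ne_zero hd))
  · intro i hi
    have h1 : i ≠ 0 := by omega
    simp [e, h1, hc i (by omega), hc (i - 1) (by omega)]
  · have h1 : ∀ i, c i • Y ^ p ^ i = e i • Y' ^ p ^ (i + 1) - e i • Y' ^ p ^ i := fun i => by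
      rw [hY', smul_pow, sub_pow_char_pow, ← pow_mul, ← pow_succ', smul_smul, smul_sub]
    have h2 : ∑ i ∈ Finset.range (j + 1 + 1), e i • Y' ^ p ^ i =
        ∑ i ∈ Finset.range (j + 1), e i • Y' ^ p ^ i := by
      rw [Finset.sum_range_succ, he, zero_smul, add_zero]
    simp only [h1, sub_smul, Finset.sum_sub_distrib]
    rw [h2, Finset.sum_range_succ' (fun i => (if i = 0 then (0 : K) else e (i - 1)) • Y' ^ p ^ i)]
    simp

variable [IsAlgClosed K]

/-- Modulo `e ↦ e ^ p - e`, every additive polynomial in `Y` is a multiple of `Y`, because `K` is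
perfect. -/
lemma exists_eq_smul_add_artinSchreier {Y f : Γ} (hf : f ∈ addSpan K p Y) :
    ∃ c : K, ∃ e ∈ addSpan K p Y, f = c • Y + (e ^ p - e) := by
  have hp : 0 < p := (Fact.out : p.Prime).pos
  rw [addSpan] at hf
  induction hf using Submodule.closure_induction with
  | zero => exact ⟨0, 0, zero_mem _, by simp [hp.ne']⟩
  | add x y _ _ hx hy =>
    obtain ⟨c, e, he, rfl⟩ := hx
    obtain ⟨c', e', he', rfl⟩ := hy
    refine ⟨c + c', e + e', add_mem he he', ?_⟩
    rw [add_pow_char, add_smul]; ring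
  | smul_mem c x hx =>
    rcases hx with rfl | ⟨i, rfl⟩
    · have : ∃ e : K, e ^ p - e = c := by
        have hdeg :
            (Polynomial.X ^ p - Polynomial.X - Polynomial.C c : Polynomial K).degree ≠ 0 := by
          have h1 : (Polynomial.X + Polynomial.C c : Polynomial K).degree < p := by
            rw [Polynomial.degree_X_add_C]; exact_mod_cast (Fact.out : p.Prime).one_lt
          rw [sub_sub, Polynomial.degree_sub_eq_left_of_degree_lt (by simpa using h1)]
          simpa using hp.ne'
        obtain ⟨e, he⟩ := IsAlgClosed.exists_root _ hdeg
        exact ⟨e, by simpa [sub_eq_zero] using he⟩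
      obtain ⟨e, he⟩ := this
      refine ⟨0, algebraMap K Γ e, algebraMap_mem_addSpan Y e, ?_⟩
      rw [zero_smul, zero_add, ← he, ← map_pow, ← map_sub, Algebra.algebraMap_eq_smul_one]
    · induction i generalizing c with
      | zero => exact ⟨c, 0, zero_mem _, by simp [hp.ne']⟩
      | succ i ih =>
        obtain ⟨d, hd⟩ := IsAlgClosed.exists_pow_nat_eq c hp
        obtain ⟨c', e, he, h⟩ := ih d
        refine ⟨c', e + d • Y ^ p ^ i,
          add_mem he (Submodule.smul_mem _ _ (pow_mem_addSpan (self_mem_addSpan Y) i)), ?_⟩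
        have h' : c • Y ^ p ^ (i + 1) = (d • Y ^ p ^ i) ^ p := by
          rw [smul_pow, hd, ← pow_mul, pow_succ]
        simp only at h ⊢
        rw [h', add_pow_char]
        linear_combination h

omit [Fact p.Prime] [CharP Γ p] in
lemma exists_algebraMap_eq_of_aeval_eq_zero {P : Polynomial K} (hP : P ≠ 0) {x : Γ}
    (hx : Polynomial.aeval x P = 0) : ∃ c : K, algebraMap K Γ c = x := by
  have hint : IsIntegral K x := isAlgebraic_iff_isIntegral.1 ⟨P, hP, hx⟩
  obtain ⟨c, hc⟩ := IsAlgClosed.exists_root (minpoly K x) (minpoly.degree_pos hint).ne'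
  have h1 := minpoly.root hint hc
  exact ⟨c, h1⟩

/-- Adjoining an Artin–Schreier root `t` of an additive polynomial in `Y` amounts to replacing `Y`
by some `Y'`: additive polynomials in `Y`, and `t` itself, are additive polynomials in `Y'`, and
`Y'` is rational over `K(Y, t)`, in the sense that automorphisms fixing `Y` and `t` fix `Y'`. -/
lemma IsAddRoot.exists_artinSchreier {Y₀ Y t : Γ} {j : ℕ} (h : IsAddRoot K p Y₀ j Y)
    (ht : t ^ p - t ∈ addSpan K p Y) :
    ∃ j' Y', IsAddRoot K p Y₀ j' Y' ∧ Y ∈ addSpan K p Y' ∧ t ∈ addSpan K p Y' ∧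
      ∀ σ : Γ ≃ₐ[K] Γ, σ Y = Y → σ t = t → σ Y' = Y' := by
  obtain ⟨c, e, he, hf⟩ := exists_eq_smul_add_artinSchreier ht
  have hs : (t - e) ^ p - (t - e) = c • Y := by
    rw [sub_pow_char]; linear_combination hf
  by_cases hc : c = 0
  · refine ⟨j, Y, h, self_mem_addSpan Y, ?_, fun σ h _ => h⟩
    rw [hc, zero_smul] at hs
    have hP : (Polynomial.X ^ p - Polynomial.X : Polynomial K) ≠ 0 :=
      FiniteField.X_pow_card_sub_X_ne_zero K (Fact.out : p.Prime).one_lt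
    obtain ⟨u, hu⟩ := exists_algebraMap_eq_of_aeval_eq_zero hP (x := t - e) (by simpa using hs)
    have : t = algebraMap K Γ u + e := by rw [hu]; ring
    rw [this]
    exact add_mem (algebraMap_mem_addSpan Y u) he
  · have hY : Y ∈ addSpan K p (t - e) := by
      have : Y = c⁻¹ • ((t - e) ^ p - (t - e)) := by
        rw [hs, smul_smul, inv_mul_cancel₀ hc, one_smul]
      have h1 := self_mem_addSpan (K := K) (p := p) (t - e)
      rw [this]
      exact Submodule.smul_mem _ _ (sub_mem (by simpa using pow_mem_addSpan h1 1) h1)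
    refine ⟨j + 1, t - e, h.step hc hs, hY, ?_, ?_⟩
    · have := add_mem (self_mem_addSpan (K := K) (p := p) (t - e)) (addSpan_le hY he)
      rwa [sub_add_cancel] at this
    · intro σ h1 h2
      rw [map_sub, h2, map_eq_of_mem_addSpan h1 he]

lemma IsAddRoot.exists_artinSchreier_finset {Y₀ Y : Γ} {j : ℕ} (h : IsAddRoot K p Y₀ j Y)
    (T : Finset Γ) (ht : ∀ t ∈ T, t ^ p - t ∈ addSpan K p Y) :
    ∃ j' Y', IsAddRoot K p Y₀ j' Y' ∧ Y ∈ addSpan K p Y' ∧ (∀ t ∈ T, t ∈ addSpan K p Y') ∧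
      ∀ σ : Γ ≃ₐ[K] Γ, σ Y = Y → (∀ t ∈ T, σ t = t) → σ Y' = Y' := by
  classical
  induction T using Finset.induction_on with
  | empty => exact ⟨j, Y, h, self_mem_addSpan Y, by simp, fun σ h _ => h⟩
  | insert t T _ ih =>
    obtain ⟨j₁, Y₁, h₁, hY₁, hT₁, hσ₁⟩ := ih fun t ht' => ht t (Finset.mem_insert_of_mem ht')
    obtain ⟨j₂, Y₂, h₂, hY₂, ht₂, hσ₂⟩ :=
      h₁.exists_artinSchreier (addSpan_le hY₁ (ht t (Finset.mem_insert_self _ _)))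
    refine ⟨j₂, Y₂, h₂, addSpan_le hY₂ hY₁, ?_, fun σ h hT => ?_⟩
    · intro s hs
      rcases Finset.mem_insert.1 hs with rfl | hs
      · exact ht₂
      · exact addSpan_le hY₂ (hT₁ s hs)
    · exact hσ₂ σ (hσ₁ σ h fun s hs => hT s (Finset.mem_insert_of_mem hs))
        (hT t (Finset.mem_insert_self _ _))

/-- The equation `t ^ p ^ n - t = f` reduces to Artin–Schreier equations of degree `p`: for
`g ∈ 𝔽_{p^n}` the sum `s_g = ∑ (g t) ^ p ^ i` satisfies `s_g ^ p - s_g = g f`, and `t` is a linear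
combination of the `s_g`. -/
theorem IsAddRoot.exists_artinSchreier_pow {Y₀ Y t : Γ} {j n : ℕ} (h : IsAddRoot K p Y₀ j Y)
    (hn : n ≠ 0) (ht : t ^ p ^ n - t ∈ addSpan K p Y) :
    ∃ j' Y', IsAddRoot K p Y₀ j' Y' ∧ Y ∈ addSpan K p Y' ∧ t ∈ addSpan K p Y' ∧
      ∀ σ : Γ ≃ₐ[K] Γ, σ Y = Y → σ t = t → σ Y' = Y' := by
  classical
  have hp := (Fact.out : p.Prime)
  have : CharP K p := (algebraMap K Γ).charP (algebraMap K Γ).injective p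
  let _ := ZMod.algebra K p
  let G := GaloisField p n
  let _ : Fintype G := Fintype.ofFinite G
  have hG : Fintype.card G = p ^ n := by
    rw [← Nat.card_eq_fintype_card]; exact GaloisField.card p n hn
  let φ : G →+* K := (IsAlgClosed.lift : G →ₐ[ZMod p] K).toRingHom
  let s : G → Γ := fun g => ∑ i ∈ Finset.range n, (φ g • t) ^ p ^ i
  have hs : ∀ g, s g ^ p - s g = φ g • (t ^ p ^ n - t) := fun g => by
    have h1 := qTrace_frobenius_sub (q := p) (p := p) (r := 1) (by simp) n (φ g • t)
    have h2 : φ g ^ p ^ n = φ g := by rw [← map_pow, ← hG, FiniteField.pow_card]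
    rw [smul_pow, h2] at h1
    rw [smul_sub]; exact h1
  obtain ⟨j', Y', h₁, hY', hT, hσ⟩ := h.exists_artinSchreier_finset (Finset.univ.image s) (by
    intro x hx
    obtain ⟨g, -, rfl⟩ := Finset.mem_image.1 hx
    rw [hs]; exact Submodule.smul_mem _ _ ht)
  refine ⟨j', Y', h₁, hY', ?_, fun σ hY ht' => hσ σ hY fun x hx => ?_⟩
  · have hsum : ∑ g : Gˣ, φ (g⁻¹ : Gˣ) • s g = -t := by
      have h3 : ∀ i ∈ Finset.range n, ∑ g : Gˣ, φ (g⁻¹ : Gˣ) • (φ g • t) ^ p ^ i =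
          if i = 0 then -t else 0 := by
        intro i hi
        have h4 : ∀ g : Gˣ, φ (g⁻¹ : Gˣ) • (φ g • t) ^ p ^ i =
            φ ((g : G) ^ (p ^ i - 1)) • t ^ p ^ i := fun g => by
          rw [smul_pow, smul_smul, ← map_pow, ← map_mul]
          congr 2
          have : (g : G) ^ p ^ i = g ^ (p ^ i - 1) * g := by
            rw [← pow_succ, Nat.sub_add_cancel (Nat.one_le_pow _ _ hp.pos)]
          rw [this, mul_comm, mul_assoc, Units.mul_inv, mul_one]
        rw [Finset.sum_congr rfl fun g _ => h4 g, ← Finset.sum_smul, ← map_sum,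
          FiniteField.sum_pow_units, hG]
        rcases Nat.eq_zero_or_pos i with rfl | hi0
        · simp
        · have h5 : ¬ (p ^ n - 1 ∣ p ^ i - 1) := by
            intro hd
            have h6 := Nat.le_of_dvd (Nat.sub_pos_of_lt (Nat.one_lt_pow hi0.ne' hp.one_lt)) hd
            have h7 := Nat.pow_lt_pow_right hp.one_lt (Finset.mem_range.1 hi)
            have h8 := Nat.one_le_pow i p hp.pos
            omega
          rw [if_neg h5, if_neg hi0.ne', map_zero, zero_smul]
      simp only [s, Finset.smul_sum]
      rw [Finset.sum_comm, Finset.sum_congr rfl h3, Finset.sum_ite_eq', if_pos]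
      exact Finset.mem_range.2 (Nat.pos_of_ne_zero hn)
    rw [← neg_neg t, ← hsum]
    exact neg_mem (sum_mem fun g _ => Submodule.smul_mem _ _
      (hT _ (Finset.mem_image_of_mem s (Finset.mem_univ _))))
  · obtain ⟨g, -, rfl⟩ := Finset.mem_image.1 hx
    simp only [s, map_sum, map_pow, map_smul, ht']

/-- A solution of `Tr_a(t) = f` satisfies `t ^ q ^ a - t = f ^ q - f`, so this equation reduces to
Artin–Schreier equations, too. -/
theorem IsAddRoot.exists_qTrace {q r : ℕ} (hq : q = p ^ r) (hr : 1 ≤ r) {Y₀ Y t : Γ} {j a : ℕ}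
    (h : IsAddRoot K p Y₀ j Y) (ha : 1 ≤ a) (ht : qTrace q a t ∈ addSpan K p Y) :
    ∃ j' Y', IsAddRoot K p Y₀ j' Y' ∧ Y ∈ addSpan K p Y' ∧ t ∈ addSpan K p Y' ∧
      ∀ σ : Γ ≃ₐ[K] Γ, σ Y = Y → σ t = t → σ Y' = Y' := by
  refine h.exists_artinSchreier_pow (n := r * a) (Nat.mul_ne_zero (by omega) (by omega)) ?_
  have h1 := qTrace_frobenius_sub hq a t
  have h2 := qpow_mem_addSpan hq ht 1
  rw [pow_one] at h2
  rw [hq, ← pow_mul, ← hq] at h1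
  rw [← h1]
  exact sub_mem h2 ht

/-- An automorphism that fixes `Y₀` moves `Y` by a constant. -/
lemma IsAddRoot.exists_map_eq_add {Y₀ Y : Γ} {j : ℕ} (h : IsAddRoot K p Y₀ j Y)
    (σ : Γ →ₐ[K] Γ) (hσ : σ Y₀ = Y₀) : ∃ c : K, σ Y = Y + algebraMap K Γ c := by
  obtain ⟨c, h0, -, -, rfl⟩ := h
  let P : Polynomial K := ∑ i ∈ Finset.range (j + 1), Polynomial.C (c i) * Polynomial.X ^ p ^ i
  have hP : P ≠ 0 := by
    intro h
    have := congrArg (fun f => Polynomial.coeff f 1) h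
    simp only [P, Polynomial.finsetSum_coeff, Polynomial.coeff_C_mul_X_pow,
      Polynomial.coeff_zero] at this
    rw [Finset.sum_eq_single 0] at this
    · simp at this; exact h0 this
    · intro i _ hi
      rw [if_neg]
      exact fun h => hi ((Nat.pow_eq_one.1 h.symm).resolve_left (Fact.out : p.Prime).one_lt.ne')
    · simp
  obtain ⟨d, hd⟩ := exists_algebraMap_eq_of_aeval_eq_zero hP (x := σ Y - Y) (by
    simp only [map_sum, map_smul, map_pow] at hσ
    simp only [P, map_sum, map_mul, Polynomial.aeval_C, map_pow, Polynomial.aeval_X,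
      sub_pow_char_pow, mul_sub, Finset.sum_sub_distrib, ← Algebra.smul_def, hσ, sub_self])
  exact ⟨d, by rw [hd]; ring⟩

end AddSpan

/-! ### Valuations with constant residues -/

section Valued

variable {Γ Γ₀ : Type*} [Field Γ] [LinearOrderedCommGroupWithZero Γ₀] (v : Valuation Γ Γ₀)

/-- The valuation `v` is trivial on the field of constants `K`, and every residue is that of a
constant. -/
structure HasConstantResidues (K : Type*) [Field K] [Algebra K Γ] : Prop where
  map_const : ∀ c : K, c ≠ 0 → v (algebraMap K Γ c) = 1
  exists_const : ∀ x, v x ≤ 1 → ∃ c : K, v (x - algebraMap K Γ c) < 1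

variable {v} {K : Type*} [Field K] [Algebra K Γ]

lemma HasConstantResidues.map_const_le (h : HasConstantResidues v K) (c : K) :
    v (algebraMap K Γ c) ≤ 1 := by
  by_cases hc : c = 0
  · simp [hc]
  · exact (h.map_const c hc).le

lemma HasConstantResidues.eq_zero_of_lt (h : HasConstantResidues v K) {c : K}
    (hc : v (algebraMap K Γ c) < 1) : c = 0 := by
  by_contra h0
  exact hc.ne (h.map_const c h0)

lemma HasConstantResidues.map_intCast_le (h : HasConstantResidues v K) (u : ℤ) :
    v (u : Γ) ≤ 1 := by
  simpa using h.map_const_le (u : K)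

section Trace

variable {p r q : ℕ} [Fact p.Prime]

lemma two_le_q (hq : q = p ^ r) (hr : 1 ≤ r) : 2 ≤ q := by
  subst hq
  exact (Fact.out : p.Prime).two_le.trans (Nat.le_self_pow (by omega) p)

lemma map_pow_le_self {x : Γ} (hx : v x ≤ 1) {m : ℕ} (hm : m ≠ 0) : v (x ^ m) ≤ v x := by
  rw [map_pow]; exact pow_le_of_le_one zero_le hx hm

lemma map_qTrace_le (hq : q = p ^ r) {x : Γ} (hx : v x ≤ 1) (m : ℕ) :
    v (qTrace q m x) ≤ v x :=
  v.map_sum_le fun _ _ => map_pow_le_self hx (qpow_ne_zero hq _)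

lemma map_qTrace_sub_self_le (hq : q = p ^ r) {x : Γ} (hx : v x ≤ 1) {m : ℕ} (hm : 1 ≤ m) :
    v (qTrace q m x - x) ≤ v x ^ q := by
  obtain ⟨m, rfl⟩ := Nat.exists_eq_add_of_le' hm
  rw [qTrace, Finset.sum_range_succ']
  simp only [pow_zero, pow_one, add_sub_cancel_right]
  refine v.map_sum_le fun j _ => ?_
  rw [pow_succ', pow_mul, ← map_pow v x q]
  refine map_pow_le_self (v := v) ?_ (qpow_ne_zero hq _)
  rw [map_pow]; exact pow_le_one₀ zero_le hx

/-- Small arguments: the first term of the truncated trace dominates. -/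
lemma map_qTrace_eq (hq : q = p ^ r) (hr : 1 ≤ r) {x : Γ} (hx : v x < 1) {m : ℕ} (hm : 1 ≤ m) :
    v (qTrace q m x) = v x := by
  by_cases h0 : v x = 0
  · refine le_antisymm (map_qTrace_le hq hx.le m) (by rw [h0]; exact zero_le)
  have h1 : v (qTrace q m x - x) < v x := by
    refine (map_qTrace_sub_self_le hq hx.le hm).trans_lt ?_
    exact pow_lt_self_of_lt_one₀ (zero_lt_iff.2 h0) hx (two_le_q hq hr)
  have := v.map_add_eq_of_lt_left h1
  rwa [add_sub_cancel] at this

/-- Large arguments: the last term of the truncated trace dominates. -/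
lemma map_qTrace_of_one_lt (hq : q = p ^ r) (hr : 1 ≤ r) {x : Γ} (hx : 1 < v x) {m : ℕ}
    (hm : 1 ≤ m) : v (qTrace q m x) = v x ^ q ^ (m - 1) := by
  obtain ⟨m, rfl⟩ := Nat.exists_eq_add_of_le' hm
  rw [qTrace, Finset.sum_range_succ, Nat.add_sub_cancel, ← map_pow]
  refine v.map_add_eq_of_lt_right (v.map_sum_lt ?_ fun j hj => ?_)
  · rw [map_pow]; exact pow_ne_zero _ (zero_lt_one.trans hx).ne'
  · rw [map_pow, map_pow]
    exact pow_lt_pow_right₀ hx (Nat.pow_lt_pow_right (two_le_q hq hr) (Finset.mem_range.1 hj))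

lemma le_one_of_map_qTrace_le (hq : q = p ^ r) (hr : 1 ≤ r) {x : Γ} {m : ℕ} (hm : 1 ≤ m)
    (h : v (qTrace q m x) ≤ 1) : v x ≤ 1 := by
  by_contra! hx
  rw [map_qTrace_of_one_lt hq hr hx hm] at h
  exact h.not_gt (one_lt_pow₀ hx (qpow_ne_zero hq _))

lemma eq_zero_of_qTrace_eq_zero (hq : q = p ^ r) (hr : 1 ≤ r) {x : Γ} (hx : v x < 1) {m : ℕ}
    (hm : 1 ≤ m) (h : qTrace q m x = 0) : x = 0 := by
  have := map_qTrace_eq hq hr hx hm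
  rw [h, map_zero] at this
  exact v.zero_iff.1 this.symm

lemma le_one_of_pow_sub_le {x : Γ} {Q : ℕ} (hQ : 2 ≤ Q) (h : v (x ^ Q - x) ≤ 1) : v x ≤ 1 := by
  by_contra! hx
  have h1 : v x < v (x ^ Q) := by
    rw [map_pow]; exact lt_self_pow₀ hx hQ
  rw [v.map_sub_eq_of_lt_left h1] at h
  exact h.not_gt (hx.trans h1)

lemma eq_zero_of_pow_eq_self {x : Γ} {Q : ℕ} (hQ : 2 ≤ Q) (hx : v x < 1) (h : x ^ Q = x) :
    x = 0 := by
  by_contra h0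
  have h1 : v (x ^ Q) < v x := by
    rw [map_pow]; exact pow_lt_self_of_lt_one₀ (zero_lt_iff.2 (v.ne_zero_iff.2 h0)) hx hQ
  rw [h] at h1; exact h1.false

/-- The equation `ζ Tr_b(δ) ^ (q ^ a) = Tr_a(δ)` has only the trivial small solution. -/
lemma eq_zero_of_mul_qTrace_eq (hq : q = p ^ r) (hr : 1 ≤ r) {a b : ℕ} (ha : 1 ≤ a)
    {ζ δ : Γ} (hζ : v ζ < 1) (hδ : v δ < 1)
    (h : ζ * (qTrace q b δ) ^ q ^ a = qTrace q a δ) : δ = 0 := by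
  by_contra h0
  have hd : 0 < v δ := zero_lt_iff.2 (v.ne_zero_iff.2 h0)
  have h1 := congrArg v h
  rw [map_qTrace_eq hq hr hδ ha, map_mul] at h1
  have h2 : v ((qTrace q b δ) ^ q ^ a) ≤ v δ :=
    (map_pow_le_self ((map_qTrace_le hq hδ.le b).trans hδ.le) (qpow_ne_zero hq _)).trans
      (map_qTrace_le hq hδ.le b)
  have h3 : v ζ * v ((qTrace q b δ) ^ q ^ a) < v δ := by
    calc _ ≤ v ζ * v δ := by gcongr
      _ < 1 * v δ := by gcongr
      _ = v δ := one_mul _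
  exact h3.ne h1

end Trace

section Root

variable {p r q : ℕ} [Fact p.Prime] [CharP Γ p] [IsAlgClosed Γ]

lemma exists_qTrace_eq (hq : q = p ^ r) (hr : 1 ≤ r) {m : ℕ} (hm : 1 ≤ m) (f : Γ) :
    ∃ g : Γ, qTrace q m g = f := by
  obtain ⟨m, rfl⟩ := Nat.exists_eq_add_of_le' hm
  let P : Polynomial Γ := ∑ j ∈ Finset.range m, Polynomial.X ^ q ^ j - Polynomial.C f
  have hP : P.degree < (q ^ m : ℕ) := by
    refine (Polynomial.degree_sub_le _ _).trans_lt (max_lt ?_ ?_)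
    · refine (Polynomial.degree_sum_le _ _).trans_lt ?_
      rw [Finset.sup_lt_iff (by exact WithBot.bot_lt_coe _)]
      intro j hj
      rw [Polynomial.degree_X_pow]
      exact_mod_cast Nat.pow_lt_pow_right (two_le_q hq hr) (Finset.mem_range.1 hj)
    · refine Polynomial.degree_C_le.trans_lt ?_
      exact_mod_cast Nat.pos_of_ne_zero (qpow_ne_zero hq m)
  have hd : (Polynomial.X ^ q ^ m + P).degree ≠ 0 := by
    rw [Polynomial.degree_add_eq_left_of_degree_lt (by rwa [Polynomial.degree_X_pow]),
      Polynomial.degree_X_pow]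
    exact_mod_cast qpow_ne_zero hq m
  obtain ⟨g, hg⟩ := IsAlgClosed.exists_root _ hd
  refine ⟨g, ?_⟩
  have h1 : g ^ q ^ m + (∑ j ∈ Finset.range m, g ^ q ^ j - f) = 0 := by
    simpa [P, Polynomial.eval_finsetSum, Polynomial.IsRoot] using hg
  rw [qTrace, Finset.sum_range_succ]
  linear_combination h1

lemma exists_pow_sub_self_eq {Q : ℕ} (hQ : 2 ≤ Q) (f : Γ) : ∃ t : Γ, t ^ Q - t = f := by
  have hd : (Polynomial.X ^ Q + (-Polynomial.X - Polynomial.C f) : Polynomial Γ).degree ≠ 0 := by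
    rw [Polynomial.degree_add_eq_left_of_degree_lt, Polynomial.degree_X_pow]
    · exact_mod_cast (by omega : Q ≠ 0)
    · rw [← neg_add', Polynomial.degree_neg, Polynomial.degree_X_add_C, Polynomial.degree_X_pow]
      exact_mod_cast hQ
  obtain ⟨t, ht⟩ := IsAlgClosed.exists_root _ hd
  have h1 : t ^ Q + (-t - f) = 0 := by simpa [Polynomial.IsRoot] using ht
  exact ⟨t, by linear_combination h1⟩

/-- A `1`-unit `1 + e` has a `(q ^ m - 1)`-th root that is a `1`-unit. -/
lemma HasConstantResidues.exists_root_one_add (h : HasConstantResidues v K) (hq : q = p ^ r)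
    (hr : 1 ≤ r) {m : ℕ} (hm : 1 ≤ m) {e : Γ} (he : v e < 1) :
    ∃ η : Γ, η ^ (q ^ m - 1) = 1 + e ∧ v (η - 1) ≤ v e := by
  have h2 : 2 ≤ q ^ m := (two_le_q hq hr).trans (Nat.le_self_pow (by omega) q)
  obtain ⟨η₀, hη₀⟩ := IsAlgClosed.exists_pow_nat_eq (1 + e) (n := q ^ m - 1) (by omega)
  have hv1 : v (1 + e) = 1 := v.map_one_add_of_lt he
  have hv : v η₀ = 1 := by
    have := congrArg v hη₀
    rw [map_pow, hv1] at this
    exact (pow_eq_one_iff_of_nonneg zero_le (by omega)).1 this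
  obtain ⟨c, hc⟩ := h.exists_const η₀ hv.le
  have hc0 : c ≠ 0 := by
    rintro rfl
    rw [map_zero, sub_zero, hv] at hc
    exact hc.false
  have hcv := h.map_const c hc0
  have hcΓ : algebraMap K Γ c ≠ 0 := (map_ne_zero _).2 hc0
  have hpow : c ^ (q ^ m - 1) = 1 := by
    rw [← sub_eq_zero]
    apply h.eq_zero_of_lt
    have h3 : v ((algebraMap K Γ c) ^ (q ^ m - 1) - η₀ ^ (q ^ m - 1)) < 1 := by
      rw [← Commute.mul_geom_sum₂ (Commute.all _ _), map_mul, ← v.map_neg, neg_sub]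
      refine mul_lt_one_of_lt_of_le hc (v.map_sum_le fun i _ => ?_)
      rw [map_mul, map_pow, map_pow, hcv, hv, one_pow, one_pow, one_mul]
    have h4 : algebraMap K Γ (c ^ (q ^ m - 1) - 1) =
        ((algebraMap K Γ c) ^ (q ^ m - 1) - η₀ ^ (q ^ m - 1)) + e := by
      rw [hη₀, map_sub, map_pow, map_one]; ring
    rw [h4]
    exact v.map_add_lt h3 he
  refine ⟨η₀ / algebraMap K Γ c, ?_, ?_⟩
  · rw [div_pow, ← map_pow, hpow, map_one, div_one, hη₀]
  · set μ := η₀ / algebraMap K Γ c - 1 with hμ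
    have hμ1 : v μ < 1 := by
      have : μ = (η₀ - algebraMap K Γ c) / algebraMap K Γ c := by rw [hμ]; field_simp
      rwa [this, map_div₀, hcv, div_one]
    have hη : (1 + μ) ^ (q ^ m - 1) = 1 + e := by
      rw [hμ, add_sub_cancel, div_pow, ← map_pow, hpow, map_one, div_one, hη₀]
    have hη' : (1 + μ) ^ q ^ m = (1 + e) * (1 + μ) := by
      rw [← hη, ← pow_succ, Nat.sub_add_cancel (by omega)]
    rw [qpow_add hq, one_pow] at hη'
    have h5 : e = μ ^ q ^ m - μ * (1 + e) := by linear_combination -hη'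
    by_contra! hlt
    have h0 : v μ ≠ 0 := (zero_le.trans_lt hlt).ne'
    have h6 : v (μ ^ q ^ m) < v (μ * (1 + e)) := by
      rw [map_mul, hv1, mul_one, map_pow]
      exact pow_lt_self_of_lt_one₀ (zero_lt_iff.2 h0) hμ1 h2
    have h7 := congrArg v h5
    rw [v.map_sub_eq_of_lt_right h6, map_mul, hv1, mul_one] at h7
    exact hlt.ne h7

end Root

end Valued

/-! ### Steps of the tower over a valued field -/

section Near

variable {Γ Γ₀ : Type*} [Field Γ] [LinearOrderedCommGroupWithZero Γ₀]

/-- `f` differs from an additive polynomial in `Y` by an integral element. -/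
def IsNear (v : Valuation Γ Γ₀) (K : Type*) [Field K] [Algebra K Γ] (p : ℕ) (Y f : Γ) : Prop :=
  ∃ s ∈ addSpan K p Y, v (f - s) ≤ 1

variable {v : Valuation Γ Γ₀} {K : Type*} [Field K] [Algebra K Γ] {p : ℕ} {Y f g : Γ}

lemma IsNear.of_mem (h : f ∈ addSpan K p Y) : IsNear v K p Y f := ⟨f, h, by simp⟩

lemma IsNear.congr (h : IsNear v K p Y f) (hg : v (g - f) ≤ 1) : IsNear v K p Y g := by
  obtain ⟨s, hs, h1⟩ := h
  refine ⟨s, hs, ?_⟩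
  have := v.map_add_le hg h1
  rwa [sub_add_sub_cancel] at this

lemma IsNear.sub (hf : IsNear v K p Y f) (hg : IsNear v K p Y g) : IsNear v K p Y (f - g) := by
  obtain ⟨s, hs, h1⟩ := hf
  obtain ⟨t, ht, h2⟩ := hg
  refine ⟨s - t, sub_mem hs ht, ?_⟩
  rw [sub_sub_sub_comm]
  exact v.map_sub_le h1 h2

lemma IsNear.const_mul (hK : HasConstantResidues v K) (hf : IsNear v K p Y f) (c : K) :
    IsNear v K p Y (algebraMap K Γ c * f) := by
  obtain ⟨s, hs, h1⟩ := hf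
  refine ⟨c • s, Submodule.smul_mem _ _ hs, ?_⟩
  rw [Algebra.smul_def, ← mul_sub, map_mul]
  exact mul_le_one' (hK.map_const_le c) h1

variable [Fact p.Prime] [CharP Γ p]

lemma IsNear.qpow {q r : ℕ} (hq : q = p ^ r) (hf : IsNear v K p Y f) (j : ℕ) :
    IsNear v K p Y (f ^ q ^ j) := by
  obtain ⟨s, hs, h1⟩ := hf
  refine ⟨s ^ q ^ j, qpow_mem_addSpan hq hs j, ?_⟩
  rw [← qpow_sub hq, map_pow]
  exact pow_le_one₀ zero_le h1

lemma IsNear.mono {Y' : Γ} (hf : IsNear v K p Y f) (h : Y ∈ addSpan K p Y') :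
    IsNear v K p Y' f := by
  obtain ⟨s, hs, h1⟩ := hf
  exact ⟨s, addSpan_le h hs, h1⟩

end Near

section State

variable {Γ Γ₀ : Type*} [Field Γ] [LinearOrderedCommGroupWithZero Γ₀]

/-- The situation at a zero of `ζ`: up to integral elements, a root of order `q ^ b - 1` of
`1 + 1 / ζ` is an additive polynomial in `Y`. -/
def ZeroState (v : Valuation Γ Γ₀) (K : Type*) [Field K] [Algebra K Γ] (p q b : ℕ) (Y ζ : Γ) :
    Prop :=
  ζ ≠ 0 ∧ v ζ < 1 ∧ ∃ θ, θ ^ (q ^ b - 1) = 1 + ζ⁻¹ ∧ IsNear v K p Y θ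

/-- The situation at a pole of `ζ`: up to integral elements, a root of order `q ^ a - 1` of
`1 + ζ` is an additive polynomial in `Y`. -/
def PoleState (v : Valuation Γ Γ₀) (K : Type*) [Field K] [Algebra K Γ] (p q a : ℕ) (Y ζ : Γ) :
    Prop :=
  1 < v ζ ∧ ∃ η, η ^ (q ^ a - 1) = 1 + ζ ∧ IsNear v K p Y η

variable {v : Valuation Γ Γ₀} {K : Type*} [Field K] [Algebra K Γ] {p r q : ℕ}

lemma ZeroState.mono [Fact p.Prime] [CharP Γ p] {b : ℕ} {Y Y' ζ : Γ}
    (h : ZeroState v K p q b Y ζ) (hY : Y ∈ addSpan K p Y') : ZeroState v K p q b Y' ζ := by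
  obtain ⟨h0, h1, θ, h2, h3⟩ := h
  exact ⟨h0, h1, θ, h2, h3.mono hY⟩

lemma PoleState.mono [Fact p.Prime] [CharP Γ p] {a : ℕ} {Y Y' ζ : Γ}
    (h : PoleState v K p q a Y ζ) (hY : Y ∈ addSpan K p Y') : PoleState v K p q a Y' ζ := by
  obtain ⟨h1, η, h2, h3⟩ := h
  exact ⟨h1, η, h2, h3.mono hY⟩

/-- A small perturbation `γ ↦ γ + δ` of the parameter over the same small `ζ` is trivial. -/
lemma map_param_eq [Fact p.Prime] [CharP Γ p] (hq : q = p ^ r) (hr : 1 ≤ r) {a b : ℕ}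
    (ha : 1 ≤ a) {ζ γ α : Γ} {u w : ℤ} (hα : α = u + qTrace q b γ)
    (hβ : -(ζ * α ^ q ^ a) = w - qTrace q a γ) (hζ : v ζ < 1) (σ : Γ ≃ₐ[K] Γ) (hσ : σ ζ = ζ)
    (hδ : v (σ γ - γ) < 1) : σ γ = γ := by
  rw [← sub_eq_zero]
  refine eq_zero_of_mul_qTrace_eq (b := b) hq hr ha hζ hδ ?_
  have h1 := congrArg σ hβ
  have h2 := congrArg σ hα
  simp only [map_neg, map_mul, map_pow, map_sub, map_add, map_intCast, map_qTrace, hσ] at h1 h2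
  have h3 : qTrace q b (σ γ - γ) = σ α - α := by rw [qTrace_sub hq, h2, hα]; ring
  rw [h3, qTrace_sub hq, qpow_sub hq]
  linear_combination hβ - h1

section ZeroZero

variable [Fact p.Prime] [CharP Γ p]

/-- A step at a zero of `ζ` where the parameter is integral leads to a zero, and involves no
extension at all. -/
lemma TowerStep.zero_zero (hK : HasConstantResidues v K) (hq : q = p ^ r) (hr : 1 ≤ r) {a b : ℕ}
    (ha : 1 ≤ a) (hb : 1 ≤ b) {Y ζ α ζ' γ : Γ} {u w : ℤ} (h : TowerStep q a b ζ α ζ')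
    (hα : α = u + qTrace q b γ) (hβ : -(ζ * α ^ q ^ a) = w - qTrace q a γ)
    (hs : ZeroState v K p q b Y ζ) (hγ : v γ ≤ 1) :
    ZeroState v K p q b Y ζ' ∧
      ∀ σ : Γ ≃ₐ[K] Γ, (∀ x, v (σ x) = v x) → σ ζ = ζ → σ γ = γ := by
  obtain ⟨h0, hζ, θ, hθ, hn⟩ := hs
  have hα0 := h.ne_zero hq
  obtain ⟨c, hc⟩ := hK.exists_const γ hγ
  refine ⟨?_, fun σ hσ hσζ => map_param_eq hq hr ha hα hβ hζ σ hσζ ?_⟩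
  swap
  · have : σ γ - γ = σ (γ - algebraMap K Γ c) - (γ - algebraMap K Γ c) := by simp
    rw [this]
    exact (v.map_sub _ _).trans_lt (max_lt (by rwa [hσ]) hc)
  set μ := γ - algebraMap K Γ c with hμ
  have hγ' : γ = algebraMap K Γ c + μ := by rw [hμ]; ring
  set β := -(ζ * α ^ q ^ a) with hβdef
  have hα1 : v α ≤ 1 := by
    rw [hα]
    exact v.map_add_le (hK.map_intCast_le u) ((map_qTrace_le hq hγ b).trans hγ)
  have hβζ : v β = v ζ * v α ^ q ^ a := by rw [hβdef, v.map_neg, map_mul, map_pow]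
  have hβ1 : v β < 1 := by
    rw [hβζ]; exact mul_lt_one_of_lt_of_le hζ (pow_le_one₀ zero_le hα1)
  have hαv : v α = 1 := by
    refine le_antisymm hα1 (not_lt.1 fun hlt => ?_)
    have h1 := h.trace_eq
    have h2 := v.map_add_lt ((map_qTrace_le hq hlt.le a).trans_lt hlt)
      ((map_qTrace_le hq hβ1.le b).trans_lt hβ1)
    rw [h1, map_one] at h2
    exact h2.false
  rw [hαv, one_pow, mul_one] at hβζ
  -- the residue of `α` approximates `α` up to the order of `ζ`
  have hconst : qTrace q a c - (w : K) = 0 := by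
    refine hK.eq_zero_of_lt ?_
    have h1 : algebraMap K Γ (qTrace q a c - (w : K)) = -β - qTrace q a μ := by
      rw [map_sub, map_qTrace, map_intCast, hβ, hγ', qTrace_add hq]; ring
    rw [h1]
    refine (v.map_sub _ _).trans_lt (max_lt (by rwa [v.map_neg]) ?_)
    exact (map_qTrace_le hq hc.le a).trans_lt hc
  have hμv : v μ = v ζ := by
    rw [← map_qTrace_eq hq hr hc ha, ← hβζ, ← v.map_neg β]
    congr 1
    have h1 := congrArg (algebraMap K Γ) hconst
    rw [map_sub, map_qTrace, map_intCast, map_zero] at h1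
    rw [hβ, hγ', qTrace_add hq]
    linear_combination -h1
  set c₀ : K := u + qTrace q b c with hc₀
  have hαc : v (α - algebraMap K Γ c₀) ≤ v ζ := by
    have h1 : α - algebraMap K Γ c₀ = qTrace q b μ := by
      rw [hα, hγ', qTrace_add hq, hc₀, map_add, map_qTrace, map_intCast]; ring
    rw [h1, ← hμv]
    exact map_qTrace_le hq hc.le b
  have hc₀0 : c₀ ≠ 0 := by
    intro h1
    rw [h1, map_zero, sub_zero, hαv] at hαc
    exact hαc.not_gt hζ
  have hcΓ : algebraMap K Γ c₀ ≠ 0 := (map_ne_zero _).2 hc₀0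
  have hcv := hK.map_const c₀ hc₀0
  have hζ'v : v ζ' < 1 := by
    have h1 := congrArg v h.next_mul
    rw [map_mul, hαv, mul_one, v.map_neg, map_pow] at h1
    rw [h1]
    exact pow_lt_one₀ zero_le hβ1 (qpow_ne_zero hq b)
  have hβ0 : β ≠ 0 := neg_ne_zero.2 (mul_ne_zero h0 (pow_ne_zero _ hα0))
  have hM : q ^ b - 1 + 1 = q ^ b :=
    Nat.sub_add_cancel (Nat.one_le_iff_ne_zero.2 (qpow_ne_zero hq b))
  have hM0 : q ^ b - 1 ≠ 0 := by
    have := (two_le_q hq hr).trans (Nat.le_self_pow (by omega : b ≠ 0) q)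
    omega
  refine ⟨h.next_ne_zero hq h0, hζ'v, θ / β, ?_, ?_⟩
  · have h1 := h.beta_pow_eq hq h0
    rw [← hβdef] at h1
    rw [div_pow, hθ, ← h1, mul_div_cancel_left₀ _ (pow_ne_zero _ hβ0)]
  · have hθ1 : θ ^ q ^ b - θ = θ / ζ := by
      rw [← hM, pow_succ, hθ]; field_simp; ring
    have h2 : IsNear v K p Y (algebraMap K Γ (-c₀⁻¹ ^ q ^ a) * (θ ^ q ^ b - θ)) :=
      ((hn.qpow hq b).sub hn).const_mul hK _
    refine h2.congr ?_
    have h3 : θ / β - algebraMap K Γ (-c₀⁻¹ ^ q ^ a) * (θ ^ q ^ b - θ) =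
        (θ / ζ) * ((α - algebraMap K Γ c₀) ^ q ^ a /
          (α ^ q ^ a * algebraMap K Γ c₀ ^ q ^ a)) := by
      rw [hθ1, qpow_sub hq, hβdef, map_neg, map_pow, map_inv₀, inv_pow]
      field_simp
      ring
    have hθv : v θ ≤ (v ζ)⁻¹ := by
      have h4 := congrArg v hθ
      have h5 : v (1 + ζ⁻¹) = (v ζ)⁻¹ := by
        have : v (1 : Γ) < v ζ⁻¹ := by
          rw [map_one, map_inv₀]
          exact (one_lt_inv₀ (zero_lt_iff.2 (v.ne_zero_iff.2 h0))).2 hζ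
        rw [v.map_add_eq_of_lt_right this, map_inv₀]
      rw [h5, map_pow] at h4
      by_cases hle : v θ ≤ 1
      · refine hle.trans ?_
        exact ((one_lt_inv₀ (zero_lt_iff.2 (v.ne_zero_iff.2 h0))).2 hζ).le
      · rw [← h4]; exact le_self_pow₀ (not_le.1 hle).le hM0
    have hζ0 : v ζ ≠ 0 := v.ne_zero_iff.2 h0
    rw [h3, map_mul, map_div₀, map_div₀, map_mul, map_pow, map_pow, map_pow, hαv, hcv, one_pow,
      one_mul, div_one]
    have h6 : v (α - algebraMap K Γ c₀) ^ q ^ a ≤ v ζ ^ 2 := by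
      calc _ ≤ v ζ ^ q ^ a := by gcongr
        _ ≤ v ζ ^ 2 := pow_le_pow_of_le_one zero_le hζ.le
          ((two_le_q hq hr).trans (Nat.le_self_pow (by omega : a ≠ 0) q))
    calc _ ≤ (v ζ)⁻¹ / v ζ * v ζ ^ 2 := by
          rw [div_eq_mul_inv, div_eq_mul_inv]
          exact mul_le_mul' (mul_le_mul' hθv le_rfl) h6
      _ = 1 := by field_simp

end ZeroZero

section Extension

variable [Fact p.Prime] [CharP Γ p] [IsAlgClosed K] [IsAlgClosed Γ]

/-- A step at a zero of `ζ` where the parameter `γ` has a pole leads to a pole: it is the extension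
generated by the solution of `Tr_a(γ) = -c θ`. -/
lemma TowerStep.zero_pole (hK : HasConstantResidues v K) (hq : q = p ^ r) (hr : 1 ≤ r) {a b : ℕ}
    (ha : 1 ≤ a) (hb : 1 ≤ b) {Y₀ Y ζ α ζ' γ : Γ} {j : ℕ} {u w : ℤ}
    (hY : IsAddRoot K p Y₀ j Y) (h : TowerStep q a b ζ α ζ')
    (hα : α = u + qTrace q b γ) (hβ : -(ζ * α ^ q ^ a) = w - qTrace q a γ)
    (hs : ZeroState v K p q b Y ζ) (hγ : 1 < v γ) :
    ∃ j' Y', IsAddRoot K p Y₀ j' Y' ∧ Y ∈ addSpan K p Y' ∧ PoleState v K p q a Y' ζ' ∧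
      (∀ σ : Γ ≃ₐ[K] Γ, (∀ x, v (σ x) = v x) → σ ζ = ζ → σ Y' = Y' → σ γ = γ) ∧
      (∀ σ : Γ ≃ₐ[K] Γ, (∀ x, v (σ x) = v x) → σ Y = Y → σ γ = γ → σ Y' = Y') := by
  obtain ⟨h0, hζ, θ, hθ, hn⟩ := hs
  have hα0 := h.ne_zero hq
  have hq2 := two_le_q hq hr
  have hQ2 : 2 ≤ q ^ a := hq2.trans (Nat.le_self_pow (by omega) q)
  have hA1 : 1 ≤ q ^ (a - 1) := Nat.one_le_pow _ _ (by omega)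
  have hB1 : 1 ≤ q ^ (b - 1) := Nat.one_le_pow _ _ (by omega)
  have hAq : q ^ a = q ^ (a - 1) * q := by rw [← pow_succ, Nat.sub_add_cancel ha]
  have hBq : q ^ b = q ^ (b - 1) * q := by rw [← pow_succ, Nat.sub_add_cancel hb]
  set β := -(ζ * α ^ q ^ a) with hβdef
  have hβv : v β = v γ ^ q ^ (a - 1) := by
    rw [hβ, ← map_qTrace_of_one_lt hq hr hγ ha]
    refine v.map_sub_eq_of_lt_right ((hK.map_intCast_le w).trans_lt ?_)
    rw [map_qTrace_of_one_lt hq hr hγ ha]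
    exact one_lt_pow₀ hγ (by omega)
  have hαv : v α = v γ ^ q ^ (b - 1) := by
    rw [hα, ← map_qTrace_of_one_lt hq hr hγ hb]
    refine v.map_add_eq_of_lt_right ((hK.map_intCast_le u).trans_lt ?_)
    rw [map_qTrace_of_one_lt hq hr hγ hb]
    exact one_lt_pow₀ hγ (by omega)
  have hγ0 : v γ ≠ 0 := (zero_lt_one.trans hγ).ne'
  have hα0' : v α ≠ 0 := v.ne_zero_iff.2 hα0
  have hβζ : v β = v ζ * v α ^ q ^ a := by rw [hβdef, v.map_neg, map_mul, map_pow]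
  have hζ'v : v ζ' * v γ ^ q ^ (b - 1) = v γ ^ (q ^ (a - 1) * q ^ b) := by
    have h1 := congrArg v h.next_mul
    rwa [map_mul, hαv, v.map_neg, map_pow, hβv, ← pow_mul] at h1
  have hζ'1 : 1 < v ζ' := by
    by_contra! hle
    have h1 : v γ ^ (q ^ (a - 1) * q ^ b) ≤ v γ ^ q ^ (b - 1) := by
      rw [← hζ'v]; exact mul_le_of_le_one_left' hle
    have h2 := (pow_le_pow_iff_right₀ hγ).1 h1
    nlinarith
  have hζ'0 : ζ' ≠ 0 := v.ne_zero_iff.1 (zero_lt_one.trans hζ'1).ne'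
  have hinv : v ζ'⁻¹ < 1 := by rw [map_inv₀]; exact inv_lt_one_of_one_lt₀ hζ'1
  obtain ⟨η, hη, hηv⟩ := hK.exists_root_one_add hq hr ha hζ
  obtain ⟨θ', hθ', hθ'v⟩ := hK.exists_root_one_add hq hr hb hinv
  -- `α η` is a root of `1 + ζ'` close to `α`
  have hη' : v (α * η - α) ≤ 1 := by
    have h1 : v α * v ζ * v α ^ (q ^ a - 1) = v β := by
      have : v α ^ q ^ a = v α ^ (q ^ a - 1) * v α := by
        rw [← pow_succ, Nat.sub_add_cancel (by omega)]
      rw [hβζ, this, mul_comm (v α) (v ζ), mul_assoc, mul_comm (v α)]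
    have h2 : v β ≤ v α ^ (q ^ a - 1) := by
      rw [hβv, hαv, ← pow_mul]
      refine pow_le_pow_right₀ hγ.le ?_
      have h3 : q ^ (a - 1) ≤ q ^ a - 1 := by rw [hAq]; apply Nat.le_sub_one_of_lt; nlinarith
      nlinarith
    have h3 : v α * v ζ ≤ 1 := by
      have h4 : 0 < v α ^ (q ^ a - 1) := zero_lt_iff.2 (pow_ne_zero _ hα0')
      refine le_of_mul_le_mul_right ?_ h4
      rw [h1, one_mul]; exact h2
    have h4 : α * η - α = α * (η - 1) := by ring
    rw [h4, map_mul]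
    exact (mul_le_mul' le_rfl hηv).trans h3
  -- `β θ'` and `θ` differ by a constant factor
  have hθ0 : θ ≠ 0 := by
    rintro rfl
    have hM0 : q ^ b - 1 ≠ 0 := by
      have := hq2.trans (Nat.le_self_pow (by omega : b ≠ 0) q)
      omega
    rw [zero_pow hM0] at hθ
    have h1 : ζ = -1 := by field_simp at hθ; linear_combination -hθ
    rw [h1, v.map_neg, map_one] at hζ
    exact hζ.false
  have hroot : ∃ ω : K, algebraMap K Γ ω = β * θ' / θ := by
    have hM0 : 0 < q ^ b - 1 := by
      have := hq2.trans (Nat.le_self_pow (by omega : b ≠ 0) q)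
      omega
    refine exists_algebraMap_eq_of_aeval_eq_zero (P := Polynomial.X ^ (q ^ b - 1) - Polynomial.C 1)
      (Polynomial.X_pow_sub_C_ne_zero hM0 1) ?_
    have h1 := h.beta_pow_eq hq h0
    rw [← hβdef, ← hθ', ← hθ] at h1
    simp only [map_sub, map_pow, Polynomial.aeval_X, map_one]
    rw [div_pow, mul_pow, h1, div_self (pow_ne_zero _ hθ0), sub_self]
  obtain ⟨ω, hω⟩ := hroot
  have hnβ : IsNear v K p Y β := by
    refine (hn.const_mul hK ω).congr ?_
    have h1 : β - algebraMap K Γ ω * θ = β * -(θ' - 1) := by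
      rw [hω]; field_simp; ring
    rw [h1, map_mul, v.map_neg (θ' - 1)]
    refine (mul_le_mul' le_rfl hθ'v).trans ?_
    rw [map_inv₀, ← div_eq_mul_inv, div_le_one₀ (zero_lt_one.trans hζ'1)]
    have h4 : 0 < v γ ^ q ^ (b - 1) := zero_lt_iff.2 (pow_ne_zero _ hγ0)
    refine le_of_mul_le_mul_right ?_ h4
    rw [hζ'v, hβv, ← pow_add]
    refine pow_le_pow_right₀ hγ.le ?_
    rw [hBq]
    nlinarith [mul_le_mul hA1 hB1 zero_le_one (by omega)]
  obtain ⟨s, hs, hsv⟩ := hnβ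
  obtain ⟨g, hg⟩ := exists_qTrace_eq hq hr ha (-s)
  obtain ⟨j', Y', hY', hYY', hgY', hσ⟩ :=
    hY.exists_qTrace (t := g) hq hr ha (by rw [hg]; exact neg_mem hs)
  have hγg : v (γ - g) ≤ 1 := by
    refine le_one_of_map_qTrace_le hq hr ha ?_
    have h1 : qTrace q a (γ - g) = w - (β - s) := by
      rw [qTrace_sub hq, hg, hβ]; ring
    rw [h1]
    exact v.map_sub_le (hK.map_intCast_le w) hsv
  obtain ⟨c, hc⟩ := hK.exists_const _ hγg
  set t := g + algebraMap K Γ c with ht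
  have htY' : t ∈ addSpan K p Y' := add_mem hgY' (algebraMap_mem_addSpan Y' c)
  have hγt : v (γ - t) < 1 := by rwa [ht, ← sub_sub]
  have hmove : ∀ σ : Γ ≃ₐ[K] Γ, (∀ x, v (σ x) = v x) → v (σ (γ - t) - (γ - t)) < 1 :=
    fun σ hσv => (v.map_sub _ _).trans_lt (max_lt (by rwa [hσv]) hγt)
  refine ⟨j', Y', hY', hYY', ⟨hζ'1, α * η, ?_, ?_⟩, ?_, ?_⟩
  · rw [mul_pow, hη, h.pow_sub_one_eq hq]
  · have h1 : IsNear v K p Y' (u + qTrace q b t) :=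
      IsNear.of_mem (add_mem (intCast_mem_addSpan Y' u) (qTrace_mem_addSpan hq htY' b))
    refine (h1.congr (g := α) ?_).congr hη'
    have h2 : α - (u + qTrace q b t) = qTrace q b (γ - t) := by
      rw [qTrace_sub hq, hα]; ring
    rw [h2]
    exact (map_qTrace_le hq hγt.le b).trans hγt.le
  · intro σ hσv hσζ hσY'
    refine map_param_eq hq hr ha hα hβ hζ σ hσζ ?_
    have h1 := hmove σ hσv
    rw [map_sub σ, map_eq_of_mem_addSpan hσY' htY'] at h1
    simpa using h1
  · intro σ hσv hσY hσγ
    refine hσ σ hσY ?_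
    rw [← sub_eq_zero]
    refine eq_zero_of_qTrace_eq_zero (v := v) hq hr ?_ ha ?_
    · have h1 := hmove σ hσv
      rw [map_sub σ, hσγ, ht, map_add, AlgEquiv.commutes] at h1
      rw [← v.map_neg]
      convert h1 using 2
      ring
    · rw [qTrace_sub hq, ← map_qTrace, hg, map_neg, map_eq_of_mem_addSpan hσY hs, sub_self]

/-- A step at a pole of `ζ` leads to a pole: it is the extension generated by the solution of
`t ^ (q ^ a) - t = -c η`. -/
lemma TowerStep.pole_pole (hK : HasConstantResidues v K) (hq : q = p ^ r) (hr : 1 ≤ r) {a b : ℕ}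
    (ha : 1 ≤ a) (hb : 1 ≤ b) {Y₀ Y ζ α ζ' γ : Γ} {j : ℕ} {u w : ℤ}
    (hY : IsAddRoot K p Y₀ j Y) (h : TowerStep q a b ζ α ζ')
    (hα : α = u + qTrace q b γ) (hβ : -(ζ * α ^ q ^ a) = w - qTrace q a γ)
    (hs : PoleState v K p q a Y ζ) :
    ∃ j' Y', IsAddRoot K p Y₀ j' Y' ∧ Y ∈ addSpan K p Y' ∧ PoleState v K p q a Y' ζ' ∧
      (∀ σ : Γ ≃ₐ[K] Γ, (∀ x, v (σ x) = v x) → σ ζ = ζ → σ Y' = Y' → σ α = α) ∧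
      (∀ σ : Γ ≃ₐ[K] Γ, (∀ x, v (σ x) = v x) → σ ζ = ζ → σ Y = Y → σ α = α → σ Y' = Y') := by
  obtain ⟨hζ, η, hη, s, hs, hsv⟩ := hs
  have hα0 := h.ne_zero hq
  have hα0' : v α ≠ 0 := v.ne_zero_iff.2 hα0
  have hq2 := two_le_q hq hr
  have hQ2 : 2 ≤ q ^ a := hq2.trans (Nat.le_self_pow (by omega) q)
  set β := -(ζ * α ^ q ^ a) with hβdef
  have hβζ : v β = v ζ * v α ^ q ^ a := by rw [hβdef, v.map_neg, map_mul, map_pow]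
  have hγ : v γ ≤ 1 := by
    by_contra! hγ
    have hβv : v β = v γ ^ q ^ (a - 1) := by
      rw [hβ, ← map_qTrace_of_one_lt hq hr hγ ha]
      refine v.map_sub_eq_of_lt_right ((hK.map_intCast_le w).trans_lt ?_)
      rw [map_qTrace_of_one_lt hq hr hγ ha]
      exact one_lt_pow₀ hγ (qpow_ne_zero hq _)
    have hαv : v α = v γ ^ q ^ (b - 1) := by
      rw [hα, ← map_qTrace_of_one_lt hq hr hγ hb]
      refine v.map_add_eq_of_lt_right ((hK.map_intCast_le u).trans_lt ?_)
      rw [map_qTrace_of_one_lt hq hr hγ hb]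
      exact one_lt_pow₀ hγ (qpow_ne_zero hq _)
    have h1 : v α ^ q ^ a < v β := by
      rw [hβζ]
      exact lt_mul_of_one_lt_left (zero_lt_iff.2 (pow_ne_zero _ hα0')) hζ
    rw [hβv, hαv, ← pow_mul] at h1
    have h2 := (pow_lt_pow_iff_right₀ hγ).1 h1
    have h3 : q ^ (a - 1) ≤ q ^ a := Nat.pow_le_pow_right (by omega) (by omega)
    have h4 : 1 ≤ q ^ (b - 1) := Nat.one_le_pow _ _ (by omega)
    nlinarith
  have hβ1 : v β ≤ 1 := by
    rw [hβ]; exact v.map_sub_le (hK.map_intCast_le w) ((map_qTrace_le hq hγ a).trans hγ)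
  have hα1 : v α < 1 := by
    by_contra! hle
    have h1 : 1 < v β := by
      rw [hβζ]; exact one_lt_mul_of_lt_of_le hζ (one_le_pow₀ hle)
    exact h1.not_ge hβ1
  have hβv : v β = 1 := by
    refine le_antisymm hβ1 (not_lt.1 fun hlt => ?_)
    have h1 := h.trace_eq
    have h2 := v.map_add_lt ((map_qTrace_le hq hα1.le a).trans_lt hα1)
      ((map_qTrace_le hq hlt.le b).trans_lt hlt)
    rw [h1, map_one] at h2
    exact h2.false
  -- the expansion `β = c - α + κ` with `κ` of second order
  obtain ⟨c, hc⟩ := hK.exists_const β hβ1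
  set ε := β - algebraMap K Γ c with hε
  have hβε : β = algebraMap K Γ c + ε := by rw [hε]; ring
  have hsum : qTrace q b ε + qTrace q a α = 0 := by
    have h1 : algebraMap K Γ (1 - qTrace q b c) = qTrace q b ε + qTrace q a α := by
      have h2 := h.trace_eq
      rw [← hβdef, hβε, qTrace_add hq] at h2
      rw [map_sub, map_one, map_qTrace]; linear_combination -h2
    rw [← h1]
    have h3 : v (algebraMap K Γ (1 - qTrace q b c)) < 1 := by
      rw [h1]
      exact v.map_add_lt ((map_qTrace_le hq hc.le b).trans_lt hc)
        ((map_qTrace_le hq hα1.le a).trans_lt hα1)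
    rw [hK.eq_zero_of_lt h3, map_zero]
  have hεv : v ε = v α := by
    rw [← map_qTrace_eq hq hr hc hb, ← map_qTrace_eq hq hr hα1 ha, ← v.map_neg (qTrace q a α)]
    congr 1; linear_combination hsum
  set κ := ε + α with hκ
  have hκv : v κ ≤ v α ^ 2 := by
    have h1 : κ = -((qTrace q b ε - ε) + (qTrace q a α - α)) := by
      rw [hκ]; linear_combination hsum
    have h2 : v α ^ q ≤ v α ^ 2 := pow_le_pow_of_le_one zero_le hα1.le hq2
    rw [h1, v.map_neg]
    refine v.map_add_le ?_ ((map_qTrace_sub_self_le hq hα1.le ha).trans h2)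
    have h3 := map_qTrace_sub_self_le hq hc.le hb
    rw [hεv] at h3
    exact h3.trans h2
  have hηv : v η ^ (q ^ a - 1) = v ζ := by
    rw [← map_pow, hη]
    exact v.map_add_eq_of_lt_right (by rwa [map_one])
  have hη1 : 1 < v η := by
    by_contra! hle
    have := pow_le_one₀ (n := q ^ a - 1) zero_le hle
    rw [hηv] at this
    exact this.not_gt hζ
  have hη0 : v η ≠ 0 := (zero_lt_one.trans hη1).ne'
  have hηα : v (η * α ^ 2) ≤ 1 := by
    have h1 : v (η * α ^ 2) ^ (q ^ a - 1) = v α ^ (q ^ a - 2) := by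
      rw [map_mul, mul_pow, hηv, map_pow, ← pow_mul]
      have h2 : 2 * (q ^ a - 1) = q ^ a + (q ^ a - 2) := by omega
      rw [h2, pow_add, ← mul_assoc, ← hβζ, hβv, one_mul]
    have h3 : v (η * α ^ 2) ^ (q ^ a - 1) ≤ 1 := by rw [h1]; exact pow_le_one₀ zero_le hα1.le
    exact (pow_le_one_iff_of_nonneg zero_le (by omega)).1 h3
  have hηQ : η ^ q ^ a = η * (1 + ζ) := by
    rw [← hη, ← pow_succ', Nat.sub_add_cancel (by omega)]
  have hkey : v ((α * η) ^ q ^ a - α * η + algebraMap K Γ c * η) ≤ 1 := by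
    have h1 : (α * η) ^ q ^ a - α * η + algebraMap K Γ c * η = η * α ^ q ^ a - η * κ := by
      rw [mul_pow, hηQ, hκ, hε, hβdef]; ring
    rw [h1]
    refine v.map_sub_le ?_ ?_
    · refine le_trans ?_ hηα
      rw [map_mul, map_mul, map_pow, map_pow]
      exact mul_le_mul' le_rfl (pow_le_pow_of_le_one zero_le hα1.le hQ2)
    · refine le_trans ?_ hηα
      rw [map_mul, map_mul, map_pow]
      exact mul_le_mul' le_rfl hκv
  obtain ⟨t₀, ht₀⟩ := exists_pow_sub_self_eq (Γ := Γ) hQ2 (-(c • s))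
  have hdiff₀ : v (α * η - t₀) ≤ 1 := by
    refine le_one_of_pow_sub_le hQ2 ?_
    have h1 : (α * η - t₀) ^ q ^ a - (α * η - t₀) =
        ((α * η) ^ q ^ a - α * η + algebraMap K Γ c * η) - algebraMap K Γ c * (η - s) := by
      rw [qpow_sub hq]
      rw [Algebra.smul_def] at ht₀
      linear_combination -ht₀
    rw [h1]
    refine v.map_sub_le hkey ?_
    rw [map_mul]
    exact mul_le_one' (hK.map_const_le c) hsv
  obtain ⟨d, hd⟩ := hK.exists_const _ hdiff₀
  set t := t₀ + algebraMap K Γ d with ht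
  have hdiff : v (α * η - t) < 1 := by rwa [ht, ← sub_sub]
  have htmem : t ^ q ^ a - t ∈ addSpan K p Y := by
    have h1 : t ^ q ^ a - t = -(c • s) + algebraMap K Γ (d ^ q ^ a - d) := by
      rw [ht, qpow_add hq, map_sub, map_pow]; linear_combination ht₀
    rw [h1]
    exact add_mem (neg_mem (Submodule.smul_mem _ _ hs)) (algebraMap_mem_addSpan Y _)
  have hQp : q ^ a = p ^ (r * a) := by rw [hq, ← pow_mul]
  obtain ⟨j', Y', hY', hYY', htY', hσ⟩ := hY.exists_artinSchreier_pow (t := t) (n := r * a)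
    (Nat.mul_ne_zero (by omega) (by omega)) (by rwa [← hQp])
  have hmove : ∀ σ : Γ ≃ₐ[K] Γ, (∀ x, v (σ x) = v x) → v (σ (α * η - t) - (α * η - t)) < 1 :=
    fun σ hσv => (v.map_sub _ _).trans_lt (max_lt (by rwa [hσv]) hdiff)
  -- an automorphism that fixes `Y` and `ζ` fixes `η`
  have hση : ∀ σ : Γ ≃ₐ[K] Γ, (∀ x, v (σ x) = v x) → σ ζ = ζ → σ Y = Y → σ η = η := by
    intro σ hσv hσζ hσY
    have hηne : η ≠ 0 := v.ne_zero_iff.1 hη0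
    obtain ⟨ω, hω⟩ := exists_algebraMap_eq_of_aeval_eq_zero (K := K)
      (P := Polynomial.X ^ (q ^ a - 1) - Polynomial.C 1) (x := σ η / η)
      (Polynomial.X_pow_sub_C_ne_zero (by omega) 1) (by
        simp only [map_sub, map_pow, Polynomial.aeval_X, map_one]
        rw [div_pow, ← map_pow, hη, map_add, map_one, hσζ, ← hη,
          div_self (pow_ne_zero _ hηne), sub_self])
    have h1 : σ η = algebraMap K Γ ω * η := by rw [hω]; field_simp
    have h2 : v (algebraMap K Γ (ω - 1) * η) ≤ 1 := by
      have h3 : algebraMap K Γ (ω - 1) * η = σ (η - s) - (η - s) := by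
        rw [map_sub σ, h1, map_eq_of_mem_addSpan hσY hs, map_sub, map_one]; ring
      rw [h3]
      exact v.map_sub_le (by rwa [hσv]) hsv
    by_cases h4 : ω - 1 = 0
    · rw [h1, sub_eq_zero.1 h4, map_one, one_mul]
    · rw [map_mul, hK.map_const _ h4, one_mul] at h2
      exact absurd hη1 h2.not_gt
  refine ⟨j', Y', hY', hYY', ⟨?_, α * η, ?_, ?_⟩, ?_, ?_⟩
  · have h1 := congrArg v h.next_mul
    rw [map_mul, v.map_neg, map_pow, hβv, one_pow] at h1
    by_contra! hle
    have h2 : v ζ' * v α < 1 := (mul_le_of_le_one_left' hle).trans_lt hα1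
    exact h2.ne h1
  · rw [mul_pow, hη, h.pow_sub_one_eq hq]
  · exact (IsNear.of_mem htY').congr hdiff.le
  · intro σ hσv hσζ hσY'
    have hσY := map_eq_of_mem_addSpan hσY' hYY'
    have h1 := hmove σ hσv
    rw [map_sub σ, map_mul, hση σ hσv hσζ hσY, map_eq_of_mem_addSpan hσY' htY'] at h1
    set δ := σ α - α with hδ
    have h2 : v (δ * η) < 1 := by
      convert h1 using 2
      rw [hδ]; ring
    have h3 : qTrace q a δ = -qTrace q b (-(ζ * δ ^ q ^ a)) := by
      have h4 := h.trace_eq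
      have h5 := congrArg σ h4
      rw [map_add, map_qTrace, map_qTrace, map_one, map_neg, map_mul, map_pow, hσζ] at h5
      have h6 : -(ζ * δ ^ q ^ a) = -(ζ * σ α ^ q ^ a) - -(ζ * α ^ q ^ a) := by
        rw [hδ, qpow_sub hq]; ring
      rw [h6, hδ, qTrace_sub hq, qTrace_sub hq]
      linear_combination h5 - h4
    by_contra hne
    have hδ0 : v δ ≠ 0 := v.ne_zero_iff.2 (sub_ne_zero.2 hne)
    have hδ1 : v δ < 1 := by
      refine lt_of_le_of_lt ?_ h2
      rw [map_mul]; exact le_mul_of_one_le_right' hη1.le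
    have h4 : v (-(ζ * δ ^ q ^ a)) < v δ := by
      have h5 : v δ ^ q ^ a = v δ ^ (q ^ a - 1) * v δ := by
        rw [← pow_succ, Nat.sub_add_cancel (by omega)]
      rw [v.map_neg, map_mul, map_pow, h5, ← mul_assoc, ← hηv, ← mul_pow, mul_comm (v η),
        ← map_mul]
      refine mul_lt_of_lt_one_left (zero_lt_iff.2 hδ0) ?_
      exact pow_lt_one₀ zero_le h2 (by omega)
    have h5 := congrArg v h3
    rw [map_qTrace_eq hq hr hδ1 ha, v.map_neg] at h5
    exact (((map_qTrace_le hq (h4.trans hδ1).le b).trans_lt h4).ne h5.symm)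
  · intro σ hσv hσζ hσY hσα
    refine hσ σ hσY ?_
    rw [← sub_eq_zero]
    refine eq_zero_of_pow_eq_self (v := v) hQ2 ?_ ?_
    · have h1 := hmove σ hσv
      rw [map_sub σ, map_mul, hσα, hση σ hσv hσζ hσY] at h1
      rw [← v.map_neg]
      convert h1 using 2
      ring
    · have h1 := map_eq_of_mem_addSpan hσY htmem
      rw [map_sub, map_pow] at h1
      rw [qpow_sub hq]
      linear_combination h1

end Extension

end State

/-! ### Chains of steps -/

section Chain

variable {Γ Γ₀ : Type*} [Field Γ] [LinearOrderedCommGroupWithZero Γ₀]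
  {v : Valuation Γ Γ₀} {K : Type*} [Field K] [Algebra K Γ] {p r q : ℕ}

/-- The situation at a zero or a pole of `ζ`. -/
def LocalState (v : Valuation Γ Γ₀) (K : Type*) [Field K] [Algebra K Γ] (p q a b : ℕ)
    (Y ζ : Γ) : Prop :=
  ZeroState v K p q b Y ζ ∨ PoleState v K p q a Y ζ

variable [Fact p.Prime] [CharP Γ p]

lemma LocalState.mono {a b : ℕ} {Y Y' ζ : Γ} (h : LocalState v K p q a b Y ζ)
    (hY : Y ∈ addSpan K p Y') : LocalState v K p q a b Y' ζ :=
  h.imp (·.mono hY) (·.mono hY)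

lemma TowerStep.map_next_eq (hq : q = p ^ r) {a b : ℕ} {ζ α ζ' : Γ} (h : TowerStep q a b ζ α ζ')
    (σ : Γ ≃ₐ[K] Γ) (hζ : σ ζ = ζ) (hα : σ α = α) : σ ζ' = ζ' := by
  rw [h.next_eq hq]; simp [hζ, hα]

variable [IsAlgClosed K] [IsAlgClosed Γ]

/-- One step of the tower above a zero or a pole of `ζ`: it replaces the generator `Y` by a root
`Y'` of an additive polynomial, and the same description holds at the next level. -/
theorem TowerStep.exists_addRoot (hK : HasConstantResidues v K) (hq : q = p ^ r) (hr : 1 ≤ r)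
    {a b : ℕ} (ha : 1 ≤ a) (hb : 1 ≤ b) (hab : Nat.gcd a b = 1) {Y₀ Y ζ α ζ' : Γ} {j : ℕ}
    (hY : IsAddRoot K p Y₀ j Y) (h : TowerStep q a b ζ α ζ')
    (hs : LocalState v K p q a b Y ζ) :
    ∃ j' Y', IsAddRoot K p Y₀ j' Y' ∧ Y ∈ addSpan K p Y' ∧ LocalState v K p q a b Y' ζ' ∧
      (∀ σ : Γ ≃ₐ[K] Γ, (∀ x, v (σ x) = v x) → σ ζ = ζ → σ Y' = Y' → σ α = α) ∧
      (∀ σ : Γ ≃ₐ[K] Γ, (∀ x, v (σ x) = v x) → σ ζ = ζ → σ Y = Y → σ α = α → σ Y' = Y') := by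
  obtain ⟨γ, u, w, hα, hβ, hγ⟩ := exists_parametrization hq ha hb hab h.trace_eq
  have hαγ : ∀ σ : Γ ≃ₐ[K] Γ, σ γ = γ → σ α = α := fun σ hσ => by
    rw [hα, map_add, map_intCast, map_qTrace, hσ]
  have hγα : ∀ σ : Γ ≃ₐ[K] Γ, σ ζ = ζ → σ α = α → σ γ = γ := fun σ h1 h2 => by
    have : Subring.closure {α, -(ζ * α ^ q ^ a)} ≤
        RingHom.eqLocus (σ : Γ →+* Γ) (RingHom.id Γ) := by
      rw [Subring.closure_le]
      rintro _ (rfl | rfl)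
      · exact h2
      · simp [RingHom.eqLocus, h1, h2]
    exact this hγ
  rcases hs with hs | hs
  · rcases le_or_gt (v γ) 1 with h1 | h1
    · obtain ⟨h2, h3⟩ := h.zero_zero hK hq hr ha hb hα hβ hs h1
      exact ⟨j, Y, hY, self_mem_addSpan Y, Or.inl h2,
        fun σ hσ hζ _ => hαγ σ (h3 σ hσ hζ), fun _ _ _ h _ => h⟩
    · obtain ⟨j', Y', h2, h3, h4, h5, h6⟩ := h.zero_pole hK hq hr ha hb hY hα hβ hs h1
      exact ⟨j', Y', h2, h3, Or.inr h4, fun σ hσ hζ hY => hαγ σ (h5 σ hσ hζ hY),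
        fun σ hσ hζ hY hα => h6 σ hσ hY (hγα σ hζ hα)⟩
  · obtain ⟨j', Y', h2, h3, h4, h5, h6⟩ := h.pole_pole hK hq hr ha hb hY hα hβ hs
    exact ⟨j', Y', h2, h3, Or.inr h4, h5, h6⟩

/-- A chain of steps is governed by one root `Y'` of an additive polynomial: an automorphism that
fixes `ζ 0` and `Y` fixes the `α i` if and only if it fixes `Y'`. -/
theorem exists_addRoot_of_chain (hK : HasConstantResidues v K) (hq : q = p ^ r) (hr : 1 ≤ r)
    {a b : ℕ} (ha : 1 ≤ a) (hb : 1 ≤ b) (hab : Nat.gcd a b = 1) {Y₀ Y : Γ} {j : ℕ}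
    (hY : IsAddRoot K p Y₀ j Y) (ζ α : ℕ → Γ) (l : ℕ)
    (h : ∀ i < l, TowerStep q a b (ζ i) (α i) (ζ (i + 1)))
    (hs : LocalState v K p q a b Y (ζ 0)) :
    ∃ j' Y', IsAddRoot K p Y₀ j' Y' ∧ Y ∈ addSpan K p Y' ∧ LocalState v K p q a b Y' (ζ l) ∧
      (∀ σ : Γ ≃ₐ[K] Γ, (∀ x, v (σ x) = v x) → σ (ζ 0) = ζ 0 → σ Y' = Y' →
        ∀ i < l, σ (α i) = α i) ∧
      (∀ σ : Γ ≃ₐ[K] Γ, (∀ x, v (σ x) = v x) → σ (ζ 0) = ζ 0 → σ Y = Y →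
        (∀ i < l, σ (α i) = α i) → σ Y' = Y') := by
  induction l with
  | zero => exact ⟨j, Y, hY, self_mem_addSpan Y, hs, by simp, fun _ _ _ h _ => h⟩
  | succ l ih =>
    obtain ⟨j₁, Y₁, h1, h2, h3, h4, h5⟩ := ih fun i hi => h i (hi.trans (Nat.lt_succ_self l))
    obtain ⟨j₂, Y₂, g1, g2, g3, g4, g5⟩ :=
      (h l (Nat.lt_succ_self l)).exists_addRoot hK hq hr ha hb hab h1 h3
    have hζ : ∀ σ : Γ ≃ₐ[K] Γ, σ (ζ 0) = ζ 0 → (∀ i < l, σ (α i) = α i) → σ (ζ l) = ζ l := by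
      intro σ h0 hα
      have : ∀ i ≤ l, σ (ζ i) = ζ i := by
        intro i hi
        induction i with
        | zero => exact h0
        | succ i ihi =>
          exact (h i (by omega)).map_next_eq hq σ (ihi (by omega)) (hα i (by omega))
      exact this l le_rfl
    refine ⟨j₂, Y₂, g1, addSpan_le g2 h2, g3, fun σ hσ h0 hY i hi => ?_, fun σ hσ h0 hY hα => ?_⟩
    · have hY₁ := map_eq_of_mem_addSpan hY g2
      have hα := h4 σ hσ h0 hY₁
      rcases Nat.lt_succ_iff_lt_or_eq.1 hi with hi | rfl
      · exact hα i hi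
      · exact g4 σ hσ (hζ σ h0 hα) hY
    · have hα' : ∀ i < l, σ (α i) = α i := fun i hi => hα i (by omega)
      exact g5 σ hσ (hζ σ h0 hα') (h5 σ hσ h0 hY hα') (hα l (Nat.lt_succ_self l))

/-- Finitely many chains of steps that start from the same `z` are governed by a single root `Y` of
an additive polynomial: an automorphism that fixes `Y₀` fixes `Y` if and only if it fixes all
chains. -/
theorem exists_addRoot_of_chains (hK : HasConstantResidues v K) (hq : q = p ^ r) (hr : 1 ≤ r)
    {a b : ℕ} (ha : 1 ≤ a) (hb : 1 ≤ b) (hab : Nat.gcd a b = 1) {Y₀ z : Γ} {ι : Type*} [Finite ι]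
    (ζ α : ι → ℕ → Γ) (l : ℕ) (hz : ∀ c, ζ c 0 = z)
    (h : ∀ c, ∀ i < l, TowerStep q a b (ζ c i) (α c i) (ζ c (i + 1)))
    (hs : LocalState v K p q a b Y₀ z) :
    ∃ j Y, IsAddRoot K p Y₀ j Y ∧
      (∀ σ : Γ ≃ₐ[K] Γ, (∀ x, v (σ x) = v x) → σ z = z → σ Y = Y →
        ∀ c, ∀ i < l, σ (α c i) = α c i) ∧
      (∀ σ : Γ ≃ₐ[K] Γ, (∀ x, v (σ x) = v x) → σ z = z → σ Y₀ = Y₀ →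
        (∀ c, ∀ i < l, σ (α c i) = α c i) → σ Y = Y) := by
  classical
  have := Fintype.ofFinite ι
  suffices H : ∀ s : Finset ι, ∃ j Y, IsAddRoot K p Y₀ j Y ∧ Y₀ ∈ addSpan K p Y ∧
      (∀ σ : Γ ≃ₐ[K] Γ, (∀ x, v (σ x) = v x) → σ z = z → σ Y = Y →
        ∀ c ∈ s, ∀ i < l, σ (α c i) = α c i) ∧
      (∀ σ : Γ ≃ₐ[K] Γ, (∀ x, v (σ x) = v x) → σ z = z → σ Y₀ = Y₀ →
        (∀ c ∈ s, ∀ i < l, σ (α c i) = α c i) → σ Y = Y) by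
    obtain ⟨j, Y, h1, -, h2, h3⟩ := H Finset.univ
    exact ⟨j, Y, h1, fun σ hσ hz hY c => h2 σ hσ hz hY c (Finset.mem_univ c),
      fun σ hσ hz hY hα => h3 σ hσ hz hY fun c _ => hα c⟩
  intro s
  induction s using Finset.induction_on with
  | empty => exact ⟨0, Y₀, IsAddRoot.refl Y₀, self_mem_addSpan Y₀, by simp, fun _ _ _ h _ => h⟩
  | insert c s _ ih =>
    obtain ⟨j, Y, h1, h2, h3, h4⟩ := ih
    obtain ⟨j', Y', g1, g2, -, g3, g4⟩ := exists_addRoot_of_chain hK hq hr ha hb hab h1 (ζ c) (α c)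
      l (h c) (by rw [hz]; exact hs.mono h2)
    rw [hz] at g3 g4
    refine ⟨j', Y', g1, addSpan_le g2 h2, fun σ hσ hz hY d hd => ?_, fun σ hσ hz hY hα => ?_⟩
    · rcases Finset.mem_insert.1 hd with rfl | hd
      · exact g3 σ hσ hz hY
      · exact h3 σ hσ hz (map_eq_of_mem_addSpan hY g2) d hd
    · exact g4 σ hσ hz (h4 σ hσ hz hY fun d hd => hα d (Finset.mem_insert_of_mem hd))
        (hα c (Finset.mem_insert_self c s))

/-- Places where `ζ` is a unit: an automorphism that acts trivially on residues fixes `α`. -/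
lemma TowerStep.map_eq_of_unit (hq : q = p ^ r) (hr : 1 ≤ r) {a b : ℕ} (ha : 1 ≤ a)
    (hb : 1 ≤ b) {N : Type*} [Field N] [CharP N p] {w : Valuation N Γ₀} {ζ α ζ' : N}
    (h : TowerStep q a b ζ α ζ') (hζ : w ζ = 1) (σ : N →+* N) (hσζ : σ ζ = ζ)
    (hσ : ∀ x, w x ≤ 1 → w (σ x - x) < 1) : σ α = α ∧ w ζ' = 1 := by
  have hα1 : w α ≤ 1 := by
    by_contra! hlt
    have h1 : w (-(ζ * α ^ q ^ a)) = w α ^ q ^ a := by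
      rw [w.map_neg, map_mul, hζ, one_mul, map_pow]
    have h2 : 1 < w (-(ζ * α ^ q ^ a)) := by rw [h1]; exact one_lt_pow₀ hlt (qpow_ne_zero hq a)
    have h3 : w (qTrace q a α) < w (qTrace q b (-(ζ * α ^ q ^ a))) := by
      rw [map_qTrace_of_one_lt hq hr hlt ha, map_qTrace_of_one_lt hq hr h2 hb, h1, ← pow_mul,
        ← pow_add]
      exact pow_lt_pow_right₀ hlt (Nat.pow_lt_pow_right (two_le_q hq hr) (by omega))
    have h4 := congrArg w h.trace_eq
    rw [w.map_add_eq_of_lt_right h3, map_one, map_qTrace_of_one_lt hq hr h2 hb] at h4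
    exact (one_lt_pow₀ h2 (qpow_ne_zero hq _)).ne' h4
  have hα : w α = 1 := by
    refine le_antisymm hα1 (not_lt.1 fun hlt => ?_)
    have hβ : w (-(ζ * α ^ q ^ a)) < 1 := by
      rw [w.map_neg, map_mul, hζ, one_mul, map_pow]
      exact pow_lt_one₀ zero_le hlt (qpow_ne_zero hq a)
    have h2 := w.map_add_lt ((map_qTrace_le hq hlt.le a).trans_lt hlt)
      ((map_qTrace_le hq hβ.le b).trans_lt hβ)
    rw [h.trace_eq, map_one] at h2
    exact h2.false
  refine ⟨?_, ?_⟩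
  · set δ := σ α - α with hδ
    have hδ1 : w δ < 1 := hσ α hα1
    have h3 : qTrace q a δ = -qTrace q b (-(ζ * δ ^ q ^ a)) := by
      have h4 := h.trace_eq
      have h5 := congrArg σ h4
      rw [map_add, map_qTrace, map_qTrace, map_one, map_neg, map_mul, map_pow, hσζ] at h5
      have h6 : -(ζ * δ ^ q ^ a) = -(ζ * σ α ^ q ^ a) - -(ζ * α ^ q ^ a) := by
        rw [hδ, qpow_sub hq]; ring
      rw [h6, hδ, qTrace_sub hq, qTrace_sub hq]
      linear_combination h5 - h4
    by_contra hne
    have hδ0 : w δ ≠ 0 := w.ne_zero_iff.2 (sub_ne_zero.2 hne)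
    have hQ2 : 2 ≤ q ^ a := (two_le_q hq hr).trans (Nat.le_self_pow (by omega) q)
    have h4 : w (-(ζ * δ ^ q ^ a)) < w δ := by
      rw [w.map_neg, map_mul, hζ, one_mul, map_pow]
      exact pow_lt_self_of_lt_one₀ (zero_lt_iff.2 hδ0) hδ1 hQ2
    have h5 := congrArg w h3
    rw [map_qTrace_eq hq hr hδ1 ha, w.map_neg] at h5
    exact (((map_qTrace_le hq (h4.trans hδ1).le b).trans_lt h4).ne h5.symm)
  · rw [h.next_eq_mul hq, map_mul, map_pow, map_pow, hζ, hα, one_pow, one_pow, one_mul]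

end Chain

/-! ### Valued fields with an invariant valuation -/

section Fixed

variable {E Γ : Type*} [Field E] [Field Γ] [IsAlgClosed Γ] [Algebra E Γ] [Algebra.IsAlgebraic E Γ]

lemma normal_of_isAlgClosed (E Γ : Type*) [Field E] [Field Γ] [IsAlgClosed Γ] [Algebra E Γ]
    [Algebra.IsAlgebraic E Γ] : Normal E Γ :=
  have : IsAlgClosure E Γ := ⟨inferInstance, inferInstance⟩
  IsAlgClosure.normal E Γ

lemma mem_range_algebraMap_of_forall_eq {x : Γ} (hx : IsSeparable E x)
    (h : ∀ σ : Γ ≃ₐ[E] Γ, σ x = x) : x ∈ (algebraMap E Γ).range := by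
  rw [← minpoly.natDegree_eq_one_iff]
  have := normal_of_isAlgClosed E Γ
  have hsp := IsAlgClosed.splits ((minpoly E x).map (algebraMap E Γ))
  have hsep : ((minpoly E x).map (algebraMap E Γ)).Separable := Polynomial.Separable.map hx
  have hcard := hsp.natDegree_eq_card_roots
  rw [Polynomial.natDegree_map] at hcard
  have hnodup := Polynomial.nodup_roots hsep
  have hsub : ∀ y ∈ ((minpoly E x).map (algebraMap E Γ)).roots, y = x := fun y hy => by
    rw [← Polynomial.aroots_def, Polynomial.mem_aroots] at hy
    obtain ⟨σ, hσ⟩ := minpoly.exists_algEquiv_of_root (Algebra.IsAlgebraic.isAlgebraic x) hy.2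
    rw [← h σ.symm, ← hσ, AlgEquiv.symm_apply_apply]
  have hle : ((minpoly E x).map (algebraMap E Γ)).roots ≤ {x} :=
    (Multiset.le_iff_subset hnodup).2 fun y hy => by simpa using hsub y hy
  have := Multiset.card_le_card hle
  have h0 := minpoly.natDegree_pos (Algebra.IsIntegral.isIntegral (R := E) x)
  rw [Multiset.card_singleton] at this
  omega

end Fixed

section Max

variable {Γ Γ₀ : Type*} [Field Γ] [LinearOrderedCommGroupWithZero Γ₀] (v : Valuation Γ Γ₀)

lemma exists_map_sum_eq {ι : Type*} (s : Finset ι) (hs : s.Nonempty) (f : ι → Γ)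
    (h : ∀ i ∈ s, ∀ j ∈ s, f i ≠ 0 → v (f i) = v (f j) → i = j) :
    ∃ i ∈ s, v (∑ j ∈ s, f j) = v (f i) ∧ ∀ j ∈ s, v (f j) ≤ v (f i) := by
  classical
  obtain ⟨i, hi, hmax⟩ := s.exists_max_image (fun i => v (f i)) hs
  refine ⟨i, hi, ?_, hmax⟩
  rcases eq_or_ne (f i) 0 with h0 | h0
  · have : ∀ j ∈ s, f j = 0 := fun j hj => by
      have := hmax j hj
      rw [h0, map_zero, le_zero_iff] at this
      exact v.zero_iff.1 this
    rw [Finset.sum_eq_zero this, h0]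
  · rw [← Finset.add_sum_erase s f hi]
    refine v.map_add_eq_of_lt_left ?_
    refine v.map_sum_lt (v.ne_zero_iff.2 h0) fun j hj => ?_
    rw [Finset.mem_erase] at hj
    exact lt_of_le_of_ne (hmax j hj.2) fun hh => hj.1 (h i hi j hj.2 h0 hh.symm).symm

end Max

section Residues

variable {Γ Γ₀ : Type*} [Field Γ] [LinearOrderedCommGroupWithZero Γ₀] {v : Valuation Γ Γ₀}
  {C K E : Type*} [Field C] [Field K] [Field E] [Algebra C K] [Algebra C Γ] [Algebra K Γ]
  [IsScalarTower C K Γ] [Algebra E Γ]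

lemma coeff_prod_X_sub_C_le_one {s : Multiset Γ} (hs : ∀ x ∈ s, v x ≤ 1) (i : ℕ) :
    v ((s.map fun x => Polynomial.X - Polynomial.C x).prod.coeff i) ≤ 1 := by
  have h : (s.map fun x => Polynomial.X - Polynomial.C x).prod ∈
      Polynomial.lifts v.integer.subtype := by
    refine multiset_prod_mem _ fun f hf => ?_
    obtain ⟨x, hx, rfl⟩ := Multiset.mem_map.1 hf
    exact ⟨Polynomial.X - Polynomial.C ⟨x, hs x hx⟩, by simp⟩
  obtain ⟨y, hy⟩ := (Polynomial.lifts_iff_coeff_lifts _).1 h i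
  rw [← hy]
  exact y.2

/-- If the residue field of the valued subfield `E` of `Γ` is the constant field `C` and `v` is
invariant under the automorphisms of `Γ` over `E`, then the residue field of `Γ` is the algebraic
closure of `C`: a monic integral polynomial over `E` reduces to a polynomial over `C`. -/
theorem hasConstantResidues_of_invariant [IsAlgClosed K] [IsAlgClosed Γ] [Algebra.IsAlgebraic E Γ]
    (hinv : ∀ (σ : Γ ≃ₐ[E] Γ) x, v (σ x) = v x)
    (hres : ∀ f : E, v (algebraMap E Γ f) ≤ 1 →
      ∃ c : C, v (algebraMap E Γ f - algebraMap C Γ c) < 1) :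
    ∀ x : Γ, v x ≤ 1 → ∃ c : K, v (x - algebraMap K Γ c) < 1 := by
  intro x hx
  have := normal_of_isAlgClosed E Γ
  have hint := Algebra.IsIntegral.isIntegral (R := E) x
  set P := minpoly E x with hP
  have hsp := IsAlgClosed.splits (P.map (algebraMap E Γ))
  have hcoeff : ∀ i, v (algebraMap E Γ (P.coeff i)) ≤ 1 := fun i => by
    rw [← Polynomial.coeff_map, hsp.eq_prod_roots_of_monic ((minpoly.monic hint).map _)]
    refine coeff_prod_X_sub_C_le_one (fun y hy => ?_) i
    rw [← Polynomial.aroots_def, Polynomial.mem_aroots] at hy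
    obtain ⟨σ, hσ⟩ := minpoly.exists_algEquiv_of_root (Algebra.IsAlgebraic.isAlgebraic x) hy.2
    rwa [← hinv σ, hσ]
  choose c hc using fun i => hres _ (hcoeff i)
  set d := P.natDegree
  have hd : d ≠ 0 := (minpoly.natDegree_pos hint).ne'
  set R : Polynomial K := Polynomial.X ^ d +
    ∑ i ∈ Finset.range d, Polynomial.C (algebraMap C K (c i)) * Polynomial.X ^ i with hR
  have hRm : R.Monic := by
    refine Polynomial.monic_X_pow_add ?_
    rw [← Polynomial.mem_degreeLT]
    refine Submodule.sum_mem _ fun i hi => Polynomial.mem_degreeLT.2 ?_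
    exact (Polynomial.degree_C_mul_X_pow_le _ _).trans_lt (by
      exact_mod_cast Finset.mem_range.1 hi)
  have hRx : v (Polynomial.aeval x R) < 1 := by
    have h1 : Polynomial.aeval x P = 0 := minpoly.aeval E x
    rw [Polynomial.aeval_eq_sum_range, Finset.sum_range_succ, (minpoly.monic hint).coeff_natDegree,
      one_smul] at h1
    have h2 : Polynomial.aeval x R = -∑ i ∈ Finset.range d,
        (algebraMap E Γ (P.coeff i) - algebraMap C Γ (c i)) * x ^ i := by
      rw [eq_neg_of_add_eq_zero_right h1 |> fun h => (by
        rw [hR]; simp only [map_add, map_pow, Polynomial.aeval_X, map_sum, map_mul,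
          Polynomial.aeval_C]; rw [h] : Polynomial.aeval x R = -_ + _)]
      simp only [sub_mul, Finset.sum_sub_distrib, Algebra.smul_def,
        ← IsScalarTower.algebraMap_apply]
      ring
    rw [h2, Valuation.map_neg]
    refine v.map_sum_lt one_ne_zero fun i _ => ?_
    rw [map_mul, map_pow]
    exact (mul_le_of_le_one_right' (pow_le_one' hx i)).trans_lt (hc i)
  have hsplit := (IsAlgClosed.splits R).eq_prod_roots_of_monic hRm
  rw [hsplit, map_multiset_prod, map_multiset_prod, Multiset.map_map, Multiset.map_map] at hRx
  by_contra! hcon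
  refine hRx.not_ge ?_
  refine Multiset.one_le_prod ?_
  intro y hy
  obtain ⟨ρ, -, rfl⟩ := Multiset.mem_map.1 hy
  simpa using hcon ρ

end Residues

section Constants

variable {Γ Γ₀ : Type*} [Field Γ] [LinearOrderedCommGroupWithZero Γ₀] {v : Valuation Γ Γ₀}
  {K : Type*} [Field K] [Algebra K Γ] 

/-- Adjoining constants is an unramified extension, linearly disjoint over the constants of the
smaller field: if the residues of the subfield `M` are represented by constants in `M`, then the
value of a combination of constants with coefficients in `M` is the value of an element of `M`,
and linear relations between constants over `M` are preserved by the endomorphisms of `K` that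
fix the constants in `M`. -/
theorem constants_combination (hK : HasConstantResidues v K) (M : Subfield Γ)
    (hM : ∀ f ∈ M, v f ≤ 1 → ∃ c : K, algebraMap K Γ c ∈ M ∧ v (f - algebraMap K Γ c) < 1)
    (τ : K →+* K) (hτ : ∀ c : K, algebraMap K Γ c ∈ M → τ c = c) {ι : Type*} (s : Finset ι)
    (c : ι → K) (e : ι → Γ) (he : ∀ i, e i ∈ M) :
    (∃ f ∈ M, v (∑ i ∈ s, e i * algebraMap K Γ (c i)) = v f) ∧
      (∑ i ∈ s, e i * algebraMap K Γ (c i) = 0 → ∑ i ∈ s, e i * algebraMap K Γ (τ (c i)) = 0) := by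
  classical
  induction s using Finset.strongInduction generalizing e with
  | H s ih =>
  rcases s.eq_empty_or_nonempty with rfl | hs
  · exact ⟨⟨0, M.zero_mem, by simp⟩, by simp⟩
  obtain ⟨i, hi, hmax⟩ := s.exists_max_image (fun i => v (e i)) hs
  rcases eq_or_ne (e i) 0 with h0 | h0
  · have : ∀ j ∈ s, e j = 0 := fun j hj => by
      have := hmax j hj
      rw [h0, map_zero, le_zero_iff] at this
      exact v.zero_iff.1 this
    have h2 : ∀ g : ι → Γ, ∑ j ∈ s, e j * g j = 0 := fun g =>
      Finset.sum_eq_zero fun j hj => by rw [this j hj, zero_mul]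
    exact ⟨⟨0, M.zero_mem, by rw [h2]⟩, fun _ => h2 _⟩
  have hv0 : v (e i) ≠ 0 := v.ne_zero_iff.2 h0
  -- the residues of the coefficients, after division by the largest one
  have hr : ∀ j, ∃ d : K, algebraMap K Γ d ∈ M ∧
      (j ∈ s → v (e j / e i - algebraMap K Γ d) < 1) := fun j => by
    by_cases hj : j ∈ s
    · obtain ⟨d, h1, h2⟩ := hM (e j / e i) (M.div_mem (he j) (he i)) (by
        rw [map_div₀]; exact div_le_one_of_le₀ (hmax j hj) zero_le)
      exact ⟨d, h1, fun _ => h2⟩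
    · exact ⟨0, by simp, fun h => absurd h hj⟩
  choose d hdM hd using hr
  have hdi : d i = 1 := by
    have := hd i hi
    rw [div_self h0, ← map_one (algebraMap K Γ), ← map_sub] at this
    exact (sub_eq_zero.1 (hK.eq_zero_of_lt this)).symm
  have hclose : v (∑ j ∈ s, e j * algebraMap K Γ (c j) -
      e i * algebraMap K Γ (∑ j ∈ s, d j * c j)) < v (e i) := by
    rw [map_sum, Finset.mul_sum, ← Finset.sum_sub_distrib]
    refine v.map_sum_lt hv0 fun j hj => ?_
    have : e j * algebraMap K Γ (c j) - e i * algebraMap K Γ (d j * c j) =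
        e i * ((e j / e i - algebraMap K Γ (d j)) * algebraMap K Γ (c j)) := by
      rw [map_mul]; field_simp
    rw [this, map_mul, map_mul]
    exact mul_lt_of_lt_one_right (zero_lt_iff.2 hv0)
      ((mul_le_of_le_one_right' (hK.map_const_le _)).trans_lt (hd j hj))
  by_cases hsum : ∑ j ∈ s, d j * c j = 0
  · -- the largest term can be eliminated
    have hci : c i = -∑ j ∈ s.erase i, d j * c j := by
      rw [← Finset.add_sum_erase s _ hi, hdi, one_mul] at hsum
      exact eq_neg_of_add_eq_zero_left hsum
    have hsum' : ∑ j ∈ s, d j * τ (c j) = 0 := by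
      have := congrArg τ hsum
      rw [map_sum, map_zero] at this
      rw [← this]
      exact Finset.sum_congr rfl fun j _ => by rw [map_mul, hτ _ (hdM j)]
    have key : ∀ g : ι → K, ∑ j ∈ s, d j * g j = 0 → ∑ j ∈ s, e j * algebraMap K Γ (g j) =
        ∑ j ∈ s.erase i, (e j - e i * algebraMap K Γ (d j)) * algebraMap K Γ (g j) := by
      intro g hg
      have hgi : g i = -∑ j ∈ s.erase i, d j * g j := by
        rw [← Finset.add_sum_erase s _ hi, hdi, one_mul] at hg
        exact eq_neg_of_add_eq_zero_left hg
      rw [← Finset.add_sum_erase s _ hi, hgi, map_neg, map_sum, mul_neg, Finset.mul_sum]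
      simp only [sub_mul, Finset.sum_sub_distrib, map_mul, mul_assoc]
      ring
    obtain ⟨h1, h2⟩ := ih (s.erase i) (Finset.erase_ssubset hi)
      (fun j => e j - e i * algebraMap K Γ (d j))
      (fun j => M.sub_mem (he j) (M.mul_mem (he i) (hdM j)))
    rw [key c hsum, key (fun j => τ (c j)) hsum']
    exact ⟨h1, h2⟩
  · have hval : v (e i * algebraMap K Γ (∑ j ∈ s, d j * c j)) = v (e i) := by
      rw [map_mul, hK.map_const _ hsum, mul_one]
    have := v.map_eq_of_sub_lt (hclose.trans_eq hval.symm)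
    rw [hval] at this
    refine ⟨⟨e i, he i, this⟩, fun h => ?_⟩
    rw [h, map_zero] at this
    exact absurd this.symm hv0

end Constants

section AdjoinConstants

variable {E Γ Γ₀ : Type*} (K : Type*) [Field E] [Field Γ] [Field K]
  [LinearOrderedCommGroupWithZero Γ₀] {v : Valuation Γ Γ₀} [Algebra K Γ] [Algebra E Γ]
  (M : IntermediateField E Γ)

/-- The multiplication map from `M ⊗ K` to `Γ`. -/
def constantsMap : TensorProduct ℤ M K →ₐ[M] Γ :=
  Algebra.TensorProduct.lift (Algebra.ofId M Γ) (algebraMap K Γ).toIntAlgHom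
    fun _ _ => Commute.all _ _

variable [Algebra.IsAlgebraic E Γ]

/-- The compositum of `M` and the field of constants `K`. -/
def adjoinConstants : IntermediateField M Γ :=
  (constantsMap K M).range.toIntermediateField fun _ hx => by
    have : Algebra.IsAlgebraic M Γ := Algebra.IsAlgebraic.tower_top (K := E) M
    exact (constantsMap K M).range.inv_mem_of_algebraic (x := ⟨_, hx⟩)
      (Algebra.IsAlgebraic.isAlgebraic _)

variable {K M}

lemma exists_sum_eq_of_mem_adjoinConstants {x : Γ} (hx : x ∈ adjoinConstants K M) :
    ∃ S : Finset (M × K), x = ∑ i ∈ S, (i.1 : Γ) * algebraMap K Γ i.2 := by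
  obtain ⟨t, rfl⟩ := hx
  obtain ⟨S, rfl⟩ := TensorProduct.exists_finset t
  exact ⟨S, (map_sum (constantsMap K M) _ _).trans (Finset.sum_congr rfl fun _ _ => rfl)⟩

lemma algebraMap_mem_adjoinConstants (c : K) : algebraMap K Γ c ∈ adjoinConstants K M :=
  ⟨1 ⊗ₜ c, by simp [constantsMap]⟩

lemma exists_map_eq_of_mem_adjoinConstants (hK : HasConstantResidues v K)
    (hM : ∀ f ∈ M, v f ≤ 1 → ∃ c : K, algebraMap K Γ c ∈ M ∧ v (f - algebraMap K Γ c) < 1)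
    {x : Γ} (hx : x ∈ adjoinConstants K M) : ∃ f ∈ M, v x = v f := by
  obtain ⟨S, rfl⟩ := exists_sum_eq_of_mem_adjoinConstants hx
  exact (constants_combination hK M.toSubfield hM (RingHom.id K) (fun _ _ => rfl) S
    (fun i => i.2) (fun i => i.1) (fun i => i.1.2)).1

/-- Automorphisms can be prescribed on constants: an endomorphism of the field of constants that
fixes the constants lying in `M` extends to an automorphism over `M`. -/
theorem exists_algEquiv_constants [IsAlgClosed Γ] (hK : HasConstantResidues v K)
    (hM : ∀ f ∈ M, v f ≤ 1 → ∃ c : K, algebraMap K Γ c ∈ M ∧ v (f - algebraMap K Γ c) < 1)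
    (τ : K →+* K) (hτ : ∀ c : K, algebraMap K Γ c ∈ M → τ c = c) :
    ∃ σ : Γ ≃ₐ[M] Γ, ∀ c : K, σ (algebraMap K Γ c) = algebraMap K Γ (τ c) := by
  let f := constantsMap K M
  let g : TensorProduct ℤ M K →ₐ[M] Γ := Algebra.TensorProduct.lift (Algebra.ofId M Γ)
    ((algebraMap K Γ).comp τ).toIntAlgHom fun _ _ => Commute.all _ _
  have hker : RingHom.ker f.rangeRestrict.toRingHom ≤ RingHom.ker g.toRingHom := by
    intro t ht
    replace ht : f t = 0 := congrArg Subtype.val ht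
    change g t = 0
    obtain ⟨S, hS⟩ := TensorProduct.exists_finset t
    rw [hS, map_sum] at ht ⊢
    exact (constants_combination hK M.toSubfield hM τ hτ S (fun i => i.2) (fun i => i.1)
      (fun i => i.1.2)).2 ht
  have : Algebra.IsAlgebraic M Γ := Algebra.IsAlgebraic.tower_top (K := E) M
  have : Normal M Γ := normal_of_isAlgClosed M Γ
  let _ : Field f.range := (f.range.isField_of_algebraic).toField
  let h : f.range →ₐ[M] Γ := f.rangeRestrict.liftOfSurjective f.rangeRestrict_surjective g hker
  have hh : ∀ t, h (f.rangeRestrict t) = g t := fun t => by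
    simp [h]
  let s := h.liftNormal Γ
  refine ⟨AlgEquiv.ofBijective s (Algebra.IsAlgebraic.algHom_bijective s), fun c => ?_⟩
  have h1 : algebraMap K Γ c = algebraMap f.range Γ (f.rangeRestrict (1 ⊗ₜ c)) := by
    change _ = f (1 ⊗ₜ c)
    simp [f, constantsMap]
  rw [h1]
  change s _ = _
  rw [AlgHom.liftNormal_commutes, hh]
  simp [g]

end AdjoinConstants

section TotallyRamified

variable {F Γ Γ₀ : Type*} [Field F] [Field Γ] [LinearOrderedCommGroupWithZero Γ₀]
  {v : Valuation Γ Γ₀} [Algebra F Γ] {w Y : Γ} {d : ℕ}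

lemma exists_map_aeval_eq (hF : ∀ f : F, f ≠ 0 → ∃ m : ℤ, v (algebraMap F Γ f) = v w ^ m)
    (hY : 1 < v Y) (hwY : v w = v Y ^ d) {R : Polynomial F} (hR : R ≠ 0) (hd : R.natDegree < d) :
    ∃ m : ℤ, v (Polynomial.aeval Y R) = v Y ^ m := by
  have hY0 : v Y ≠ 0 := (zero_lt_one.trans hY).ne'
  have hYne : Y ≠ 0 := v.ne_zero_iff.1 hY0
  have hterm : ∀ i, R.coeff i ≠ 0 → ∃ m : ℤ, v (R.coeff i • Y ^ i) = v Y ^ (d * m + i) := by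
    intro i hi
    obtain ⟨m, hm⟩ := hF _ hi
    refine ⟨m, ?_⟩
    rw [Algebra.smul_def, map_mul, hm, map_pow, hwY, zpow_add₀ hY0, zpow_mul, zpow_natCast,
      zpow_natCast]
  rw [Polynomial.aeval_eq_sum_range]
  obtain ⟨i, hi, h1, h2⟩ := exists_map_sum_eq v (Finset.range (R.natDegree + 1)) (by simp)
    (fun i => R.coeff i • Y ^ i) (by
      intro i hi j hj hne heq
      rw [Finset.mem_range] at hi hj
      have hi0 : R.coeff i ≠ 0 := fun h => hne (by simp [h])
      have hj0 : R.coeff j ≠ 0 := fun h => by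
        rw [h, zero_smul, map_zero] at heq
        exact v.ne_zero_iff.2 hne heq
      obtain ⟨m, hm⟩ := hterm i hi0
      obtain ⟨m', hm'⟩ := hterm j hj0
      rw [hm, hm'] at heq
      have := zpow_right_injective₀ (zero_lt_one.trans hY) hY.ne' heq
      have h3 : ((d * m + i : ℤ)) % d = (d * m' + j : ℤ) % d := by rw [this]
      simp only [Int.mul_add_emod_self_left] at h3
      rw [Int.emod_eq_of_lt (by omega) (by omega), Int.emod_eq_of_lt (by omega) (by omega)] at h3
      omega)
  rw [h1]
  have hi0 : R.coeff i ≠ 0 := fun h => by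
    have := h2 R.natDegree (by simp)
    simp only [h, zero_smul, map_zero, le_zero_iff] at this
    rw [v.zero_iff, smul_eq_zero] at this
    rcases this with h | h
    · exact hR (Polynomial.leadingCoeff_eq_zero.1 h)
    · exact pow_ne_zero _ hYne h
  obtain ⟨m, hm⟩ := hterm i hi0
  exact ⟨_, hm⟩

/-- An element `Y` whose value is a `d`-th root of the generator of the value group of `F`, and
which is a root of a polynomial of degree at most `d`, generates a totally ramified extension of
degree `d`: the terms of a polynomial in `Y` of degree less than `d` have distinct values. -/
theorem finrank_eq_and_map_eq_of_root
    (hF : ∀ f : F, f ≠ 0 → ∃ m : ℤ, v (algebraMap F Γ f) = v w ^ m)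
    (hY : 1 < v Y) (hwY : v w = v Y ^ d) {P : Polynomial F} (hP : P ≠ 0)
    (hPY : Polynomial.aeval Y P = 0) (hPd : P.natDegree ≤ d) :
    Module.finrank F (IntermediateField.adjoin F {Y}) = d ∧
      ∀ x ∈ IntermediateField.adjoin F {Y}, x ≠ 0 → ∃ m : ℤ, v x = v Y ^ m := by
  have hint : IsIntegral F Y := isAlgebraic_iff_isIntegral.1 ⟨P, hP, hPY⟩
  have hle : (minpoly F Y).natDegree ≤ d :=
    (Polynomial.natDegree_le_of_dvd (minpoly.dvd F Y hPY) hP).trans hPd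
  have hge : d ≤ (minpoly F Y).natDegree := by
    by_contra! hlt
    obtain ⟨m, hm⟩ := exists_map_aeval_eq hF hY hwY (minpoly.ne_zero hint) hlt
    rw [minpoly.aeval, map_zero] at hm
    exact zpow_ne_zero m (zero_lt_one.trans hY).ne' hm.symm
  refine ⟨(IntermediateField.adjoin.finrank hint).trans (le_antisymm hle hge), ?_⟩
  intro x hx hx0
  obtain ⟨R, hR⟩ := (IntermediateField.adjoin.powerBasis hint).exists_eq_aeval' ⟨x, hx⟩
  have hx' : x = Polynomial.aeval Y (R %ₘ minpoly F Y) := by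
    rw [Polynomial.aeval_modByMonic_eq_self_of_root (minpoly.aeval F Y)]
    have := congrArg (algebraMap _ Γ) hR
    rw [IntermediateField.adjoin.powerBasis_gen, ← Polynomial.aeval_algebraMap_apply] at this
    simpa using this
  rw [hx']
  refine exists_map_aeval_eq hF hY hwY (fun h => hx0 (by rw [hx', h, map_zero])) ?_
  exact (Polynomial.natDegree_modByMonic_lt _ (minpoly.monic hint)
    (minpoly.ne_one F Y)).trans_le hle

end TotallyRamified

section Tame

variable {Γ Γ₀ : Type*} [Field Γ] [LinearOrderedCommGroupWithZero Γ₀] {v : Valuation Γ Γ₀}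
  {K : Type*} [Field K] [Algebra K Γ] [IsAlgClosed K]

/-- A radical that is congruent to an element with an automorphism `σ` acting trivially on its
class modulo principal units is fixed by `σ`: the root of unity by which `σ` multiplies it is
a principal unit. -/
lemma HasConstantResidues.map_eq_of_radical (hK : HasConstantResidues v K) {m : ℕ} (hm : m ≠ 0)
    (σ : Γ ≃ₐ[K] Γ) (hσ : ∀ x, v (σ x) = v x) {Y x : Γ} (h : v ((Y * x) ^ m - 1) < 1)
    (hY : σ (Y ^ m) = Y ^ m) (hx : v (σ x / x - 1) < 1) : σ Y = Y := by
  have hu : Y * x ≠ 0 := fun h0 => by simp [h0, hm] at h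
  have hY0 := left_ne_zero_of_mul hu
  have hx0 := right_ne_zero_of_mul hu
  have hvu : v (Y * x) = 1 := by
    have : v ((Y * x) ^ m) = 1 := by
      rw [← v.map_one]; exact v.map_eq_of_sub_lt (by rwa [v.map_one])
    rw [map_pow] at this
    exact (pow_eq_one_iff_of_nonneg zero_le hm).1 this
  obtain ⟨c, hc⟩ := hK.exists_const _ hvu.le
  have h1 : v (σ (Y * x) - Y * x) < 1 := by
    have : σ (Y * x) - Y * x = σ (Y * x - algebraMap K Γ c) - (Y * x - algebraMap K Γ c) := by
      rw [map_sub σ, AlgEquiv.commutes]; ring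
    rw [this]
    exact v.map_sub_lt (by rwa [hσ]) hc
  have hσY0 : σ Y ≠ 0 := by simpa using hY0
  have hσx0 : σ x ≠ 0 := by simpa using hx0
  have hvσx : v (σ x / x) = 1 := by rw [map_div₀, hσ, div_self (v.ne_zero_iff.2 hx0)]
  have h2 : v (σ Y / Y - 1) < 1 := by
    have : (σ Y / Y - 1) * (σ x / x) = (σ (Y * x) - Y * x) / (Y * x) - (σ x / x - 1) := by
      rw [map_mul σ]; field_simp; ring
    rw [← mul_one (v _), ← hvσx, ← map_mul, this, hvσx]
    refine v.map_sub_lt ?_ hx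
    rwa [map_div₀, hvu, div_one]
  have h3 : (σ Y / Y) ^ m = 1 := by
    rw [div_pow, ← map_pow, hY, div_self (pow_ne_zero m hY0)]
  obtain ⟨e, he⟩ := exists_algebraMap_eq_of_aeval_eq_zero (K := K)
    (P := Polynomial.X ^ m - 1) (Polynomial.X_pow_sub_C_ne_zero (Nat.pos_of_ne_zero hm) (1 : K))
    (x := σ Y / Y) (by simp [h3])
  rw [← he, ← map_one (algebraMap K Γ), ← map_sub] at h2
  have := hK.eq_zero_of_lt h2
  rw [sub_eq_zero.1 this, map_one, eq_comm, div_eq_one_iff_eq hY0] at he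
  exact he

end Tame

/-! ### The polynomial of the first step -/

section StepPoly

open Polynomial

/-- The polynomial of which the parameter `γ` of a tower step at `ζ`, with `α = u + Tr_b γ` and
`-ζ α ^ q ^ a = w - Tr_a γ`, is a root. -/
def stepPoly {R : Type*} [CommRing R] (q a b : ℕ) (u w : ℤ) (ζ : R) : R[X] :=
  C ζ * ((u : R[X]) + qTrace q b X) ^ q ^ a + ((w : R[X]) - qTrace q a X)

variable {R : Type*} [CommRing R] {p r q a b : ℕ} {u w : ℤ} {ζ : R}

lemma aeval_stepPoly {S : Type*} [CommRing S] [Algebra R S] (x : S) :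
    aeval x (stepPoly q a b u w ζ) =
      algebraMap R S ζ * ((u : S) + qTrace q b x) ^ q ^ a + ((w : S) - qTrace q a x) := by
  simp [stepPoly, map_qTrace]

lemma map_stepPoly {S : Type*} [CommRing S] (f : R →+* S) :
    (stepPoly q a b u w ζ).map f = stepPoly q a b u w (f ζ) := by
  rw [← coe_mapRingHom]
  simp only [stepPoly, map_add, map_sub, map_mul, map_pow, map_intCast, map_qTrace]
  simp

variable [Fact p.Prime] [CharP R p]

lemma qTrace_comm (hq : q = p ^ r) (a b : ℕ) (x : R) :
    qTrace q a (qTrace q b x) = qTrace q b (qTrace q a x) := by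
  simp only [qTrace, qpow_sum hq, ← pow_mul]
  rw [Finset.sum_comm]
  simp only [mul_comm]

lemma natDegree_qTrace_X_le (hq : q = p ^ r) (m : ℕ) :
    (qTrace q m (X : R[X])).natDegree ≤ q ^ (m - 1) := by
  refine natDegree_sum_le_of_forall_le _ _ fun j hj => (natDegree_X_pow_le _).trans ?_
  exact Nat.pow_le_pow_right (Nat.pos_of_ne_zero (by simpa using qpow_ne_zero hq 1))
    (Nat.le_sub_one_of_lt (Finset.mem_range.1 hj))

lemma monic_intCast_add_qTrace_X [Nontrivial R] (hq : q = p ^ r) (hr : 1 ≤ r) {m : ℕ}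
    (hm : 1 ≤ m) : ((u : R[X]) + qTrace q m X).Monic ∧
      ((u : R[X]) + qTrace q m X).natDegree = q ^ (m - 1) := by
  obtain ⟨m, rfl⟩ := Nat.exists_eq_add_of_le' hm
  have h1 : (u : R[X]) + qTrace q (m + 1) X =
      X ^ q ^ m + ((u : R[X]) + ∑ j ∈ Finset.range m, X ^ q ^ j) := by
    rw [qTrace, Finset.sum_range_succ]; ring
  have h2 : ((u : R[X]) + ∑ j ∈ Finset.range m, X ^ q ^ j).degree < ((q ^ m : ℕ) : WithBot ℕ) := by
    rw [← mem_degreeLT]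
    refine Submodule.add_mem _ ?_ (Submodule.sum_mem _ fun j hj => ?_)
    · rw [mem_degreeLT, ← C_eq_intCast]
      exact degree_C_le.trans_lt (by exact_mod_cast Nat.pos_of_ne_zero (qpow_ne_zero hq m))
    · rw [mem_degreeLT]
      exact (degree_X_pow_le _).trans_lt (by
        exact_mod_cast Nat.pow_lt_pow_right (two_le_q hq hr) (Finset.mem_range.1 hj))
  have h3 : degree (X ^ q ^ m + ((u : R[X]) + ∑ j ∈ Finset.range m, X ^ q ^ j)) =
      ((q ^ m : ℕ) : WithBot ℕ) := by
    rw [degree_add_eq_left_of_degree_lt (by rwa [degree_X_pow]), degree_X_pow]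
  rw [h1]
  exact ⟨monic_X_pow_add h2, natDegree_eq_of_degree_eq_some h3⟩

lemma derivative_stepPoly (hq : q = p ^ r) (hr : 1 ≤ r) (ha : 1 ≤ a) :
    derivative (stepPoly q a b u w ζ) = -1 := by
  have hq0 : (q : R[X]) = 0 := by
    rw [hq, Nat.cast_pow, CharP.cast_eq_zero, zero_pow (by omega)]
  have h1 : derivative (qTrace q a (X : R[X])) = 1 := by
    obtain ⟨m, rfl⟩ := Nat.exists_eq_add_of_le' ha
    rw [qTrace, Finset.sum_range_succ', map_add, map_sum]
    simp [pow_succ, hq0, derivative_X_pow]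
  obtain ⟨a, rfl⟩ := Nat.exists_eq_add_of_le' ha
  rw [stepPoly, map_add, map_sub, derivative_C_mul, derivative_pow, h1, pow_succ]
  simp [hq0]

lemma coeff_one_stepPoly (hq : q = p ^ r) (hr : 1 ≤ r) (ha : 1 ≤ a) :
    (stepPoly q a b u w ζ).coeff 1 = -1 := by
  have := coeff_derivative (stepPoly q a b u w ζ) 0
  rw [derivative_stepPoly hq hr ha] at this
  simpa using this.symm

lemma qTrace_intCast_add_eq_one (hq : q = p ^ r) (huw : (p : ℤ) ∣ a * u + b * w - 1) :
    qTrace q a (u : R) + qTrace q b (w : R) = 1 := by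
  have h1 : ∀ (m : ℕ) (u : ℤ), qTrace q m (u : R) = m * u := fun m u => by
    simp [qTrace, qpow_intCast hq]
  have h2 := (CharP.intCast_eq_zero_iff R p _).2 huw
  push_cast at h2
  rw [h1, h1]
  linear_combination h2

lemma isCoprime_stepPoly (hq : q = p ^ r) (huw : (p : ℤ) ∣ a * u + b * w - 1) :
    IsCoprime ((u : R[X]) + qTrace q b X) ((w : R[X]) - qTrace q a X) := by
  have hdvd : ∀ (m : ℕ) (f : R[X]), f ∣ qTrace q m f := fun m f =>
    Finset.dvd_sum fun j _ => dvd_pow_self f (qpow_ne_zero hq j)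
  obtain ⟨f, hf⟩ := hdvd a ((u : R[X]) + qTrace q b X)
  obtain ⟨g, hg⟩ := hdvd b ((w : R[X]) - qTrace q a X)
  refine ⟨f, g, ?_⟩
  rw [mul_comm f, mul_comm g, ← hf, ← hg, qTrace_add hq, qTrace_sub hq,
    qTrace_comm hq a b, ← qTrace_intCast_add_eq_one (R := R[X]) hq huw]
  ring

lemma natDegree_stepPoly {F : Type*} [Field F] [CharP F p] (hq : q = p ^ r) (hr : 1 ≤ r)
    (ha : 1 ≤ a) (hb : 1 ≤ b) {ζ : F} (hζ : ζ ≠ 0) :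
    (stepPoly q a b u w ζ).natDegree = q ^ (b - 1) * q ^ a ∧
      (stepPoly q a b u w ζ).leadingCoeff = ζ := by
  obtain ⟨h1, h2⟩ := monic_intCast_add_qTrace_X (R := F) (u := u) hq hr hb
  have h3 := h1.pow (q ^ a)
  have hd : (C ζ * ((u : F[X]) + qTrace q b X) ^ q ^ a).natDegree = q ^ (b - 1) * q ^ a := by
    rw [natDegree_C_mul hζ, natDegree_pow, h2, mul_comm]
  have hlt : ((w : F[X]) - qTrace q a X).degree <
      (C ζ * ((u : F[X]) + qTrace q b X) ^ q ^ a).degree := by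
    rw [degree_eq_natDegree (mul_ne_zero (C_ne_zero.2 hζ) h3.ne_zero), hd]
    refine degree_le_natDegree.trans_lt (Nat.cast_lt.2 ?_)
    refine (natDegree_sub_le _ _).trans_lt (max_lt ?_ ?_)
    · rw [natDegree_intCast]
      exact Nat.mul_pos (Nat.pos_of_ne_zero (qpow_ne_zero hq _))
        (Nat.pos_of_ne_zero (qpow_ne_zero hq _))
    · refine (natDegree_qTrace_X_le hq a).trans_lt ?_
      rw [← pow_add]
      exact Nat.pow_lt_pow_right (two_le_q hq hr) (by omega)
  refine ⟨(natDegree_add_eq_left_of_degree_lt hlt).trans hd, ?_⟩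
  rw [stepPoly, add_comm, leadingCoeff_add_of_degree_lt hlt, leadingCoeff_mul, leadingCoeff_C,
    h3.leadingCoeff, mul_one]

lemma towerStep_of_root {Γ : Type*} [Field Γ] [CharP Γ p] (hq : q = p ^ r)
    (huw : (p : ℤ) ∣ a * u + b * w - 1) {ζ x : Γ}
    (hx : (stepPoly q a b u w ζ).eval x = 0) :
    -(ζ * ((u : Γ) + qTrace q b x) ^ q ^ a) = (w : Γ) - qTrace q a x ∧
    TowerStep q a b ζ ((u : Γ) + qTrace q b x)
      (-((w : Γ) - qTrace q a x) ^ q ^ b / ((u : Γ) + qTrace q b x)) := by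
  rw [← coe_aeval_eq_eval, aeval_stepPoly, Algebra.algebraMap_self, RingHom.id_apply] at hx
  have hβ : -(ζ * ((u : Γ) + qTrace q b x) ^ q ^ a) = (w : Γ) - qTrace q a x := by
    linear_combination -hx
  have htr : qTrace q a ((u : Γ) + qTrace q b x) +
      qTrace q b (-(ζ * ((u : Γ) + qTrace q b x) ^ q ^ a)) = 1 := by
    rw [hβ, qTrace_add hq, qTrace_sub hq]
    rw [qTrace_comm hq a b]
    linear_combination qTrace_intCast_add_eq_one (R := Γ) hq huw
  have hα : (u : Γ) + qTrace q b x ≠ 0 := fun h => by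
    rw [h, qpow_zero hq, mul_zero, neg_zero, qTrace_zero hq, qTrace_zero hq] at htr
    simp at htr
  refine ⟨hβ, ⟨htr, ?_⟩⟩
  rw [div_mul_cancel₀ _ hα, hβ]

end StepPoly

section Ramified

open Polynomial

variable {Γ Γ₀ : Type*} [Field Γ] [LinearOrderedCommGroupWithZero Γ₀] {v : Valuation Γ Γ₀}
  {p r q a b : ℕ} {u w : ℤ} {ζ : Γ} [Fact p.Prime] [CharP Γ p] [IsAlgClosed Γ]

lemma map_intCast_le_one (v : Valuation Γ Γ₀) (u : ℤ) : v (u : Γ) ≤ 1 :=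
  (v.mem_integer_iff _).1 (intCast_mem v.integer u)

/-- Above a zero of `ζ` some root of the step polynomial is not integral, and the corresponding
`-ζ α ^ q ^ a` is inverse to `(1 + 1 / ζ) ^ (1 / (q ^ b - 1))` up to a principal unit. -/
lemma exists_radical_of_lt_one (hq : q = p ^ r) (hr : 1 ≤ r) (ha : 1 ≤ a) (hb : 1 ≤ b)
    (huw : (p : ℤ) ∣ a * u + b * w - 1) (h0 : ζ ≠ 0) (hζ : v ζ < 1)
    (S : Subfield Γ) (hS : ∀ x, (stepPoly q a b u w ζ).eval x = 0 → x ∈ S) {Y : Γ}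
    (hY : Y ^ (q ^ b - 1) = 1 + ζ⁻¹) :
    ∃ x ∈ S, v ((Y * x) ^ (q ^ b - 1) - 1) < 1 := by
  obtain ⟨-, hlc⟩ := natDegree_stepPoly (u := u) (w := w) hq hr ha hb h0
  have hex : ∃ x, (stepPoly q a b u w ζ).eval x = 0 ∧ 1 < v x := by
    by_contra! hcon
    have h1 := (IsAlgClosed.splits (stepPoly q a b u w ζ)).eq_prod_roots
    have h2 := coeff_one_stepPoly (b := b) (u := u) (w := w) (ζ := ζ) hq hr ha
    rw [h1, coeff_C_mul, hlc] at h2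
    have h3 : v ((((stepPoly q a b u w ζ).roots.map fun x => X - C x).prod).coeff 1) ≤ 1 :=
      coeff_prod_X_sub_C_le_one (fun x hx => hcon x (isRoot_of_mem_roots hx)) 1
    have h4 := congrArg v h2
    rw [map_mul, Valuation.map_neg, map_one] at h4
    exact ((mul_le_of_le_one_right' h3).trans_lt hζ).ne h4
  obtain ⟨x, hx, hvx⟩ := hex
  obtain ⟨hβ, hstep⟩ := towerStep_of_root hq huw hx
  set α := (u : Γ) + qTrace q b x with hα
  set ζ' := -((w : Γ) - qTrace q a x) ^ q ^ b / α with hζ'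
  have hvα : 1 < v α := by
    have h1 : 1 < v (qTrace q b x) := by
      rw [map_qTrace_of_one_lt hq hr hvx hb]
      exact one_lt_pow₀ hvx (qpow_ne_zero hq _)
    rw [hα, v.map_add_eq_of_lt_right ((map_intCast_le_one v u).trans_lt h1)]
    exact h1
  have hvζ' : 1 < v ζ' := by
    have h1 := congrArg v (hstep.pow_sub_one_eq hq)
    rw [map_mul, v.map_one_add_of_lt hζ, mul_one, map_pow] at h1
    have h2 : q ^ a - 1 ≠ 0 := by
      have := Nat.one_lt_pow (by omega : a ≠ 0) (two_le_q hq hr)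
      omega
    have h3 := one_lt_pow₀ hvα h2
    rw [h1] at h3
    by_contra! hcon
    exact h3.not_ge ((v.map_add _ _).trans (max_le v.map_one.le hcon))
  have hβS : -(ζ * α ^ q ^ a) ∈ S := by
    rw [hβ]
    exact sub_mem (intCast_mem _ _) (qTrace_mem (hS x hx) _ _)
  refine ⟨(-(ζ * α ^ q ^ a))⁻¹, inv_mem hβS, ?_⟩
  have h1 := hstep.beta_pow_eq hq h0
  have hβ0 : -(ζ * α ^ q ^ a) ≠ 0 :=
    neg_ne_zero.2 (mul_ne_zero h0 (pow_ne_zero _ (hstep.ne_zero hq)))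
  have h2 : (Y * (-(ζ * α ^ q ^ a))⁻¹) ^ (q ^ b - 1) - 1 = ζ'⁻¹ := by
    rw [mul_pow, hY, ← h1, inv_pow, mul_right_comm, mul_inv_cancel₀ (pow_ne_zero _ hβ0)]
    ring
  rw [h2, map_inv₀]
  exact inv_lt_one_of_one_lt₀ hvζ'

/-- Above a pole of `ζ` two roots of the step polynomial are congruent, and their difference is
inverse to `(1 + ζ) ^ (1 / (q ^ a - 1))` up to a principal unit. -/
lemma exists_radical_of_one_lt (hq : q = p ^ r) (hr : 1 ≤ r) (ha : 1 ≤ a) (hb : 1 ≤ b)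
    (hζ : 1 < v ζ)
    (S : Subfield Γ) (hS : ∀ x, (stepPoly q a b u w ζ).eval x = 0 → x ∈ S) {Y : Γ}
    (hY : Y ^ (q ^ a - 1) = 1 + ζ) :
    ∃ x ∈ S, v ((Y * x) ^ (q ^ a - 1) - 1) < 1 := by
  have hq2 := two_le_q hq hr
  have h0 : ζ ≠ 0 := v.ne_zero_iff.1 (zero_lt_one.trans hζ).ne'
  obtain ⟨hd, hlc⟩ := natDegree_stepPoly (u := 0) (w := 0) hq hr ha hb h0
  set D := stepPoly q a b 0 0 ζ with hD
  have hD1 : D.coeff 1 = -1 := coeff_one_stepPoly hq hr ha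
  have hev : ∀ x, D.eval x = ζ * qTrace q b x ^ q ^ a - qTrace q a x := fun x => by
    rw [← coe_aeval_eq_eval, hD, aeval_stepPoly]
    simp only [Int.cast_zero, zero_add, Algebra.algebraMap_self, RingHom.id_apply]
    ring
  have hdpos : 1 ≤ D.natDegree := by
    rw [hd]
    exact Nat.mul_pos (Nat.pos_of_ne_zero (qpow_ne_zero hq _))
      (Nat.pos_of_ne_zero (qpow_ne_zero hq _))
  have hlc' : D.divX.leadingCoeff = ζ := by
    rw [leadingCoeff, natDegree_divX_eq_natDegree_tsub_one, coeff_divX, Nat.sub_add_cancel hdpos]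
    exact hlc
  -- the product of the nonzero roots of `D` is `±1 / ζ`
  have hex : ∃ δ, D.divX.eval δ = 0 ∧ v δ < 1 := by
    by_contra! hcon
    have h1 := (IsAlgClosed.splits D.divX).coeff_zero_eq_leadingCoeff_mul_prod_roots
    rw [coeff_divX, hD1, hlc'] at h1
    have h2 := congrArg v h1
    rw [Valuation.map_neg, map_one, map_mul, map_mul, map_pow, Valuation.map_neg, map_one, one_pow,
      one_mul, map_multiset_prod] at h2
    have h3 : 1 ≤ (D.divX.roots.map v).prod := by
      refine Multiset.one_le_prod fun y hy => ?_
      obtain ⟨ρ, hρ, rfl⟩ := Multiset.mem_map.1 hy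
      exact hcon ρ (isRoot_of_mem_roots hρ)
    exact (hζ.trans_le (le_mul_of_one_le_right' h3)).ne h2
  obtain ⟨δ, hδ, hvδ⟩ := hex
  have hδ0 : δ ≠ 0 := by
    rintro rfl
    rw [← coeff_zero_eq_eval_zero, coeff_divX, hD1] at hδ
    simp at hδ
  have hDδ : ζ * qTrace q b δ ^ q ^ a = qTrace q a δ := by
    have h1 := congrArg (eval δ) (divX_mul_X_add D)
    rw [coeff_zero_eq_eval_zero, hev 0, qTrace_zero hq, qTrace_zero hq, qpow_zero hq, mul_zero,
      sub_zero, C_0, add_zero, eval_mul, hδ, zero_mul, hev] at h1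
    linear_combination -h1
  obtain ⟨ρ, hρ⟩ := IsAlgClosed.exists_root (stepPoly q a b u w ζ) (by
    rw [degree_eq_natDegree (by
      intro h
      have := coeff_one_stepPoly (b := b) (u := u) (w := w) (ζ := ζ) hq hr ha
      rw [h] at this
      simp at this), (natDegree_stepPoly (u := u) (w := w) hq hr ha hb h0).1]
    exact_mod_cast mul_ne_zero (qpow_ne_zero hq _) (qpow_ne_zero hq _))
  have hρδ : (stepPoly q a b u w ζ).eval (ρ + δ) = 0 := by
    have h1 : (stepPoly q a b u w ζ).eval ρ = 0 := hρ
    rw [← coe_aeval_eq_eval, aeval_stepPoly, Algebra.algebraMap_self, RingHom.id_apply] at h1 ⊢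
    rw [qTrace_add hq, qTrace_add hq, ← add_assoc, qpow_add hq]
    linear_combination h1 + hDδ
  refine ⟨δ, by simpa using sub_mem (hS _ hρδ) (hS _ hρ), ?_⟩
  have hvδ0 := v.ne_zero_iff.2 hδ0
  have htr : ∀ m, 1 ≤ m → v (qTrace q m δ / δ - 1) < 1 := fun m hm => by
    have h1 : qTrace q m δ / δ - 1 = (qTrace q m δ - δ) / δ := by field_simp
    rw [h1, map_div₀, div_lt_one₀ (zero_lt_iff.2 hvδ0)]
    exact (map_qTrace_sub_self_le hq hvδ.le hm).trans_lt
      (pow_lt_self_of_lt_one₀ (zero_lt_iff.2 hvδ0) hvδ hq2)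
  set s := qTrace q a δ / δ with hs
  set t := qTrace q b δ / δ with ht
  have ht1 : v (t ^ q ^ a - 1) < 1 := by
    have := qpow_sub hq a t 1
    rw [one_pow] at this
    rw [← this, map_pow]
    exact pow_lt_one₀ zero_le (htr b hb) (qpow_ne_zero hq a)
  have hvt : v (t ^ q ^ a) = 1 := by
    rw [← v.map_one]; exact v.map_eq_of_sub_lt (by rwa [v.map_one])
  have hQ : δ ^ q ^ a = δ ^ (q ^ a - 1) * δ := by
    rw [← pow_succ, Nat.sub_add_cancel (Nat.one_le_iff_ne_zero.2 (qpow_ne_zero hq a))]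
  have hmain : ζ * δ ^ (q ^ a - 1) * t ^ q ^ a = s := by
    have h1 : qTrace q b δ = t * δ := by rw [ht]; field_simp
    have h2 : qTrace q a δ = s * δ := by rw [hs]; field_simp
    rw [h1, h2, mul_pow, hQ] at hDδ
    exact mul_right_cancel₀ hδ0 (by linear_combination hDδ)
  have hfin : v (ζ * δ ^ (q ^ a - 1) - 1) < 1 := by
    rw [← mul_one (v _), ← hvt, ← map_mul]
    have : (ζ * δ ^ (q ^ a - 1) - 1) * t ^ q ^ a = (s - 1) - (t ^ q ^ a - 1) := by
      rw [sub_mul, hmain]; ring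
    rw [this, hvt]
    exact v.map_sub_lt (htr a ha) ht1
  have hM : q ^ a - 1 ≠ 0 := by
    have := Nat.one_lt_pow (by omega : a ≠ 0) hq2
    omega
  have : (Y * δ) ^ (q ^ a - 1) - 1 = (ζ * δ ^ (q ^ a - 1) - 1) + δ ^ (q ^ a - 1) := by
    rw [mul_pow, hY]; ring
  rw [this]
  refine v.map_add_lt hfin ?_
  rw [map_pow]
  exact pow_lt_one₀ zero_le hvδ hM

end Ramified

/-! ### Global structure of the Galois closure -/

lemma TowerStep.of_map {Γ Δ : Type*} [Field Γ] [Field Δ] {q a b : ℕ} {ζ α ζ' : Γ} (f : Γ →+* Δ)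
    (h : TowerStep q a b (f ζ) (f α) (f ζ')) : TowerStep q a b ζ α ζ' where
  trace_eq := f.injective (by
    simpa only [map_add, map_qTrace, map_neg, map_mul, map_pow, map_one] using h.trace_eq)
  next_mul := f.injective (by
    simpa only [map_neg, map_mul, map_pow] using h.next_mul)

section Irreducible

open Polynomial

variable {p r q a b : ℕ} {u w : ℤ} [Fact p.Prime]

/-- The step polynomial is irreducible over a rational function field `C(t)`, by Gauss's lemma:
it is linear in `t` with coprime coefficients. -/
theorem irreducible_stepPoly {C F : Type*} [Field C] [Field F] [CharP C p]
    (hq : q = p ^ r) (hr : 1 ≤ r) (ha : 1 ≤ a) (hb : 1 ≤ b)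
    (huw : (p : ℤ) ∣ a * u + b * w - 1) (e : RatFunc C ≃+* F) :
    Irreducible (stepPoly q a b u w (e RatFunc.X)) := by
  have h1 : Irreducible (Polynomial.C (((u : C[X]) + qTrace q b X) ^ q ^ a) * X +
      Polynomial.C ((w : C[X]) - qTrace q a X)) := by
    refine irreducible_C_mul_X_add_C (pow_ne_zero _
      (monic_intCast_add_qTrace_X hq hr hb).1.ne_zero) ?_
    exact ((isCoprime_stepPoly hq huw).pow_left).isRelPrime
  have h2 : Bivariate.swap (R := C) (Polynomial.C (((u : C[X]) + qTrace q b X) ^ q ^ a) * X +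
      Polynomial.C ((w : C[X]) - qTrace q a X)) = stepPoly q a b u w (X : C[X]) := by
    simp only [stepPoly, map_add, map_mul, map_sub, map_pow, map_intCast, map_qTrace]
    rw [Bivariate.swap_Y, Bivariate.swap_C, Polynomial.map_X]
    ring
  have h3 : Irreducible (stepPoly q a b u w (X : C[X])) := by
    rw [← h2]; exact (MulEquiv.irreducible_iff (Bivariate.swap (R := C))).2 h1
  have h4 : (stepPoly q a b u w (X : C[X])).natDegree ≠ 0 := fun h => by
    have h5 := coeff_one_stepPoly (b := b) (u := u) (w := w) (ζ := (X : C[X])) hq hr ha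
    rw [coeff_eq_zero_of_natDegree_lt (by omega)] at h5
    simp at h5
  rw [(h3.isPrimitive h4).irreducible_iff_irreducible_map_fraction_map (K := RatFunc C),
    map_stepPoly, RatFunc.algebraMap_X] at h3
  have h5 := (MulEquiv.irreducible_iff (mapEquiv e)).2 h3
  rwa [mapEquiv_apply, map_stepPoly] at h5

end Irreducible

section Closure

variable {C Ω : Type*} [Field C] [Field Ω] [IsAlgClosed Ω] [Algebra C Ω]
  {p r q a b : ℕ} [Fact p.Prime] [CharP Ω p] {z α : ℕ → Ω}

lemma charP_of_algebra (C Ω : Type*) [Field C] [Field Ω] [Algebra C Ω] (p : ℕ) [CharP Ω p] :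
    CharP C p :=
  (RingHom.charP_iff (algebraMap C Ω) (algebraMap C Ω).injective p).2 inferInstance

lemma one_add_ne_zero_of_transcendental {t : Ω} (ht : Transcendental C t) : 1 + t ≠ 0 := by
  intro h
  apply ht
  rw [show t = algebraMap C Ω (-1) by rw [map_neg, map_one]; linear_combination h]
  exact isAlgebraic_algebraMap _

variable (hz : Transcendental C (z 1))
  (hstep : ∀ j, 1 ≤ j → TowerStep q a b (z j) (α j) (z (j + 1)))

include hz hstep

lemma z_ne_zero_and_one_add_ne_zero (hq : q = p ^ r) {j : ℕ} (hj : 1 ≤ j) :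
    z j ≠ 0 ∧ 1 + z j ≠ 0 := by
  induction j, hj using Nat.le_induction with
  | base =>
    refine ⟨fun h => hz ?_, one_add_ne_zero_of_transcendental hz⟩
    rw [h]; exact isAlgebraic_zero
  | succ j hj ih =>
    have h := hstep j hj
    refine ⟨h.next_ne_zero hq ih.1, ?_⟩
    rw [← h.pow_sub_one_eq hq]
    exact mul_ne_zero (pow_ne_zero _ (h.ne_zero hq)) ih.2

lemma mem_stepField (hq : q = p ^ r) (hab : Nat.gcd a b = 1) {i j : ℕ} (hj : 1 ≤ j) (hji : j < i) :
    α j ∈ stepField C z i := by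
  have h := z_ne_zero_and_one_add_ne_zero hz hstep hq hj
  refine (hstep j hj).mem_of_mem hq hab h.1 h.2 (stepField C z i).toSubfield ?_ ?_
  · exact IntermediateField.subset_adjoin _ _ ⟨j, ⟨hj, hji.le⟩, rfl⟩
  · exact IntermediateField.subset_adjoin _ _ ⟨j + 1, ⟨by omega, hji⟩, rfl⟩

lemma mem_separableClosure (hq : q = p ^ r) (hr : 1 ≤ r) (ha : 1 ≤ a) (hb : 1 ≤ b)
    (hab : Nat.gcd a b = 1) {j : ℕ} (hj : 1 ≤ j) :
    z j ∈ separableClosure (baseField C z) Ω := by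
  induction j, hj using Nat.le_induction with
  | base => exact IntermediateField.algebraMap_mem _ (baseGen C z)
  | succ j hj ih =>
    set S := separableClosure (baseField C z) Ω with hS
    have h := hstep j hj
    obtain ⟨γ, u, w, hα, hβ, -⟩ := exists_parametrization hq ha hb hab h.trace_eq
    have hroot : Polynomial.aeval γ (stepPoly q a b u w (⟨z j, ih⟩ : S)) = 0 := by
      rw [aeval_stepPoly, ← hα, ← hβ]
      change z j * _ + _ = _
      ring
    have : CharP S p := charP_of_algebra S Ω p
    have hsep : (stepPoly q a b u w (⟨z j, ih⟩ : S)).Separable := by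
      rw [Polynomial.Separable, derivative_stepPoly hq hr ha]
      exact isCoprime_one_right.neg_right
    have hγ : IsSeparable S γ := hsep.of_dvd (minpoly.dvd _ _ hroot)
    have hγS : γ ∈ S := by
      have h1 := mem_separableClosure_iff.2 hγ
      rw [separableClosure.separableClosure_eq_bot, IntermediateField.mem_bot] at h1
      obtain ⟨y, rfl⟩ := h1
      exact y.2
    have hαS : α j ∈ S := by
      rw [hα]; exact add_mem (intCast_mem _ _) (qTrace_mem hγS _ _)
    rw [h.next_eq hq]
    exact div_mem (neg_mem (pow_mem (neg_mem (mul_mem ih (pow_mem hαS _))) _)) hαS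

/-- The Galois closure `N_i` is finite Galois over `N₁`. It is generated by the
conjugates of the `α_j`, and, when `i ≥ 2`, it is a splitting field for the first step. -/
theorem galoisStep_structure (hq : q = p ^ r) (hr : 1 ≤ r) (ha : 1 ≤ a) (hb : 1 ≤ b)
    (hab : Nat.gcd a b = 1) (i : ℕ) :
    FiniteDimensional (baseField C z) (galoisStep C z i) ∧
    IsGalois (baseField C z) (galoisStep C z i) ∧
    (∃ ζ α : ℕ → galoisStep C z i, ζ 0 = algebraMap _ _ (baseGen C z) ∧
      (∀ j < i - 1, TowerStep q a b (ζ j) (α j) (ζ (j + 1))) ∧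
      IntermediateField.adjoin (baseField C z)
        {x | ∃ j < i - 1, ∃ σ : Gal(galoisStep C z i/baseField C z), x = σ (α j)} = ⊤) ∧
    (2 ≤ i → ∃ u w : ℤ, (p : ℤ) ∣ a * u + b * w - 1 ∧
      ((stepPoly q a b u w (baseGen C z)).map
        (algebraMap (baseField C z) (galoisStep C z i))).Splits) := by
  have hsepH : stepField C z i ≤ separableClosure (baseField C z) Ω := by
    rw [IntermediateField.adjoin_le_iff]
    rintro _ ⟨j, hj, rfl⟩
    exact mem_separableClosure hz hstep hq hr ha hb hab hj.1
  have hsH : Algebra.IsSeparable (baseField C z) (stepField C z i) :=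
    (le_separableClosure_iff _ _ _).1 hsepH
  have hfH : FiniteDimensional (baseField C z) (stepField C z i) := by
    refine IntermediateField.finiteDimensional_adjoin ?_
    rintro _ ⟨j, hj, rfl⟩
    exact (mem_separableClosure_iff.1
      (mem_separableClosure hz hstep hq hr ha hb hab hj.1)).isIntegral
  have hfN : FiniteDimensional (baseField C z) (galoisStep C z i) := inferInstance
  have hsN : Algebra.IsSeparable (baseField C z) (galoisStep C z i) := by
    refine (le_separableClosure_iff _ _ _).1 (iSup_le ?_)
    rintro φ _ ⟨x, rfl⟩
    exact mem_separableClosure_iff.2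
      (IsSeparable.map φ φ.toRingHom.injective (Algebra.IsSeparable.isSeparable _ x))
  have hnN : Normal (baseField C z) (galoisStep C z i) :=
    (Algebra.IsAlgebraic.isNormalClosure_normalClosure (F := baseField C z)
      (K := stepField C z i) (L := Ω) fun x => IsAlgClosed.splits _).normal
  have hgN : IsGalois (baseField C z) (galoisStep C z i) := ⟨⟩
  have hHN : stepField C z i ≤ galoisStep C z i := IntermediateField.le_normalClosure _
  have hzN : ∀ j, 1 ≤ j → j ≤ i → z j ∈ stepField C z i := fun j h1 h2 =>
    IntermediateField.subset_adjoin _ _ ⟨j, ⟨h1, h2⟩, rfl⟩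
  have hαN : ∀ j, 1 ≤ j → j < i → α j ∈ stepField C z i := fun j =>
    mem_stepField hz hstep hq hab
  refine ⟨hfN, hgN, ?_, ?_⟩
  · classical
    let ζ' : ℕ → galoisStep C z i := fun j => if h : z (j + 1) ∈ galoisStep C z i then ⟨_, h⟩ else 0
    let α' : ℕ → galoisStep C z i := fun j => if h : α (j + 1) ∈ galoisStep C z i then ⟨_, h⟩ else 0
    have hζ' : ∀ j, z (j + 1) ∈ galoisStep C z i → (ζ' j : Ω) = z (j + 1) := fun j h => by
      simp only [ζ', dif_pos h]
    have hα' : ∀ j, α (j + 1) ∈ galoisStep C z i → (α' j : Ω) = α (j + 1) := fun j h => by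
      simp only [α', dif_pos h]
    have hαj : ∀ j, j < i - 1 → (α' j : Ω) = α (j + 1) := fun j hj =>
      hα' j (hHN (hαN _ (by omega) (by omega)))
    refine ⟨ζ', α', Subtype.ext (hζ' 0 ?_), fun j hj => ?_, ?_⟩
    · exact IntermediateField.algebraMap_mem _ (baseGen C z)
    · refine TowerStep.of_map (galoisStep C z i).val.toRingHom ?_
      change TowerStep q a b (ζ' j : Ω) (α' j : Ω) (ζ' (j + 1) : Ω)
      rw [hζ' j (hHN (hzN _ (by omega) (by omega))), hαj j hj,
        hζ' (j + 1) (hHN (hzN _ (by omega) (by omega)))]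
      exact hstep (j + 1) (by omega)
    · set T := IntermediateField.adjoin (baseField C z)
        {x | ∃ j < i - 1, ∃ σ : Gal(galoisStep C z i/baseField C z), x = σ (α' j)} with hT
      have hle : galoisStep C z i ≤ T.map (galoisStep C z i).val := by
        refine iSup_le fun φ => ?_
        have hφα : ∀ j (h1 : 1 ≤ j) (h2 : j < i),
            φ ⟨α j, hαN j h1 h2⟩ ∈ T.map (galoisStep C z i).val := by
          intro j h1 h2
          obtain ⟨j, rfl⟩ := Nat.exists_eq_add_of_le' h1
          let φ' : stepField C z i →ₐ[baseField C z] galoisStep C z i :=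
            φ.codRestrict (galoisStep C z i).toSubalgebra
              fun x => AlgHom.fieldRange_le_normalClosure φ ⟨x, rfl⟩
          let ψ := φ'.liftNormal (galoisStep C z i)
          let σ := AlgEquiv.ofBijective ψ (Algebra.IsAlgebraic.algHom_bijective ψ)
          refine ⟨σ (α' j), IntermediateField.subset_adjoin _ _ ⟨j, by omega, σ, rfl⟩, ?_⟩
          have h3 : α' j = algebraMap (stepField C z i) (galoisStep C z i)
              ⟨α (j + 1), hαN _ h1 h2⟩ := Subtype.ext (hαj j (by omega))
          have h4 : σ (α' j) = φ' ⟨α (j + 1), hαN _ h1 h2⟩ := by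
            rw [h3]
            exact AlgHom.liftNormal_commutes φ' _ _
          rw [h4]
          rfl
        have hφz : ∀ j (h1 : 1 ≤ j) (h2 : j ≤ i),
            φ ⟨z j, hzN j h1 h2⟩ ∈ T.map (galoisStep C z i).val := by
          intro j h1
          induction j, h1 using Nat.le_induction with
          | base =>
            intro h2
            have : (⟨z 1, hzN 1 le_rfl h2⟩ : stepField C z i) =
              algebraMap (baseField C z) _ (baseGen C z) := rfl
            rw [this, AlgHom.commutes]
            exact IntermediateField.algebraMap_mem _ _
          | succ j h1 ih =>
            intro h2
            have h3 : TowerStep q a b (⟨z j, hzN j h1 (by omega)⟩ : stepField C z i)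
                ⟨α j, hαN j h1 (by omega)⟩ ⟨z (j + 1), hzN _ (by omega) h2⟩ :=
              TowerStep.of_map (stepField C z i).val.toRingHom (hstep j h1)
            have h4 := (h3.map φ.toRingHom).next_eq hq
            have h5 := ih (by omega)
            have h6 := hφα j h1 (by omega)
            change φ _ = -(-(φ _ * φ _ ^ q ^ a)) ^ q ^ b / φ _ at h4
            rw [h4]
            exact div_mem (neg_mem (pow_mem (neg_mem (mul_mem h5 (pow_mem h6 _))) _)) h6
        have hall : ∀ x (hx : x ∈ stepField C z i),
            φ ⟨x, hx⟩ ∈ T.map (galoisStep C z i).val := by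
          intro x hx
          induction hx using IntermediateField.adjoin_induction with
          | mem x hx =>
            obtain ⟨j, hj, rfl⟩ := hx
            exact hφz j hj.1 hj.2
          | algebraMap x =>
            have : φ (algebraMap _ _ x) ∈ T.map (galoisStep C z i).val := by
              rw [AlgHom.commutes]; exact IntermediateField.algebraMap_mem _ _
            exact this
          | add x y hx hy h1 h2 =>
            have := add_mem h1 h2
            rwa [← map_add] at this
          | inv x hx h1 =>
            have := inv_mem h1
            rwa [← map_inv₀] at this
          | mul x y hx hy h1 h2 =>
            have := mul_mem h1 h2
            rwa [← map_mul] at this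
        rintro _ ⟨x, rfl⟩
        exact hall x.1 x.2
      rw [eq_top_iff]
      rintro x -
      obtain ⟨y, hy, hyx⟩ := hle x.2
      have : y = x := Subtype.ext hyx
      exact this ▸ hy
  · intro hi
    obtain ⟨γ, u, w, hα, hβ, hγ⟩ := exists_parametrization hq ha hb hab (hstep 1 le_rfl).trace_eq
    have huw : (p : ℤ) ∣ a * u + b * w - 1 := by
      have h1 := (hstep 1 le_rfl).trace_eq
      rw [hβ, hα, qTrace_add hq, qTrace_sub hq, qTrace_comm hq a b] at h1
      have h2 : qTrace q a (u : Ω) + qTrace q b (w : Ω) = 1 := by linear_combination h1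
      rw [← CharP.intCast_eq_zero_iff Ω p]
      simp only [qTrace, qpow_intCast hq, Finset.sum_const, Finset.card_range, nsmul_eq_mul] at h2
      push_cast
      linear_combination h2
    refine ⟨u, w, huw, ?_⟩
    have hγN : γ ∈ galoisStep C z i := by
      have h1 : α 1 ∈ galoisStep C z i := hHN (hαN 1 le_rfl (by omega))
      have h2 : z 1 ∈ galoisStep C z i := hHN (hzN 1 le_rfl (by omega))
      have : Subring.closure {α 1, -(z 1 * α 1 ^ q ^ a)} ≤
          (galoisStep C z i).toSubfield.toSubring := by
        rw [Subring.closure_le]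
        rintro _ (rfl | rfl)
        · exact h1
        · exact neg_mem (mul_mem h2 (pow_mem h1 _))
      exact this hγ
    have := charP_of_algebra C Ω p
    have hirr := irreducible_stepPoly hq hr ha hb huw
      (RatFunc.algEquivOfTranscendental (z 1) hz).toRingEquiv
    have hX : (RatFunc.algEquivOfTranscendental (z 1) hz).toRingEquiv RatFunc.X = baseGen C z :=
      Subtype.ext (RatFunc.algEquivOfTranscendental_X (z 1) hz)
    rw [hX] at hirr
    have hroot : Polynomial.aeval (⟨γ, hγN⟩ : galoisStep C z i)
        (stepPoly q a b u w (baseGen C z)) = 0 := by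
      have h1 := Polynomial.aeval_algHom_apply (galoisStep C z i).val ⟨γ, hγN⟩
        (stepPoly q a b u w (baseGen C z))
      have h2 : Polynomial.aeval γ (stepPoly q a b u w (baseGen C z)) = 0 := by
        rw [aeval_stepPoly, ← hα, ← hβ]
        change z 1 * _ + _ = _
        ring
      exact Subtype.ext (h1.symm.trans h2)
    have hint : IsIntegral (baseField C z) (⟨γ, hγN⟩ : galoisStep C z i) :=
      Algebra.IsIntegral.isIntegral _
    refine (hnN.splits ⟨γ, hγN⟩).of_dvd
      (Polynomial.map_ne_zero (minpoly.ne_zero hint)) ((Polynomial.map_dvd_map' _).2 ?_)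
    exact ((minpoly.irreducible hint).dvd_symm hirr (minpoly.dvd _ _ hroot))

end Closure

/-! ### Generators of the local extensions -/

section AddPoly

open Polynomial

/-- The additive polynomial `∑ d i X ^ p ^ i`, `i ≤ j`. -/
def addPoly {B : Type*} [CommRing B] (p j : ℕ) (d : ℕ → B) : B[X] :=
  ∑ i ∈ Finset.range (j + 1), C (d i) * X ^ p ^ i

variable {B Γ : Type*} [Field B] [Field Γ] [Algebra B Γ] {p j : ℕ} [hp : Fact p.Prime] {d : ℕ → B}

lemma aeval_addPoly (x : Γ) :
    aeval x (addPoly p j d) = ∑ i ∈ Finset.range (j + 1), algebraMap B Γ (d i) * x ^ p ^ i := by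
  simp [addPoly]

lemma derivative_addPoly [CharP B p] : derivative (addPoly p j d) = C (d 0) := by
  rw [addPoly, Finset.sum_range_succ', map_add, map_sum]
  simp [derivative_X_pow, pow_succ]

lemma natDegree_addPoly (hd : d j ≠ 0) : (addPoly p j d).natDegree = p ^ j := by
  rw [addPoly, Finset.sum_range_succ, natDegree_add_eq_right_of_degree_lt,
    natDegree_C_mul_X_pow _ _ hd]
  rw [degree_C_mul_X_pow _ hd, ← mem_degreeLT]
  refine Submodule.sum_mem _ fun i hi => mem_degreeLT.2 ?_
  exact (degree_C_mul_X_pow_le _ _).trans_lt (by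
    exact_mod_cast Nat.pow_lt_pow_right hp.out.one_lt (Finset.mem_range.1 hi))

lemma natDegree_addPoly_sub (hd : d j ≠ 0) (c : B) : (addPoly p j d - C c).natDegree = p ^ j := by
  rw [natDegree_sub_C, natDegree_addPoly hd]

lemma addPoly_sub_ne_zero (hd : d j ≠ 0) (c : B) : addPoly p j d - C c ≠ 0 := by
  intro h
  have := natDegree_addPoly_sub (p := p) hd c
  rw [h, natDegree_zero] at this
  exact (pow_pos hp.out.pos j).ne this

lemma separable_addPoly_sub [CharP B p] (hd : d 0 ≠ 0) (c : B) :
    (addPoly p j d - C c).Separable := by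
  rw [Polynomial.Separable, map_sub, derivative_addPoly, derivative_C, sub_zero]
  exact ⟨0, C (d 0)⁻¹, by rw [zero_mul, zero_add, ← C_mul, inv_mul_cancel₀ hd, C_1]⟩

end AddPoly

section Generator

variable {Γ Γ₀ : Type*} [Field Γ] [LinearOrderedCommGroupWithZero Γ₀]

/-- The inverse `w` of a uniformizer `t` or `t⁻¹` at a zero or a pole of `t`, together with the tame
ramification index `m`. -/
def IsLocalParameter (v : Valuation Γ Γ₀) (q a b : ℕ) (t w : Γ) (m : ℕ) : Prop :=
  (t ≠ 0 ∧ v t < 1 ∧ w = t⁻¹ ∧ m = q ^ b - 1) ∨ (1 < v t ∧ w = t ∧ m = q ^ a - 1)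

lemma IsLocalParameter.one_lt {v : Valuation Γ Γ₀} {q a b m : ℕ} {t w : Γ}
    (h : IsLocalParameter v q a b t w m) : 1 < v w := by
  rcases h with ⟨h0, h1, rfl, -⟩ | ⟨h1, rfl, -⟩
  · rw [map_inv₀]
    exact (one_lt_inv₀ (zero_lt_iff.2 (v.ne_zero_iff.2 h0))).2 h1
  · exact h1

lemma IsLocalParameter.degree {v : Valuation Γ Γ₀} {q a b m : ℕ} {t w : Γ}
    (h : IsLocalParameter v q a b t w m) {p r : ℕ} [Fact p.Prime] (hq : q = p ^ r) (hr : 1 ≤ r)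
    (ha : 1 ≤ a) (hb : 1 ≤ b) : m ≠ 0 ∧ (p : ℤ) ∣ m + 1 := by
  have key : ∀ c, 1 ≤ c → q ^ c - 1 ≠ 0 ∧ (p : ℤ) ∣ (q ^ c - 1 : ℕ) + 1 := fun c hc => by
    have h1 := Nat.one_lt_pow (by omega : c ≠ 0) (two_le_q hq hr)
    refine ⟨by omega, ?_⟩
    have h2 : p ∣ q ^ c := by
      rw [hq, ← pow_mul]; exact dvd_pow_self p (by positivity)
    have h3 : ((q ^ c - 1 : ℕ) : ℤ) + 1 = (q ^ c : ℕ) := by omega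
    rw [h3]; exact_mod_cast h2
  rcases h with ⟨-, -, -, rfl⟩ | ⟨-, -, rfl⟩
  exacts [key b hb, key a ha]

variable {v : Valuation Γ Γ₀} {K : Type*} [Field K] [Algebra K Γ] {p : ℕ}

/-- The element `Y` generates the extension by the elements of `A`, over any field that contains
the constants, `w`, and the auxiliary set `S`: it is a root of an additive polynomial of degree
`p ^ j` over the tame extension generated by `Y₀`, which satisfies `Y₀ ^ m = 1 + w`. -/
structure IsLocalGenerator (v : Valuation Γ Γ₀) (K : Type*) [Field K] [Algebra K Γ] (p m : ℕ)
    (w : Γ) (S A : Set Γ) (Y₀ : Γ) (j : ℕ) (Y : Γ) : Prop where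
  pow_eq : Y₀ ^ m = 1 + w
  isAddRoot : IsAddRoot K p Y₀ j Y
  exists_radical : ∃ x ∈ S, v ((Y₀ * x) ^ m - 1) < 1
  one_lt : 1 < v Y
  map_eq₀ : v Y₀ = v Y ^ p ^ j
  map_eq : v w = v Y₀ ^ m
  fixes : ∀ σ : Γ ≃ₐ[K] Γ, (∀ x, v (σ x) = v x) → σ w = w → σ Y = Y → ∀ x ∈ A, σ x = x
  fixed : ∀ σ : Γ ≃ₐ[K] Γ, (∀ x, v (σ x) = v x) → σ w = w → σ Y₀ = Y₀ → (∀ x ∈ A, σ x = x) →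
    σ Y = Y

lemma IsAddRoot.map_eq [hp : Fact p.Prime] (hK : HasConstantResidues v K) {Y₀ Y : Γ} {j : ℕ}
    (h : IsAddRoot K p Y₀ j Y) (h1 : 1 < v Y₀) : 1 < v Y ∧ v Y₀ = v Y ^ p ^ j := by
  obtain ⟨c, -, hcj, -, rfl⟩ := h
  have hY : 1 < v Y := by
    by_contra! hcon
    refine h1.not_ge (v.map_sum_le fun i _ => ?_)
    rw [Algebra.smul_def, map_mul, map_pow]
    exact mul_le_one' (hK.map_const_le _) (pow_le_one' hcon _)
  refine ⟨hY, ?_⟩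
  have hj : v (c j • Y ^ p ^ j) = v Y ^ p ^ j := by
    rw [Algebra.smul_def, map_mul, map_pow, hK.map_const _ hcj, one_mul]
  rw [Finset.sum_range_succ, v.map_add_eq_of_lt_right, hj]
  rw [hj]
  refine v.map_sum_lt (pow_ne_zero _ (zero_lt_one.trans hY).ne') fun i hi => ?_
  rw [Algebra.smul_def, map_mul, map_pow]
  exact (mul_le_of_le_one_left' (hK.map_const_le _)).trans_lt
    (pow_lt_pow_right₀ hY (Nat.pow_lt_pow_right hp.out.one_lt (Finset.mem_range.1 hi)))

variable [Fact p.Prime] [CharP Γ p] [IsAlgClosed K] [IsAlgClosed Γ]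

/-- All the chains of steps that start at `t` are governed by one `Y`, which lies above the radical
`Y₀ = (1 + w) ^ (1 / m)`. The roots of the step polynomial make `Y₀` rational up to a principal unit
(`exists_radical`), which has an `m`-th root by Hensel's lemma. -/
theorem exists_isLocalGenerator (hK : HasConstantResidues v K) {r q : ℕ} (hq : q = p ^ r)
    (hr : 1 ≤ r) {a b : ℕ} (ha : 1 ≤ a) (hb : 1 ≤ b) (hab : Nat.gcd a b = 1) {t w : Γ} {m : ℕ}
    (hw : IsLocalParameter v q a b t w m) {u u' : ℤ} (huw : (p : ℤ) ∣ a * u + b * u' - 1)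
    {ι : Type*} [Finite ι] (ζ α : ι → ℕ → Γ) (l : ℕ) (hz : ∀ c, ζ c 0 = t)
    (h : ∀ c, ∀ i < l, TowerStep q a b (ζ c i) (α c i) (ζ c (i + 1)))
    (S : Subfield Γ) (hS : ∀ x, (stepPoly q a b u u' t).eval x = 0 → x ∈ S) :
    ∃ Y₀ j Y, IsLocalGenerator v K p m w S {x | ∃ c, ∃ i < l, x = α c i} Y₀ j Y := by
  have hvw := hw.one_lt
  obtain ⟨hm, -⟩ := hw.degree hq hr ha hb
  obtain ⟨Y₀, hY₀⟩ := IsAlgClosed.exists_pow_nat_eq (1 + w) (Nat.pos_of_ne_zero hm)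
  have hrad : ∃ x ∈ S, v ((Y₀ * x) ^ m - 1) < 1 := by
    rcases hw with ⟨h0, h1, rfl, rfl⟩ | ⟨h1, rfl, rfl⟩
    · exact exists_radical_of_lt_one hq hr ha hb huw h0 h1 S hS hY₀
    · exact exists_radical_of_one_lt hq hr ha hb h1 S hS hY₀
  have hnear : IsNear v K p Y₀ Y₀ := IsNear.of_mem (self_mem_addSpan Y₀)
  have hs : LocalState v K p q a b Y₀ t := by
    rcases hw with ⟨h0, h1, rfl, rfl⟩ | ⟨h1, rfl, rfl⟩
    · exact Or.inl ⟨h0, h1, Y₀, hY₀, hnear⟩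
    · exact Or.inr ⟨h1, Y₀, hY₀, hnear⟩
  obtain ⟨j, Y, h1, h2, h3⟩ := exists_addRoot_of_chains hK hq hr ha hb hab ζ α l hz h hs
  have hmap : v w = v Y₀ ^ m := by
    rw [← map_pow, hY₀, v.map_add_eq_of_lt_right (by rwa [map_one])]
  have hvY₀ : 1 < v Y₀ := by
    by_contra! hcon
    rw [hmap] at hvw
    exact hvw.not_ge (pow_le_one' hcon m)
  obtain ⟨h4, h5⟩ := h1.map_eq hK hvY₀
  have hσ : ∀ σ : Γ ≃ₐ[K] Γ, σ w = w → σ t = t := fun σ hσ => by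
    rcases hw with ⟨h0, -, rfl, -⟩ | ⟨-, rfl, -⟩
    · rw [map_inv₀] at hσ; exact inv_injective hσ
    · exact hσ
  refine ⟨Y₀, j, Y, hY₀, h1, hrad, h4, h5, hmap, ?_, ?_⟩
  · rintro σ g1 g2 g3 _ ⟨c, i, hi, rfl⟩
    exact h2 σ g1 (hσ σ g2) g3 c i hi
  · intro σ g1 g2 g3 g4
    exact h3 σ g1 (hσ σ g2) g3 fun c i hi => g4 _ ⟨c, i, hi, rfl⟩

end Generator

section Fields

variable {E Γ Γ₀ : Type*} [Field E] [Field Γ] [LinearOrderedCommGroupWithZero Γ₀]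
  {v : Valuation Γ Γ₀} {K : Type*} [Field K] [Algebra K Γ] [Algebra E Γ] {p m j : ℕ}
  {w Y₀ Y : Γ} {S A : Set Γ} [hp : Fact p.Prime] [CharP Γ p] [IsAlgClosed K] [IsAlgClosed Γ]
  {B : Type*} [Field B] [Algebra B Γ] [Algebra.IsAlgebraic B Γ]

/-- The valuation `v` of `Γ` is invariant under the automorphisms over `E`. -/
def IsInvariant (v : Valuation Γ Γ₀) (E : Type*) [Field E] [Algebra E Γ] : Prop :=
  ∀ σ : Γ ≃+* Γ, (∀ e : E, σ (algebraMap E Γ e) = algebraMap E Γ e) → ∀ x, v (σ x) = v x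

omit [IsAlgClosed K] [Algebra.IsAlgebraic B Γ] in
lemma IsAddRoot.isSeparable (h : IsAddRoot K p Y₀ j Y)
    (hKB : ∀ c : K, algebraMap K Γ c ∈ (algebraMap B Γ).range)
    (hY₀ : Y₀ ∈ (algebraMap B Γ).range) : IsSeparable B Y := by
  obtain ⟨c, hc0, -, -, hc⟩ := h
  obtain ⟨y, hy⟩ := hY₀
  choose d hd using hKB
  have hd0 : d (c 0) ≠ 0 := fun h0 => hc0 (by
    have := hd (c 0)
    rw [h0, map_zero] at this
    exact (algebraMap K Γ).injective (by rw [← this, map_zero]))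
  have := charP_of_algebra B Γ p
  refine (separable_addPoly_sub (p := p) (j := j) (d := fun i => d (c i)) hd0 y).of_dvd
    (minpoly.dvd _ _ ?_)
  rw [map_sub, aeval_addPoly, Polynomial.aeval_C, hy, hc]
  simp [hd, Algebra.smul_def]

/-- A field that contains the constants, `w`, `S` and `A` contains the generator. -/
lemma IsLocalGenerator.mem_range (hK : HasConstantResidues v K) (hv : IsInvariant v E)
    (h : IsLocalGenerator v K p m w S A Y₀ j Y) (hm : m ≠ 0) (hpm : (p : ℤ) ∣ m + 1)
    (hKB : ∀ c : K, algebraMap K Γ c ∈ (algebraMap B Γ).range)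
    (hEB : ∀ e : E, algebraMap E Γ e ∈ (algebraMap B Γ).range)
    (hw : w ∈ (algebraMap B Γ).range)
    (hS : ∀ x ∈ S, x ∈ (algebraMap B Γ).range) (hA : ∀ x ∈ A, x ∈ (algebraMap B Γ).range) :
    Y₀ ∈ (algebraMap B Γ).range ∧ Y ∈ (algebraMap B Γ).range := by
  have hfix : ∀ (σ : Γ ≃ₐ[B] Γ) x, x ∈ (algebraMap B Γ).range → σ x = x := by
    rintro σ _ ⟨y, rfl⟩; exact σ.commutes y
  have hvσ : ∀ (σ : Γ ≃ₐ[B] Γ) x, v (σ x) = v x := fun σ =>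
    hv σ.toRingEquiv fun e => hfix σ _ (hEB e)
  let τ : (Γ ≃ₐ[B] Γ) → (Γ ≃ₐ[K] Γ) := fun σ =>
    AlgEquiv.ofRingEquiv (f := σ.toRingEquiv) fun c => hfix σ _ (hKB c)
  have h0 : Y₀ ∈ (algebraMap B Γ).range := by
    obtain ⟨w', hw'⟩ := hw
    obtain ⟨x, hx, hrad⟩ := h.exists_radical
    have hx0 : x ≠ 0 := by
      rintro rfl
      simp [hm] at hrad
    refine mem_range_algebraMap_of_forall_eq ?_ fun σ => ?_
    · have hmB : (m : B) ≠ 0 := fun h0 => by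
        have h1 := (CharP.intCast_eq_zero_iff Γ p _).2 hpm
        have h2 := congrArg (algebraMap B Γ) h0
        push_cast at h1
        rw [map_natCast, map_zero] at h2
        simp [h2] at h1
      have hvw : w ≠ -1 := fun h1 => by
        have := h.pow_eq
        rw [h1, add_neg_cancel, pow_eq_zero_iff hm] at this
        have h2 := h.map_eq₀
        rw [this, map_zero] at h2
        exact pow_ne_zero _ (zero_lt_one.trans h.one_lt).ne' h2.symm
      have hw0 : 1 + w' ≠ 0 := fun h1 => hvw (by
        rw [← hw']; have := congrArg (algebraMap B Γ) h1
        rw [map_add, map_one, map_zero] at this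
        exact (neg_eq_of_add_eq_zero_right this).symm)
      refine (Polynomial.separable_X_pow_sub_C (1 + w') hmB hw0).of_dvd (minpoly.dvd _ _ ?_)
      simp [h.pow_eq, hw']
    · refine hK.map_eq_of_radical hm (τ σ) (hvσ σ) hrad ?_ ?_
      · rw [h.pow_eq]
        change σ (1 + w) = 1 + w
        rw [map_add, map_one, ← hw', σ.commutes]
      · change v (σ x / x - 1) < 1
        rw [hfix σ x (hS x hx), div_self hx0, sub_self, map_zero]
        exact zero_lt_one
  refine ⟨h0, mem_range_algebraMap_of_forall_eq (h.isAddRoot.isSeparable hKB h0) fun σ => ?_⟩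
  exact h.fixed (τ σ) (hvσ σ) (hfix σ w hw) (hfix σ Y₀ h0) fun x hx => hfix σ x (hA x hx)

omit hp [CharP Γ p] [IsAlgClosed K] in
/-- A field that contains the constants, `w` and the generator contains `A`. -/
lemma IsLocalGenerator.mem_range_of_mem (hv : IsInvariant v E)
    (h : IsLocalGenerator v K p m w S A Y₀ j Y)
    (hKB : ∀ c : K, algebraMap K Γ c ∈ (algebraMap B Γ).range)
    (hEB : ∀ e : E, algebraMap E Γ e ∈ (algebraMap B Γ).range)
    (hw : w ∈ (algebraMap B Γ).range) (hY : Y ∈ (algebraMap B Γ).range)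
    (hA : ∀ x ∈ A, IsSeparable B x) : ∀ x ∈ A, x ∈ (algebraMap B Γ).range := by
  have hfix : ∀ (σ : Γ ≃ₐ[B] Γ) x, x ∈ (algebraMap B Γ).range → σ x = x := by
    rintro σ _ ⟨y, rfl⟩; exact σ.commutes y
  refine fun x hx => mem_range_algebraMap_of_forall_eq (hA x hx) fun σ => ?_
  exact h.fixes (AlgEquiv.ofRingEquiv (f := σ.toRingEquiv) fun c => hfix σ _ (hKB c))
    (hv σ.toRingEquiv fun e => hfix σ _ (hEB e)) (hfix σ w hw) (hfix σ Y hY) x hx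

end Fields

/-! ### Triviality of the second ramification group -/

section Weak

variable {C E Γ Γ₀ K : Type*} [Field C] [Field E] [Field Γ] [LinearOrderedCommGroupWithZero Γ₀]
  {v : Valuation Γ Γ₀} [Field K] [Algebra C K] [Algebra C E] [Algebra C Γ] [Algebra K Γ]
  [Algebra E Γ] [IsScalarTower C K Γ] [IsScalarTower C E Γ]
  [IsAlgClosed K] [IsAlgClosed Γ] [Algebra.IsAlgebraic E Γ]

/-- An automorphism over `C` maps the constants, which are algebraic over `C`, to constants. -/
lemma exists_algebraMap_eq_apply [Algebra.IsAlgebraic C K] (σ : Γ ≃ₐ[E] Γ) (c : K) :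
    ∃ c' : K, algebraMap K Γ c' = σ (algebraMap K Γ c) := by
  have hc := Algebra.IsAlgebraic.isAlgebraic (R := C) c
  refine exists_algebraMap_eq_of_aeval_eq_zero (K := K)
    (P := (minpoly C c).map (algebraMap C K))
    (Polynomial.map_ne_zero (minpoly.ne_zero hc.isIntegral)) ?_
  rw [Polynomial.aeval_map_algebraMap]
  have h1 := Polynomial.aeval_algHom_apply (σ.restrictScalars C).toAlgHom (algebraMap K Γ c)
    (minpoly C c)
  rw [Polynomial.aeval_algebraMap_apply, minpoly.aeval, map_zero, map_zero] at h1
  exact h1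

/-- If the residues of `E` are constants in `C`, then the residues of an intermediate field `M`
are represented by constants in `M`. -/
lemma exists_const_mem [Algebra.IsAlgebraic C K] [Algebra.IsSeparable C K]
    (hK : HasConstantResidues v K) (hv : IsInvariant v E) (M : IntermediateField E Γ) :
    ∀ f ∈ M, v f ≤ 1 → ∃ c : K, algebraMap K Γ c ∈ M ∧ v (f - algebraMap K Γ c) < 1 := by
  intro f hf hvf
  obtain ⟨c, hc⟩ := hK.exists_const f hvf
  refine ⟨c, ?_, hc⟩
  have : Algebra.IsAlgebraic M Γ := Algebra.IsAlgebraic.tower_top (K := E) M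
  have hsep : IsSeparable M (algebraMap K Γ c) := by
    have h1 : IsSeparable C (algebraMap K Γ c) :=
      IsSeparable.map (IsScalarTower.toAlgHom C K Γ) (algebraMap K Γ).injective
        (Algebra.IsSeparable.isSeparable C c)
    have h2 : IsSeparable E (algebraMap K Γ c) := h1.tower_top E
    exact h2.tower_top M
  obtain ⟨y, hy⟩ := mem_range_algebraMap_of_forall_eq hsep fun σ => by
    obtain ⟨c', hc'⟩ := exists_algebraMap_eq_apply (C := C) (σ.restrictScalars E) c
    change _ = σ _ at hc'
    have h1 : v (σ (f - algebraMap K Γ c)) < 1 := by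
      have := hv σ.toRingEquiv (fun e => σ.commutes (algebraMap E M e)) (f - algebraMap K Γ c)
      change v (σ _) = _ at this
      rwa [this]
    have h2 : σ f = f := σ.commutes ⟨f, hf⟩
    rw [map_sub σ, h2, ← hc'] at h1
    have h3 := v.map_sub_lt hc h1
    rw [show f - algebraMap K Γ c - (f - algebraMap K Γ c') = algebraMap K Γ (c' - c) by
      rw [map_sub]; ring] at h3
    rw [← hc', sub_eq_zero.1 (hK.eq_zero_of_lt h3)]
  rw [← hy]
  exact y.2

/-- Elements on which `σ` acts by multiplication by a principal unit. -/
lemma map_sub_lt_of_zpow {σ : Γ ≃+* Γ} {ϖ x : Γ} (hϖ : ϖ ≠ 0)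
    (h1 : v (σ ϖ / ϖ - 1) < 1) {n : ℤ} (h2 : v x = v ϖ ^ n)
    (h3 : v (σ (x / ϖ ^ n) - x / ϖ ^ n) < 1) :
    v (σ x / x - 1) < 1 := by
  have hvϖ := v.ne_zero_iff.2 hϖ
  have hx : x ≠ 0 := v.ne_zero_iff.1 (by rw [h2]; exact zpow_ne_zero n hvϖ)
  have key : ∀ f g : Γ, v (f - 1) < 1 → v (g - 1) < 1 → v (f * g - 1) < 1 := fun f g hf hg => by
    rw [show f * g - 1 = (f - 1) * (g - 1) + ((f - 1) + (g - 1)) by ring]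
    refine v.map_add_lt ?_ (v.map_add_lt hf hg)
    rw [map_mul]
    exact mul_lt_one_of_lt_of_le hf hg.le
  have hone : ∀ f : Γ, v (f - 1) < 1 → v f = 1 := fun f hf => by
    rw [← v.map_one]; exact v.map_eq_of_sub_lt (by rwa [v.map_one])
  have hpow : ∀ (f : Γ), v (f - 1) < 1 → ∀ n : ℕ, v (f ^ n - 1) < 1 := fun f hf n => by
    induction n with
    | zero => simp
    | succ n ih => rw [pow_succ]; exact key _ _ ih hf
  have hinv : ∀ f : Γ, v (f - 1) < 1 → v (f⁻¹ - 1) < 1 := fun f hf => by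
    have hf0 : f ≠ 0 := v.ne_zero_iff.1 (by rw [hone f hf]; exact one_ne_zero)
    rw [show f⁻¹ - 1 = -(f - 1) * f⁻¹ by field_simp; ring, map_mul, Valuation.map_neg, map_inv₀,
      hone f hf, inv_one, mul_one]
    exact hf
  have hz : v ((σ ϖ / ϖ) ^ n - 1) < 1 := by
    obtain ⟨n, rfl | rfl⟩ := n.eq_nat_or_neg
    · rw [zpow_natCast]; exact hpow _ h1 n
    · rw [zpow_neg, zpow_natCast]; exact hinv _ (hpow _ h1 n)
  have hu0 : x / ϖ ^ n ≠ 0 := div_ne_zero hx (zpow_ne_zero n hϖ)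
  have hu : v (x / ϖ ^ n) = 1 := by
    rw [map_div₀, map_zpow₀, h2, div_self (zpow_ne_zero n hvϖ)]
  have h4 : v (σ (x / ϖ ^ n) / (x / ϖ ^ n) - 1) < 1 := by
    rw [show σ (x / ϖ ^ n) / (x / ϖ ^ n) - 1 = (σ (x / ϖ ^ n) - x / ϖ ^ n) / (x / ϖ ^ n) by
      rw [sub_div, div_self hu0], map_div₀, hu, div_one]
    exact h3
  have h5 : σ x / x = σ (x / ϖ ^ n) / (x / ϖ ^ n) * (σ ϖ / ϖ) ^ n := by
    have hσϖ : σ ϖ ≠ 0 := by simpa using hϖ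
    rw [map_div₀, map_zpow₀, div_zpow]
    field_simp
  rw [h5]
  exact key _ _ h4 hz

variable {p m j : ℕ} {t : E} {w Y₀ Y : Γ} {S A : Set Γ} [hp : Fact p.Prime] [CharP Γ p]

/-- An automorphism `σ` that acts trivially modulo the third power of the maximal ideal of `M` is
trivial on `M`: it may be assumed to fix the constants, then it fixes `Y₀`, and it moves `Y`, which
has the value of the inverse of a uniformizer, by a constant and by a non-unit. -/
theorem map_eq_of_sub_le_pow_three [Algebra.IsAlgebraic C K] [Algebra.IsSeparable C K]
    (hK : HasConstantResidues v K) (hv : IsInvariant v E)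
    (hres : ∀ f : E, v (algebraMap E Γ f) ≤ 1 →
      ∃ c : C, v (algebraMap E Γ f - algebraMap C Γ c) < 1)
    (hval : ∀ f : E, f ≠ 0 → ∃ n : ℤ, v (algebraMap E Γ f) = v w ^ n)
    (hw : w ∈ (algebraMap E Γ).range) (hm : m ≠ 0) (hpm : (p : ℤ) ∣ m + 1)
    (h : IsLocalGenerator v K p m w S A Y₀ j Y) (M : IntermediateField E Γ)
    (hSM : ∀ x ∈ S, x ∈ M) (hAM : M = IntermediateField.adjoin E A)
    (hsep : ∀ x ∈ M, IsSeparable E x) {ϖ : Γ} (hϖM : ϖ ∈ M) (hϖ0 : ϖ ≠ 0) (hϖ1 : v ϖ < 1)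
    (hϖ : ∀ x ∈ M, x ≠ 0 → ∃ n : ℤ, v x = v ϖ ^ n) (σ : Γ ≃ₐ[E] Γ)
    (hσ : ∀ x ∈ M, v x ≤ 1 → v (σ x - x) ≤ v ϖ ^ 3) : ∀ x ∈ M, σ x = x := by
  have hresM := exists_const_mem (C := C) hK hv M
  have hvϖ := v.ne_zero_iff.2 hϖ0
  have hϖ3 : v ϖ ^ 3 < 1 := pow_lt_one₀ zero_le hϖ1 (by norm_num)
  have : Algebra.IsAlgebraic M Γ := Algebra.IsAlgebraic.tower_top (K := E) M
  -- the automorphism `σ` may be assumed to fix the constants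
  obtain ⟨τ, hτK, hτM⟩ : ∃ τ : Γ ≃ₐ[E] Γ, (∀ c : K, τ (algebraMap K Γ c) = algebraMap K Γ c) ∧
      ∀ x ∈ M, τ x = σ x := by
    choose ρ hρ using fun c : K => exists_algebraMap_eq_apply (C := C) σ.symm c
    have hinj := (algebraMap K Γ).injective
    let ρ' : K →+* K :=
      { toFun := ρ
        map_one' := hinj (by simp [hρ])
        map_mul' := fun x y => hinj (by simp [hρ])
        map_zero' := hinj (by simp [hρ])
        map_add' := fun x y => hinj (by simp [hρ]) }
    obtain ⟨ψ, hψ⟩ := exists_algEquiv_constants hK hresM ρ' fun c hc => by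
      obtain ⟨c', hc'⟩ := exists_algebraMap_eq_apply (C := C) σ c
      have h1 := (hσ _ hc (hK.map_const_le c)).trans_lt hϖ3
      rw [← hc', ← map_sub] at h1
      have h2 := sub_eq_zero.1 (hK.eq_zero_of_lt h1)
      rw [h2] at hc'
      apply hinj
      change algebraMap K Γ (ρ c) = _
      rw [hρ, hc', AlgEquiv.symm_apply_apply, ← hc']
    refine ⟨(ψ.restrictScalars E).trans σ, fun c => ?_, fun x hx => ?_⟩
    · change σ (ψ _) = _
      rw [hψ]
      change σ (algebraMap K Γ (ρ c)) = _
      rw [hρ, AlgEquiv.apply_symm_apply]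
    · change σ (ψ x) = _
      rw [show ψ x = x from ψ.commutes ⟨x, hx⟩]
  suffices H : ∀ x ∈ A, τ x = x by
    intro x hx
    rw [← hτM x hx]
    have hle : M ≤ IntermediateField.fixedField (Subgroup.zpowers τ) := by
      rw [hAM, IntermediateField.adjoin_le_iff]
      intro y hy
      rw [SetLike.mem_coe, IntermediateField.mem_fixedField_iff]
      intro g hg
      exact (Subgroup.zpowers_le.2 (show τ ∈ MulAction.stabilizer (Γ ≃ₐ[E] Γ) y from H y hy)) hg
    exact (IntermediateField.mem_fixedField_iff _ _).1 (hle hx) τ (Subgroup.mem_zpowers τ)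
  let τ' : Γ ≃ₐ[K] Γ := AlgEquiv.ofRingEquiv (f := τ.toRingEquiv) hτK
  have hvτ : ∀ x, v (τ' x) = v x := hv τ.toRingEquiv τ.commutes
  have hτw : τ' w = w := by obtain ⟨e, rfl⟩ := hw; exact τ.commutes e
  have hτϖ : v (τ ϖ - ϖ) ≤ v ϖ ^ 3 := by rw [hτM _ hϖM]; exact hσ _ hϖM hϖ1.le
  have hprin : ∀ x ∈ M, x ≠ 0 → v (τ x / x - 1) < 1 := fun x hx hx0 => by
    obtain ⟨n, hn⟩ := hϖ x hx hx0
    have hxM : x / ϖ ^ n ∈ M := div_mem hx (zpow_mem hϖM n)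
    refine map_sub_lt_of_zpow (σ := τ.toRingEquiv) hϖ0 ?_ hn ?_
    · change v (τ ϖ / ϖ - 1) < 1
      rw [show τ ϖ / ϖ - 1 = (τ ϖ - ϖ) / ϖ by rw [sub_div, div_self hϖ0], map_div₀,
        div_lt_one₀ (zero_lt_iff.2 hvϖ)]
      exact hτϖ.trans_lt (pow_lt_self_of_lt_one₀ (zero_lt_iff.2 hvϖ) hϖ1 (by norm_num))
    · change v (τ _ - _) < 1
      rw [hτM _ hxM]
      refine (hσ _ hxM ?_).trans_lt hϖ3
      rw [map_div₀, map_zpow₀, hn, div_self (zpow_ne_zero n hvϖ)]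
  have hY₀ : τ' Y₀ = Y₀ := by
    obtain ⟨x, hx, hrad⟩ := h.exists_radical
    have hx0 : x ≠ 0 := by
      rintro rfl
      simp [hm] at hrad
    refine hK.map_eq_of_radical hm τ' hvτ hrad ?_ (hprin x (hSM x hx) hx0)
    rw [h.pow_eq, map_add τ', map_one, hτw]
  suffices hY : τ' Y = Y from fun x hx => h.fixes τ' hvτ hτw hY x hx
  -- the field `B` generated by `M` and the constants contains `Y`
  let B := adjoinConstants K M
  have : Algebra.IsAlgebraic B Γ := Algebra.IsAlgebraic.tower_top (K := M) B
  have hYB : Y ∈ B := by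
    have hMB : ∀ x ∈ M, x ∈ (algebraMap B Γ).range := fun x hx =>
      ⟨algebraMap M B ⟨x, hx⟩, rfl⟩
    obtain ⟨y, hy⟩ := (h.mem_range (B := B) hK hv hm hpm
      (fun c => ⟨⟨_, algebraMap_mem_adjoinConstants c⟩, rfl⟩)
      (fun e => hMB _ (M.algebraMap_mem e))
      (by obtain ⟨e, rfl⟩ := hw; exact hMB _ (M.algebraMap_mem e))
      (fun x hx => hMB x (hSM x hx))
      (fun x hx => hMB x (hAM ▸ IntermediateField.subset_adjoin E A hx))).2
    rw [← hy]; exact y.2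
  have hvB : ∀ x ∈ B, x ≠ 0 → ∃ n : ℤ, v x = v ϖ ^ n := fun x hx hx0 => by
    obtain ⟨f, hf, hxf⟩ := exists_map_eq_of_mem_adjoinConstants hK hresM hx
    rw [hxf]
    exact hϖ f hf (v.ne_zero_iff.1 (by rw [← hxf]; exact v.ne_zero_iff.2 hx0))
  -- the value of `Y` generates the value group of the field generated by `Y` and the constants
  have hvY : ∃ n : ℤ, v ϖ = v Y ^ n := by
    let B₀ := adjoinConstants K (⊥ : IntermediateField E Γ)
    have : Algebra.IsAlgebraic (⊥ : IntermediateField E Γ) Γ :=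
      Algebra.IsAlgebraic.tower_top (K := E) _
    have : Algebra.IsAlgebraic B₀ Γ :=
      Algebra.IsAlgebraic.tower_top (K := (⊥ : IntermediateField E Γ)) B₀
    have hEB : ∀ e : E, algebraMap E Γ e ∈ B₀ := fun e =>
      B₀.algebraMap_mem (⟨_, (⊥ : IntermediateField E Γ).algebraMap_mem e⟩ :
        (⊥ : IntermediateField E Γ))
    have hres₀ : ∀ f ∈ (⊥ : IntermediateField E Γ), v f ≤ 1 →
        ∃ c : K, algebraMap K Γ c ∈ (⊥ : IntermediateField E Γ) ∧ v (f - algebraMap K Γ c) < 1 := by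
      rintro f hf hvf
      obtain ⟨e, rfl⟩ := IntermediateField.mem_bot.1 hf
      obtain ⟨c, hc⟩ := hres e hvf
      refine ⟨algebraMap C K c, ?_, by rwa [← IsScalarTower.algebraMap_apply]⟩
      rw [← IsScalarTower.algebraMap_apply, IsScalarTower.algebraMap_apply C E Γ]
      exact IntermediateField.algebraMap_mem _ _
    have hval₀ : ∀ f : B₀, f ≠ 0 → ∃ n : ℤ, v (algebraMap B₀ Γ f) = v w ^ n := fun f hf => by
      obtain ⟨g, hg, hfg⟩ := exists_map_eq_of_mem_adjoinConstants hK hres₀ f.2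
      obtain ⟨e, rfl⟩ := IntermediateField.mem_bot.1 hg
      change ∃ n : ℤ, v (f : Γ) = _
      rw [hfg]
      refine hval e ?_
      rintro rfl
      rw [map_zero, map_zero, v.zero_iff] at hfg
      exact hf (Subtype.ext hfg)
    obtain ⟨c, hc0, hcj, -, hc⟩ := h.isAddRoot
    let d : ℕ → B₀ := fun i => ⟨_, algebraMap_mem_adjoinConstants (c i)⟩
    have hdj : d j ≠ 0 := fun h0 => hcj (by
      have := congrArg (algebraMap B₀ Γ) h0
      rw [map_zero] at this
      exact (algebraMap K Γ).injective (by rw [map_zero]; exact this))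
    obtain ⟨e, he⟩ := hw
    let P : Polynomial B₀ := addPoly p j d ^ m - Polynomial.C (1 + ⟨_, hEB e⟩)
    have hPd : P.natDegree = p ^ j * m := by
      rw [Polynomial.natDegree_sub_C, Polynomial.natDegree_pow, natDegree_addPoly hdj, mul_comm]
    have hP0 : P ≠ 0 := fun h0 => by
      rw [h0, Polynomial.natDegree_zero] at hPd
      exact mul_ne_zero (pow_pos hp.out.pos j).ne' hm hPd.symm
    have hPY : Polynomial.aeval Y P = 0 := by
      rw [map_sub, map_pow, aeval_addPoly, Polynomial.aeval_C, map_add, map_one]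
      have h1 : ∑ i ∈ Finset.range (j + 1), algebraMap B₀ Γ (d i) * Y ^ p ^ i = Y₀ := by
        rw [hc]
        exact Finset.sum_congr rfl fun i _ => by rw [Algebra.smul_def]; rfl
      rw [h1, h.pow_eq, ← he]
      exact sub_self _
    obtain ⟨-, h2⟩ := finrank_eq_and_map_eq_of_root hval₀ h.one_lt
      (by rw [h.map_eq, h.map_eq₀, ← pow_mul]) hP0 hPY hPd.le
    refine h2 ϖ ?_ hϖ0
    let B₁ := IntermediateField.adjoin B₀ {Y}
    have : Algebra.IsAlgebraic B₁ Γ := Algebra.IsAlgebraic.tower_top (K := B₀) B₁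
    have hB₀₁ : ∀ x ∈ B₀, x ∈ (algebraMap B₁ Γ).range := fun x hx =>
      ⟨algebraMap B₀ B₁ ⟨x, hx⟩, rfl⟩
    have hA₁ := h.mem_range_of_mem (B := B₁) hv
      (fun c => hB₀₁ _ (algebraMap_mem_adjoinConstants c)) (fun e => hB₀₁ _ (hEB e))
      (hB₀₁ _ (he ▸ hEB e)) ⟨⟨Y, IntermediateField.subset_adjoin _ _ rfl⟩, rfl⟩ fun x hx => by
        have := hsep x (hAM ▸ IntermediateField.subset_adjoin E A hx)
        have h3 : IsSeparable (⊥ : IntermediateField E Γ) x := this.tower_top _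
        have h4 : IsSeparable B₀ x := h3.tower_top _
        exact h4.tower_top _
    have hMB₁ : ∀ x ∈ M, x ∈ B₁ := by
      intro x hx
      rw [hAM] at hx
      induction hx using IntermediateField.adjoin_induction with
      | mem x hx => obtain ⟨y, hy⟩ := hA₁ x hx; exact hy ▸ y.2
      | algebraMap e => obtain ⟨y, hy⟩ := hB₀₁ _ (hEB e); exact hy ▸ y.2
      | add x y _ _ hx hy => exact add_mem hx hy
      | inv x _ hx => exact inv_mem hx
      | mul x y _ _ hx hy => exact mul_mem hx hy
    exact hMB₁ ϖ hϖM
  have hY0 : Y ≠ 0 := v.ne_zero_iff.1 (zero_lt_one.trans h.one_lt).ne'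
  have hvY' : v Y = (v ϖ)⁻¹ := by
    obtain ⟨n', hn'⟩ := hvY
    obtain ⟨n, hn⟩ := hvB Y hYB hY0
    rw [hn, ← zpow_mul] at hn'
    have h1 : n * n' = 1 := by
      refine (zpow_right_injective₀ (zero_lt_iff.2 hvϖ) hϖ1.ne ?_).symm
      simpa using hn'
    rcases Int.eq_one_or_neg_one_of_mul_eq_one h1 with rfl | rfl
    · rw [zpow_one] at hn
      exact absurd h.one_lt (by rw [hn]; exact hϖ1.le.not_gt)
    · rw [hn, zpow_neg, zpow_one]
  -- `Y` is a constant multiple of `ϖ⁻¹` up to an integral element of `B`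
  obtain ⟨c₁, hc₁⟩ := hK.exists_const (Y * ϖ) (by rw [map_mul, hvY', inv_mul_cancel₀ hvϖ])
  set R := Y - algebraMap K Γ c₁ * ϖ⁻¹ with hR
  have hRB : R ∈ B := sub_mem hYB (mul_mem (algebraMap_mem_adjoinConstants c₁)
    (inv_mem (B.algebraMap_mem ⟨ϖ, hϖM⟩)))
  have hvR : v R ≤ 1 := by
    rcases eq_or_ne R 0 with h0 | h0
    · rw [h0, map_zero]; exact zero_le
    obtain ⟨n, hn⟩ := hvB R hRB h0
    have h1 : v R < (v ϖ)⁻¹ := by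
      have h2 : R = (Y * ϖ - algebraMap K Γ c₁) * ϖ⁻¹ := by rw [hR]; field_simp
      rw [h2, map_mul, map_inv₀]
      exact mul_lt_of_lt_one_left (zero_lt_iff.2 (inv_ne_zero hvϖ)) hc₁
    rw [hn, ← zpow_neg_one, zpow_lt_zpow_iff_right_of_lt_one₀ (zero_lt_iff.2 hvϖ) hϖ1] at h1
    rw [hn]
    exact (zpow_le_one_iff_right_of_lt_one₀ (zero_lt_iff.2 hvϖ) hϖ1).2 (by omega)
  obtain ⟨c₂, hc₂⟩ := hK.exists_const R hvR
  have hτϖ0 : τ' ϖ ≠ 0 := by simpa using hϖ0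
  have h1 : v (τ' ϖ⁻¹ - ϖ⁻¹) < 1 := by
    have h2 : τ' ϖ⁻¹ - ϖ⁻¹ = -(τ' ϖ - ϖ) / (τ' ϖ * ϖ) := by
      rw [map_inv₀]; field_simp; ring
    rw [h2, map_div₀, Valuation.map_neg, map_mul, hvτ, div_lt_one₀
      (zero_lt_iff.2 (mul_ne_zero hvϖ hvϖ))]
    refine hτϖ.trans_lt ?_
    rw [pow_succ, ← pow_two]
    exact mul_lt_of_lt_one_right (zero_lt_iff.2 (pow_ne_zero 2 hvϖ)) hϖ1
  have h2 : v (τ' Y - Y) < 1 := by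
    have h3 : τ' Y - Y = algebraMap K Γ c₁ * (τ' ϖ⁻¹ - ϖ⁻¹) +
        (τ' (R - algebraMap K Γ c₂) - (R - algebraMap K Γ c₂)) := by
      have h4 : Y = algebraMap K Γ c₁ * ϖ⁻¹ + R := by rw [hR]; ring
      clear_value R
      conv_lhs => rw [h4]
      rw [map_add τ', map_mul τ', map_sub τ', AlgEquiv.commutes, AlgEquiv.commutes]
      ring
    rw [h3]
    refine v.map_add_lt ?_ (v.map_sub_lt (by rwa [hvτ]) hc₂)
    rw [map_mul]
    exact (mul_le_of_le_one_left' (hK.map_const_le c₁)).trans_lt h1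
  obtain ⟨c, hc⟩ := h.isAddRoot.exists_map_eq_add (σ := τ'.toAlgHom) hY₀
  change τ' Y = _ at hc
  rw [hc, add_sub_cancel_left] at h2
  rw [hc, hK.eq_zero_of_lt h2, map_zero, add_zero]

end Weak

/-! ### Finite extensions of complete fields -/

section Normed

open scoped NNReal

/-- The valuation of the spectral norm. -/
def spectralValuation (E Γ : Type*) [NontriviallyNormedField E] [IsUltrametricDist E]
    [CompleteSpace E] [Field Γ] [Algebra E Γ] [Algebra.IsAlgebraic E Γ] : Valuation Γ ℝ≥0 where
  toFun x := ⟨spectralNorm E Γ x, spectralNorm_nonneg x⟩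
  map_zero' := NNReal.eq spectralNorm_zero
  map_one' := NNReal.eq spectralNorm_one
  map_mul' x y := NNReal.eq (spectralAlgNorm_mul x y)
  map_add_le_max' x y := isNonarchimedean_spectralNorm x y

variable {L : Type*} [NormedField L] [CompleteSpace L] [IsUltrametricDist L] (E : Subfield L)
  {F N : Type*} [Field F] [Field N] [Algebra F N] [FiniteDimensional F N]

/-- The completion of a finite extension is a finite extension of the completion of the base field,
and its norm extends to an invariant valuation of the algebraic closure. -/
theorem exists_valuation_of_closed (hE : IsClosed (E : Set L)) (hE1 : ∃ e ∈ E, 1 < ‖e‖)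
    (f : N →+* L) (hf : DenseRange f) (hfE : ∀ x : F, f (algebraMap F N x) ∈ E) :
    FiniteDimensional E L ∧ IntermediateField.adjoin E (Set.range f) = ⊤ ∧
      ∃ v : Valuation (AlgebraicClosure L) ℝ≥0, IsInvariant v E ∧
        ∀ x : L, v (algebraMap L (AlgebraicClosure L) x) = ‖x‖₊ := by
  let _ : NontriviallyNormedField E :=
    { (inferInstance : NormedField E) with
      non_trivial := by obtain ⟨e, he, h1⟩ := hE1; exact ⟨⟨e, he⟩, h1⟩ }
  have : CompleteSpace E := hE.completeSpace_coe
  have : IsUltrametricDist E := ⟨fun x y z => dist_triangle_max (x : L) y z⟩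
  have hfin : FiniteDimensional E L ∧ IntermediateField.adjoin E (Set.range f) = ⊤ := by
    let V : Submodule E L := Submodule.span E (Set.range (f ∘ Module.finBasis F N))
    have hV : FiniteDimensional E V := FiniteDimensional.span_of_finite E (Set.finite_range _)
    have hcl : IsClosed (V : Set L) := V.closed_of_finiteDimensional
    have hle : Set.range f ⊆ V := by
      rintro _ ⟨x, rfl⟩
      rw [← (Module.finBasis F N).sum_repr x, map_sum]
      refine V.sum_mem fun i _ => ?_
      rw [Algebra.smul_def, map_mul]
      exact V.smul_mem (⟨_, hfE _⟩ : E) (Submodule.subset_span ⟨i, rfl⟩)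
    have htop : V = ⊤ := by
      rw [eq_top_iff]
      rintro x -
      have := hcl.closure_subset_iff.2 hle (hf x)
      exact this
    constructor
    · rw [htop] at hV
      exact Module.Finite.equiv (Submodule.topEquiv (R := E) (M := L))
    · have hle' : V ≤ Subalgebra.toSubmodule
          (IntermediateField.adjoin E (Set.range f)).toSubalgebra := by
        refine Submodule.span_le.2 ?_
        rintro _ ⟨i, rfl⟩
        exact IntermediateField.subset_adjoin E _ ⟨_, rfl⟩
      rw [htop] at hle'
      exact eq_top_iff.2 fun x _ => hle' (Submodule.mem_top (x := x))
  obtain ⟨hfin, hadj⟩ := hfin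
  refine ⟨hfin, hadj, ?_⟩
  let _ : NormedAlgebra E L := { (inferInstance : Algebra E L) with
    norm_smul_le := fun e x => (norm_mul_le (e : L) x) }
  have : Algebra.IsAlgebraic E (AlgebraicClosure L) := Algebra.IsAlgebraic.trans E L _
  refine ⟨spectralValuation E (AlgebraicClosure L), fun σ hσ x => ?_, fun x => ?_⟩
  · exact NNReal.eq (spectralNorm_eq_of_equiv (AlgEquiv.ofRingEquiv hσ) x).symm
  · refine NNReal.eq ?_
    change spectralNorm E (AlgebraicClosure L) (algebraMap L _ x) = ‖x‖
    rw [NormedAlgebra.norm_eq_spectralNorm E x, ← spectralNorm.eq_of_tower]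

end Normed

/-! ### Values and residues of rational function fields -/

section RationalFunctions

variable {C N Γ₀ : Type*} [Field C] [Field N] [Algebra C N] [LinearOrderedCommGroupWithZero Γ₀]
  {v : Valuation N Γ₀} {t w : N}

lemma map_aeval_of_one_lt (hC : ∀ c : C, c ≠ 0 → v (algebraMap C N c) = 1) (hw : 1 < v w)
    {P : Polynomial C} (hP : P ≠ 0) : v (Polynomial.aeval w P) = v w ^ P.natDegree := by
  have : v.IsTrivialOn C := ⟨hC⟩
  exact Polynomial.valuation_aeval_eq_valuation_X_pow_natDegree_of_one_lt_valuation_X w hw hP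

lemma exists_aeval_div_of_mem_adjoin (h : w = t ∨ w = t⁻¹) {x : N}
    (hx : x ∈ IntermediateField.adjoin C {t}) :
    ∃ P Q : Polynomial C, x = Polynomial.aeval w P / Polynomial.aeval w Q := by
  have hx' : x ∈ IntermediateField.adjoin C {w} := by
    obtain h | h := h
    · rwa [h]
    rw [h]
    refine IntermediateField.adjoin_le_iff.2 ?_ hx
    rintro _ rfl
    exact inv_mem_iff.1 (IntermediateField.mem_adjoin_simple_self C _)
  exact (IntermediateField.mem_adjoin_simple_iff C x).1 hx'

lemma exists_map_eq_zpow_of_mem_adjoin (hC : ∀ c : C, c ≠ 0 → v (algebraMap C N c) = 1)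
    (hw : 1 < v w) (h : w = t ∨ w = t⁻¹) {x : N} (hx : x ∈ IntermediateField.adjoin C {t})
    (hx0 : x ≠ 0) : ∃ m : ℤ, v x = v w ^ m := by
  obtain ⟨P, Q, rfl⟩ := exists_aeval_div_of_mem_adjoin h hx
  have hP : P ≠ 0 := by rintro rfl; simp at hx0
  have hQ : Q ≠ 0 := by rintro rfl; simp at hx0
  refine ⟨P.natDegree - Q.natDegree, ?_⟩
  rw [map_div₀, map_aeval_of_one_lt hC hw hP, map_aeval_of_one_lt hC hw hQ,
    zpow_sub₀ (zero_lt_one.trans hw).ne', zpow_natCast, zpow_natCast]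

lemma exists_const_of_mem_adjoin (hC : ∀ c : C, c ≠ 0 → v (algebraMap C N c) = 1)
    (hw : 1 < v w) (h : w = t ∨ w = t⁻¹) {x : N} (hx : x ∈ IntermediateField.adjoin C {t})
    (hx1 : v x ≤ 1) : ∃ c : C, v (x - algebraMap C N c) < 1 := by
  obtain ⟨P, Q, rfl⟩ := exists_aeval_div_of_mem_adjoin h hx
  have hw0 : (0 : Γ₀) < v w := zero_lt_one.trans hw
  by_cases hP : P = 0
  · exact ⟨0, by simp [hP]⟩
  by_cases hQ : Q = 0
  · exact ⟨0, by simp [hQ]⟩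
  have hQ0 : Polynomial.aeval w Q ≠ 0 := by
    rw [← v.ne_zero_iff, map_aeval_of_one_lt hC hw hQ]; exact pow_ne_zero _ hw0.ne'
  rw [map_div₀, map_aeval_of_one_lt hC hw hP, map_aeval_of_one_lt hC hw hQ,
    div_le_one₀ (pow_pos hw0 _), pow_le_pow_iff_right₀ hw] at hx1
  obtain hlt | heq := hx1.lt_or_eq
  · refine ⟨0, ?_⟩
    rwa [map_zero, sub_zero, map_div₀, map_aeval_of_one_lt hC hw hP, map_aeval_of_one_lt hC hw hQ,
      div_lt_one₀ (pow_pos hw0 _), pow_lt_pow_iff_right₀ hw]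
  · set c := P.leadingCoeff / Q.leadingCoeff with hc
    have hQl : Q.leadingCoeff ≠ 0 := Polynomial.leadingCoeff_ne_zero.2 hQ
    have hc0 : c ≠ 0 := div_ne_zero (Polynomial.leadingCoeff_ne_zero.2 hP) hQl
    refine ⟨c, ?_⟩
    have hx : Polynomial.aeval w P / Polynomial.aeval w Q - algebraMap C N c =
        Polynomial.aeval w (P - Polynomial.C c * Q) / Polynomial.aeval w Q := by
      rw [map_sub, map_mul, Polynomial.aeval_C]
      field_simp
    rw [hx]
    by_cases hR : P - Polynomial.C c * Q = 0
    · simp [hR]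
    have hd : (P - Polynomial.C c * Q).natDegree < Q.natDegree := by
      refine (Polynomial.natDegree_lt_natDegree hR (q := P) ?_).trans_eq heq
      refine Polynomial.degree_sub_lt_left ?_ hP ?_
      · rw [Polynomial.degree_C_mul hc0, Polynomial.degree_eq_natDegree hP,
          Polynomial.degree_eq_natDegree hQ, heq]
      · rw [Polynomial.leadingCoeff_mul, Polynomial.leadingCoeff_C, hc, div_mul_cancel₀ _ hQl]
    rwa [map_div₀, map_aeval_of_one_lt hC hw hR, map_aeval_of_one_lt hC hw hQ,
      div_lt_one₀ (pow_pos hw0 _), pow_lt_pow_iff_right₀ hw]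

/-- A finite extension of a discretely valued field is discretely valued. -/
theorem exists_uniformizer_of_finite {F : Type*} [Field F] [Algebra F N] [FiniteDimensional F N]
    (hF : ∀ x : F, x ≠ 0 → ∃ m : ℤ, v (algebraMap F N x) = v w ^ m) (hw : 1 < v w) :
    ∃ ϖ : N, ϖ ≠ 0 ∧ v ϖ < 1 ∧ ∀ x : N, x ≠ 0 → ∃ m : ℤ, v x = v ϖ ^ m := by
  have hw0 : v w ≠ 0 := (zero_lt_one.trans hw).ne'
  set D := (Module.finrank F N).factorial with hD
  have hD0 : D ≠ 0 := Nat.factorial_ne_zero _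
  -- two terms in the minimal equation of `x` have the same value
  have key : ∀ x : N, x ≠ 0 → ∃ m : ℤ, v x ^ D = v w ^ m := by
    intro x hx
    have hvx : v x ≠ 0 := v.ne_zero_iff.2 hx
    have hint : IsIntegral F x := Algebra.IsIntegral.isIntegral x
    set P := minpoly F x with hP
    have : ∃ i ∈ Finset.range (P.natDegree + 1), ∃ j ∈ Finset.range (P.natDegree + 1),
        P.coeff i • x ^ i ≠ 0 ∧ v (P.coeff i • x ^ i) = v (P.coeff j • x ^ j) ∧ i ≠ j := by
      by_contra! hcon
      obtain ⟨i, -, h1, h2⟩ := exists_map_sum_eq v (Finset.range (P.natDegree + 1)) (by simp)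
        (fun i => P.coeff i • x ^ i) hcon
      have h3 := h2 P.natDegree (by simp)
      rw [← h1, ← Polynomial.aeval_eq_sum_range, minpoly.aeval, map_zero, le_zero_iff,
        v.zero_iff, smul_eq_zero] at h3
      obtain h3 | h3 := h3
      · exact minpoly.ne_zero hint (Polynomial.leadingCoeff_eq_zero.1 h3)
      · exact hx (eq_zero_of_pow_eq_zero h3)
    have key2 : ∃ i ∈ Finset.range (P.natDegree + 1), ∃ j ∈ Finset.range (P.natDegree + 1),
        i < j ∧ ∃ m : ℤ, v x ^ (j - i) = v w ^ m := by
      have aux : ∀ i j, P.coeff i • x ^ i ≠ 0 → v (P.coeff i • x ^ i) = v (P.coeff j • x ^ j) →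
          i < j → ∃ m : ℤ, v x ^ (j - i) = v w ^ m := by
        intro i j h1 h2 hij
        have h3 : P.coeff j • x ^ j ≠ 0 := by
          rw [← v.ne_zero_iff, ← h2]; exact v.ne_zero_iff.2 h1
        obtain ⟨m, hm⟩ := hF _ (left_ne_zero_of_smul h1)
        obtain ⟨m', hm'⟩ := hF _ (left_ne_zero_of_smul h3)
        refine ⟨m - m', ?_⟩
        rw [Algebra.smul_def, Algebra.smul_def, map_mul, map_mul, map_pow, map_pow, hm, hm'] at h2
        rw [zpow_sub₀ hw0, eq_div_iff (zpow_ne_zero _ hw0), pow_sub₀ _ hvx hij.le]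
        field_simp
        rw [mul_comm, ← h2, mul_comm]
      obtain ⟨i, hi, j, hj, h1, h2, hij⟩ := this
      obtain hlt | hlt := hij.lt_or_gt
      · exact ⟨i, hi, j, hj, hlt, aux i j h1 h2 hlt⟩
      · refine ⟨j, hj, i, hi, hlt, aux j i ?_ h2.symm hlt⟩
        rw [← v.ne_zero_iff, ← h2]; exact v.ne_zero_iff.2 h1
    obtain ⟨i, -, j, hj, hij, m, hm⟩ := key2
    have hdeg : P.natDegree ≤ Module.finrank F N := minpoly.natDegree_le x
    obtain ⟨e, he⟩ : j - i ∣ D := Nat.dvd_factorial (by omega) (by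
      have := Finset.mem_range.1 hj; omega)
    exact ⟨m * e, by rw [he, pow_mul, hm, zpow_mul, zpow_natCast]⟩
  -- the exponents that occur form a subgroup of `ℤ`
  let S : AddSubgroup ℤ :=
    { carrier := {m | ∃ x : N, x ≠ 0 ∧ v x ^ D = v w ^ m}
      add_mem' := by
        rintro m m' ⟨x, hx, h⟩ ⟨x', hx', h'⟩
        exact ⟨x * x', mul_ne_zero hx hx', by rw [map_mul, mul_pow, h, h', zpow_add₀ hw0]⟩
      zero_mem' := ⟨1, one_ne_zero, by simp⟩
      neg_mem' := by
        rintro m ⟨x, hx, h⟩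
        exact ⟨x⁻¹, inv_ne_zero hx, by rw [map_inv₀, inv_pow, h, zpow_neg]⟩ }
  obtain ⟨g, hg⟩ := Int.subgroup_cyclic S
  rw [← AddSubgroup.zmultiples_eq_closure] at hg
  have hgS : -|g| ∈ S := by
    rw [neg_mem_iff, hg, Int.mem_zmultiples_iff, dvd_abs]
  have hDS : (D : ℤ) ∈ S := ⟨w, v.ne_zero_iff.1 hw0, by rw [zpow_natCast]⟩
  have hg0 : g ≠ 0 := by
    rintro rfl
    rw [hg, Int.mem_zmultiples_iff, zero_dvd_iff] at hDS
    exact hD0 (by exact_mod_cast hDS)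
  obtain ⟨ϖ, hϖ, hϖg⟩ := hgS
  refine ⟨ϖ, hϖ, ?_, fun x hx => ?_⟩
  · have : v ϖ ^ D < 1 := by
      rw [hϖg]
      exact zpow_lt_one_of_neg₀ hw (by simpa using hg0)
    exact (pow_lt_one_iff_of_nonneg zero_le hD0).1 this
  · obtain ⟨m, hm⟩ := key x hx
    have hmS : m ∈ S := ⟨x, hx, hm⟩
    rw [hg, Int.mem_zmultiples_iff, ← abs_dvd] at hmS
    obtain ⟨e, rfl⟩ := hmS
    refine ⟨-e, (pow_left_inj₀ zero_le zero_le hD0).1 ?_⟩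
    rw [hm, ← zpow_natCast (v ϖ ^ (-e)), ← zpow_mul, mul_comm (-e), zpow_mul (v ϖ),
      zpow_natCast, hϖg,
      ← zpow_mul]
    congr 1; ring

end RationalFunctions

/-! ### Completions at a place -/

section Complete

open scoped NNReal

/-- The field `L` is a completion of the finite extension `N / F` at the place `O`, and `E` is the
closure of `F` in `L`; the valuation `v` of the algebraic closure of `L` extends that of `O`. -/
structure IsCompletion (F : Type*) {N L : Type*} [Field F] [Field N] [Algebra F N] [Field L]
    (O : ValuationSubring N) (E : Subfield L) (f : N →+* L)
    (v : Valuation (AlgebraicClosure L) ℝ≥0) : Prop where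
  finite : FiniteDimensional E L
  adjoin_eq_top : IntermediateField.adjoin E (Set.range f) = ⊤
  invariant : IsInvariant v E
  map_mem : ∀ x : F, f (algebraMap F N x) ∈ E
  le_one_iff : ∀ x : N, v (algebraMap L _ (f x)) ≤ 1 ↔ x ∈ O
  exists_sub_lt : ∀ (x : L) (ε : ℝ≥0), 0 < ε → ∃ y : N, v (algebraMap L _ (x - f y)) < ε
  exists_sub_lt_of_mem : ∀ x ∈ E, ∀ ε : ℝ≥0, 0 < ε →
    ∃ y : F, v (algebraMap L _ (x - f (algebraMap F N y))) < ε
  exists_extension : ∀ σ : N ≃ₐ[F] N, (∀ x, O.valuation (σ x) = O.valuation x) →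
    ∃ σ' : L ≃ₐ[E] L, ∀ x : N, σ' (f x) = f (σ x)

lemma toCompleted_apply {N : Type*} [Field N] (O : ValuationSubring N) (x : N) :
    (Valued.v : Valuation (Completed O) _) (toCompleted O x) = O.valuation x := by
  change Valued.v (((WithVal.equiv O.valuation).symm x : WithVal O.valuation) : Completed O) = _
  rw [Valued.valuedCompletion_apply]
  rfl

lemma exists_toCompleted_eq {N : Type*} [Field N] (O : ValuationSubring N) (x : Completed O) :
    ∃ y : N, (Valued.v : Valuation (Completed O) _) x = O.valuation y := by
  obtain ⟨r, hr⟩ := Valued.exists_coe_eq_v x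
  exact ⟨WithVal.equiv O.valuation r, hr⟩

/-- An automorphism that preserves the place `O` extends to the completion. -/
lemma exists_extension_completed {F N : Type*} [Field F] [Field N] [Algebra F N]
    (O : ValuationSubring N) [FiniteDimensional (completedBase F O) (Completed O)]
    (σ : N ≃ₐ[F] N) (hσ : ∀ x, O.valuation (σ x) = O.valuation x) :
    ∃ σ' : Completed O ≃ₐ[completedBase F O] Completed O,
      ∀ x : N, σ' (toCompleted O x) = toCompleted O (σ x) := by
  let e := WithVal.equiv O.valuation
  let s : WithVal O.valuation →+* WithVal O.valuation :=
    (e.symm.toRingHom.comp (σ : N →+* N)).comp e.toRingHom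
  have hs : Continuous s := by
    refine continuous_of_continuousAt_zero s ?_
    rw [ContinuousAt, map_zero]
    refine (Valued.hasBasis_nhds_zero _ _).tendsto_iff (Valued.hasBasis_nhds_zero _ _) |>.2 ?_
    intro γ _
    refine ⟨γ, trivial, fun x hx => ?_⟩
    have h1 : Valued.v.restrict (s x) = Valued.v.restrict x :=
      (Valuation.restrict_inj _).2 (hσ (e x))
    exact (congrArg (· < γ.1) h1).mpr hx
  let s' : Completed O →+* Completed O := UniformSpace.Completion.mapRingHom s hs
  have hs' : ∀ x : N, s' (toCompleted O x) = toCompleted O (σ x) := by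
    intro x
    exact UniformSpace.Completion.mapRingHom_coe hs (e.symm x)
  have hfix : ∀ x ∈ completedBase F O, s' x = x := by
    intro x hx
    have hcl : IsClosed {x : Completed O | s' x = x} :=
      isClosed_eq UniformSpace.Completion.continuous_map continuous_id
    refine closure_minimal ?_ hcl hx
    rintro _ ⟨y, rfl⟩
    exact (hs' _).trans (by simp)
  let g : Completed O →ₐ[completedBase F O] Completed O :=
    { s' with commutes' := fun x => hfix x x.2 }
  exact ⟨AlgEquiv.ofBijective g g.bijective, hs'⟩

/-- A discrete valuation is of rank one. -/
lemma isRankOneDiscrete_of_zpow {L Γ₀ : Type*} [Field L] [LinearOrderedCommGroupWithZero Γ₀]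
    (v : Valuation L Γ₀) {ϖ : L} (hϖ : ϖ ≠ 0) (hϖ1 : v ϖ < 1)
    (h : ∀ x : L, x ≠ 0 → ∃ m : ℤ, v x = v ϖ ^ m) : v.IsRankOneDiscrete := by
  refine ⟨Units.mk0 (v ϖ) (v.ne_zero_iff.2 hϖ), ?_, ?_⟩
  · ext γ
    have h1 : γ ∈ MonoidWithZeroHom.valueGroup (.ofClass v) ↔
        (γ : Γ₀) ∈ Units.val '' (MonoidWithZeroHom.valueGroup (.ofClass v) : Set Γ₀ˣ) := by
      rw [Set.mem_image]
      exact ⟨fun h => ⟨γ, h, rfl⟩, fun ⟨δ, h, hδ⟩ => Units.ext hδ ▸ h⟩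
    rw [h1, MonoidWithZeroHom.valueGroup_eq_range, Subgroup.mem_zpowers_iff]
    constructor
    · rintro ⟨m, rfl⟩
      exact ⟨⟨ϖ ^ m, by simp⟩, Units.ne_zero _⟩
    · rintro ⟨⟨x, hx⟩, -⟩
      have hx : v x = γ := hx
      have hx0 : x ≠ 0 := by rintro rfl; rw [map_zero] at hx; exact γ.ne_zero hx.symm
      obtain ⟨m, hm⟩ := h x hx0
      exact ⟨m, Units.ext (by simp [← hx, hm])⟩
  · rwa [← Units.val_lt_val]

/-- The completion of `N` at a discrete place has the properties that are collected in
`IsCompletion`. -/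
theorem exists_isCompletion {F N : Type*} [Field F] [Field N] [Algebra F N]
    [FiniteDimensional F N] (O : ValuationSubring N) {ϖ : N} (hϖ : ϖ ≠ 0)
    (hϖ1 : O.valuation ϖ < 1) (h : ∀ x : N, x ≠ 0 → ∃ m : ℤ, O.valuation x = O.valuation ϖ ^ m)
    {w : F} (hw : 1 < O.valuation (algebraMap F N w)) :
    ∃ v : Valuation (AlgebraicClosure (Completed O)) ℝ≥0,
      IsCompletion F O (completedBase F O) (toCompleted O) v ∧
      ∀ x : Completed O, v (algebraMap (Completed O) _ x) ≤ 1 ↔ x ∈ completedIntegers O := by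
  have : (Valued.v : Valuation (Completed O) O.ValueGroup).IsRankOneDiscrete := by
    refine isRankOneDiscrete_of_zpow _ (ϖ := toCompleted O ϖ) ?_ ?_ ?_
    · exact (map_ne_zero _).2 hϖ
    · rwa [toCompleted_apply]
    · intro x hx
      obtain ⟨y, hy⟩ := exists_toCompleted_eq O x
      have hy0 : y ≠ 0 := by
        rintro rfl
        rw [map_zero, Valuation.zero_iff] at hy
        exact hx hy
      rw [toCompleted_apply, hy]
      exact h y hy0
  -- the base `2` of the absolute value is an arbitrary choice
  let _ : (Valued.v : Valuation (Completed O) O.ValueGroup).RankOne :=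
    Valuation.IsRankOneDiscrete.rankOne _ (e := 2) (by norm_num)
  let _ : NormedField (Completed O) := Valued.toNormedField (Completed O) O.ValueGroup
  have hcomp : CompleteSpace (Completed O) := by
    exact (inferInstance : CompleteSpace (UniformSpace.Completion (WithVal O.valuation)))
  have hdense : DenseRange (toCompleted O) := by
    have h1 : DenseRange ((↑) : WithVal O.valuation → Completed O) :=
      UniformSpace.Completion.denseRange_coe
    exact h1.comp (WithVal.equiv O.valuation).symm.surjective.denseRange
      (UniformSpace.Completion.continuous_coe _)
  have hmem : ∀ x : F, toCompleted O (algebraMap F N x) ∈ completedBase F O := fun x =>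
    Subfield.le_topologicalClosure _ ⟨x, rfl⟩
  obtain ⟨hfin, hadj, v, hinv, hv⟩ := exists_valuation_of_closed (F := F) (N := N)
    (completedBase F O) (Subfield.isClosed_topologicalClosure _)
    ⟨toCompleted O (algebraMap F N w), hmem w, by
      rw [Valued.toNormedField.one_lt_norm_iff, toCompleted_apply]; exact hw⟩
    (toCompleted O) hdense hmem
  have hle : ∀ x : Completed O, v (algebraMap (Completed O) _ x) ≤ 1 ↔ x ∈ completedIntegers O := by
    intro x
    rw [hv]
    exact Valued.toNormedField.norm_le_one_iff
  refine ⟨v, ⟨hfin, hadj, hinv, hmem, fun x => ?_, fun x ε hε => ?_, fun x hx ε hε => ?_,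
    exists_extension_completed O⟩, hle⟩
  · rw [hle, Valuation.mem_valuationSubring_iff, toCompleted_apply,
      ValuationSubring.valuation_le_one_iff]
  · obtain ⟨y, hy⟩ := hdense.exists_dist_lt x (NNReal.coe_pos.2 hε)
    exact ⟨y, by rw [hv]; rwa [dist_eq_norm] at hy⟩
  · have hx' : x ∈ closure
        (((toCompleted O).comp (algebraMap F N)).fieldRange : Set (Completed O)) := hx
    obtain ⟨_, ⟨y, rfl⟩, hy⟩ := Metric.mem_closure_iff.1 hx' ε (NNReal.coe_pos.2 hε)
    exact ⟨y, by rw [hv]; rwa [dist_eq_norm] at hy⟩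

end Complete

/-! ### Values and residues in the completion -/

section CompletionValues

open scoped NNReal

variable {C F N L : Type*} [Field C] [Field F] [Field N] [Field L] [Algebra C F] [Algebra C N]
  [Algebra F N] [IsScalarTower C F N] {O : ValuationSubring N} {E : Subfield L} {f : N →+* L}
  {v : Valuation (AlgebraicClosure L) ℝ≥0}

lemma IsPlace.valuation_eq_one (hC : IsPlace C O) {c : C} (hc : c ≠ 0) :
    O.valuation (algebraMap C N c) = 1 := by
  have h0 : algebraMap C N c ≠ 0 := (map_ne_zero _).2 hc
  refine le_antisymm ((O.valuation_le_one_iff _).2 (hC.constants_mem c)) ?_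
  have h1 := (O.valuation_le_one_iff _).2 (hC.constants_mem c⁻¹)
  rwa [map_inv₀, map_inv₀, inv_le_one₀ (zero_lt_iff.2 (O.valuation.ne_zero_iff.2 h0))] at h1

/-- The embedding of `N` into the algebraic closure of its completion. -/
def closureEmbedding (f : N →+* L) : N →+* AlgebraicClosure L := (algebraMap L _).comp f

lemma closureEmbedding_apply (f : N →+* L) (x : N) :
    closureEmbedding f x = algebraMap L _ (f x) := rfl

/-- The field `F` is generated by `t` over `C`, and `w`, which is `t` or `t⁻¹`, has a pole
at `v`. -/
structure IsPole (C : Type*) {F : Type*} [Field C] [Field F] [Algebra C F] (t : F)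
    (v : Valuation F ℝ≥0) (w : F) : Prop where
  adjoin_eq_top : IntermediateField.adjoin C {t} = ⊤
  eq_or_eq : w = t ∨ w = t⁻¹
  one_lt : 1 < v w

namespace IsCompletion

lemma isEquiv (h : IsCompletion F O E f v) :
    O.valuation.IsEquiv (v.comap (closureEmbedding f)) :=
  Valuation.isEquiv_iff_val_le_one.2 fun {x} =>
    (O.valuation_le_one_iff x).trans (h.le_one_iff x).symm

lemma exists_map_eq (h : IsCompletion F O E f v) {x : L} (hx : x ≠ 0) :
    ∃ y : N, y ≠ 0 ∧ v (algebraMap L _ x) = v (closureEmbedding f y) := by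
  have hx' : v (algebraMap L _ x) ≠ 0 := v.ne_zero_iff.2 ((map_ne_zero _).2 hx)
  obtain ⟨y, hy⟩ := h.exists_sub_lt x _ (pos_iff_ne_zero.2 hx')
  rw [map_sub, Valuation.map_sub_swap] at hy
  have h1 := v.map_eq_of_sub_lt hy
  refine ⟨y, ?_, h1.symm⟩
  rintro rfl
  rw [map_zero, map_zero, map_zero] at h1
  exact hx' h1.symm

lemma exists_map_eq_of_mem (h : IsCompletion F O E f v) {x : E} (hx : x ≠ 0) :
    ∃ y : F, y ≠ 0 ∧ v (algebraMap E _ x) = v (closureEmbedding f (algebraMap F N y)) := by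
  have hx' : v (algebraMap E (AlgebraicClosure L) x) ≠ 0 := v.ne_zero_iff.2 ((map_ne_zero _).2 hx)
  obtain ⟨y, hy⟩ := h.exists_sub_lt_of_mem x x.2 _ (pos_iff_ne_zero.2 hx')
  rw [map_sub, Valuation.map_sub_swap] at hy
  have h1 := v.map_eq_of_sub_lt hy
  refine ⟨y, ?_, h1.symm⟩
  rintro rfl
  rw [map_zero, map_zero, map_zero, map_zero] at h1
  exact hx' h1.symm

variable {t w : F}

lemma map_const (h : IsCompletion F O E f v) (hC : IsPlace C O) {c : C} (hc : c ≠ 0) :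
    v (closureEmbedding f (algebraMap C N c)) = 1 :=
  (Valuation.isEquiv_iff_val_eq_one.1 h.isEquiv).1 (hC.valuation_eq_one hc)

/-- The values of the completed rational function field are the powers of the value of `w`. -/
theorem exists_map_eq_zpow (h : IsCompletion F O E f v) (hC : IsPlace C O)
    (hw : IsPole C t (v.comap ((closureEmbedding f).comp (algebraMap F N))) w) {x : E}
    (hx : x ≠ 0) :
    ∃ m : ℤ, v (algebraMap E _ x) = v (closureEmbedding f (algebraMap F N w)) ^ m := by
  obtain ⟨y, hy, hxy⟩ := h.exists_map_eq_of_mem hx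
  rw [hxy]
  refine exists_map_eq_zpow_of_mem_adjoin (C := C)
    (v := v.comap ((closureEmbedding f).comp (algebraMap F N))) (fun c hc => ?_) hw.one_lt
    hw.eq_or_eq (hw.adjoin_eq_top ▸ IntermediateField.mem_top) hy
  have := h.map_const hC hc
  rwa [IsScalarTower.algebraMap_apply C F N] at this

/-- The residue field of the completed rational function field at the zero or the pole of `t` is
the field of constants. -/
theorem exists_const (h : IsCompletion F O E f v) (hC : IsPlace C O)
    (hw : IsPole C t (v.comap ((closureEmbedding f).comp (algebraMap F N))) w) {x : E}
    (hx : v (algebraMap E _ x) ≤ 1) :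
    ∃ c : C, v (algebraMap E _ x - closureEmbedding f (algebraMap C N c)) < 1 := by
  obtain ⟨y, hy⟩ := h.exists_sub_lt_of_mem x x.2 1 one_pos
  rw [map_sub] at hy
  have hy1 : v (closureEmbedding f (algebraMap F N y)) ≤ 1 := by
    have h2 := v.map_sub_le hx hy.le
    rwa [show algebraMap E (AlgebraicClosure L) x - (algebraMap L _ (x : L) -
      algebraMap L _ (f (algebraMap F N y))) = closureEmbedding f (algebraMap F N y) from
        sub_sub_cancel _ _] at h2
  obtain ⟨c, hc⟩ := exists_const_of_mem_adjoin (C := C)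
    (v := v.comap ((closureEmbedding f).comp (algebraMap F N))) (x := y) (fun c hc => by
      have := h.map_const hC hc
      rwa [IsScalarTower.algebraMap_apply C F N] at this) hw.one_lt hw.eq_or_eq
    (hw.adjoin_eq_top ▸ IntermediateField.mem_top) hy1
  refine ⟨c, ?_⟩
  have h3 := v.map_add_lt hy hc
  rwa [map_sub, RingHom.comp_apply, RingHom.comp_apply, ← IsScalarTower.algebraMap_apply C F N,
    ← closureEmbedding_apply, sub_add_sub_cancel] at h3

/-- A uniformizer of the completion can be chosen in `N`. -/
theorem exists_uniformizer [FiniteDimensional F N] (h : IsCompletion F O E f v) (hC : IsPlace C O)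
    (hw : IsPole C t (v.comap ((closureEmbedding f).comp (algebraMap F N))) w) :
    ∃ ϖ : N, ϖ ≠ 0 ∧ v (closureEmbedding f ϖ) < 1 ∧
      ∀ x : L, x ≠ 0 → ∃ m : ℤ, v (algebraMap L _ x) = v (closureEmbedding f ϖ) ^ m := by
  have hF : ∀ x : F, x ≠ 0 → ∃ m : ℤ, v (closureEmbedding f (algebraMap F N x)) =
      v (closureEmbedding f (algebraMap F N w)) ^ m := fun x hx =>
    h.exists_map_eq_zpow hC hw (x := ⟨_, h.map_mem x⟩) fun h0 =>
      hx ((map_eq_zero (f.comp (algebraMap F N))).1 (congrArg Subtype.val h0))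
  obtain ⟨ϖ, h0, h1, h2⟩ := exists_uniformizer_of_finite (F := F)
    (v := v.comap (closureEmbedding f)) (w := algebraMap F N w) hF hw.one_lt
  refine ⟨ϖ, h0, h1, fun x hx => ?_⟩
  obtain ⟨y, hy, hxy⟩ := h.exists_map_eq hx
  rw [hxy]
  exact h2 y hy

/-- The residues of the algebraic closure of the completion are represented by the algebraic
closure `K` of the field of constants. -/
theorem hasConstantResidues (h : IsCompletion F O E f v) (hC : IsPlace C O)
    (hw : IsPole C t (v.comap ((closureEmbedding f).comp (algebraMap F N))) w)
    [Algebra C (AlgebraicClosure L)]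
    (hCL : ∀ c, algebraMap C (AlgebraicClosure L) c = closureEmbedding f (algebraMap C N c))
    (K : Type*) [Field K] [Algebra C K] [Algebra.IsAlgebraic C K] [IsAlgClosed K]
    [Algebra K (AlgebraicClosure L)] [IsScalarTower C K (AlgebraicClosure L)] :
    HasConstantResidues v K := by
  have := h.finite
  have : Algebra.IsAlgebraic E (AlgebraicClosure L) := Algebra.IsAlgebraic.trans E L _
  have hCv : ∀ c : C, c ≠ 0 → v (algebraMap C (AlgebraicClosure L) c) = 1 := fun c hc => by
    rw [hCL]; exact h.map_const hC hc
  have hle : ∀ c : K, v (algebraMap K _ c) ≤ 1 := by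
    intro c
    by_contra! hlt
    have hint : IsIntegral C c := Algebra.IsIntegral.isIntegral c
    have h1 := map_aeval_of_one_lt hCv hlt (minpoly.ne_zero hint)
    rw [Polynomial.aeval_algebraMap_apply, minpoly.aeval, map_zero, map_zero] at h1
    exact pow_ne_zero _ (zero_lt_one.trans hlt).ne' h1.symm
  refine ⟨fun c hc => le_antisymm (hle c) ?_, ?_⟩
  · have h1 := hle c⁻¹
    have h0 : v (algebraMap K (AlgebraicClosure L) c) ≠ 0 :=
      v.ne_zero_iff.2 ((map_ne_zero _).2 hc)
    rwa [map_inv₀, map_inv₀, inv_le_one₀ (zero_lt_iff.2 h0)] at h1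
  · refine hasConstantResidues_of_invariant (C := C) (E := E)
      (fun σ x => h.invariant σ.toRingEquiv σ.commutes x) fun x hx => ?_
    obtain ⟨c, hc⟩ := h.exists_const hC hw hx
    exact ⟨c, by rwa [hCL]⟩

/-- The completion inside its algebraic closure, over the completed base field. -/
def closureRange (E : Subfield L) : IntermediateField E (AlgebraicClosure L) :=
  (IsScalarTower.toAlgHom E L (AlgebraicClosure L)).fieldRange

/-- Generators of `N` over `F` generate the completion of `N` over `E`, which is the compositum of
`N` and `E`. -/
lemma closureRange_eq_adjoin (h : IsCompletion F O E f v) {A : Set N}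
    (hA : IntermediateField.adjoin F A = ⊤) :
    closureRange E = IntermediateField.adjoin E (closureEmbedding f '' A) := by
  refine le_antisymm ?_ (IntermediateField.adjoin_le_iff.2 ?_)
  · have h1 : ∀ x : N, closureEmbedding f x ∈
        IntermediateField.adjoin E (closureEmbedding f '' A) := by
      intro x
      let T : IntermediateField F N :=
        ((IntermediateField.adjoin E (closureEmbedding f '' A)).toSubfield.comap
          (closureEmbedding f)).toIntermediateField fun y =>
            (IntermediateField.adjoin E (closureEmbedding f '' A)).algebraMap_mem
              ⟨_, h.map_mem y⟩
      have hT : IntermediateField.adjoin F A ≤ T := IntermediateField.adjoin_le_iff.2 fun y hy =>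
        IntermediateField.subset_adjoin E _ ⟨y, hy, rfl⟩
      rw [hA] at hT
      exact hT IntermediateField.mem_top
    rintro _ ⟨x, rfl⟩
    have h2 : IntermediateField.adjoin E (Set.range f) ≤
        (IntermediateField.adjoin E (closureEmbedding f '' A)).comap
          (IsScalarTower.toAlgHom E L (AlgebraicClosure L)) := by
      refine IntermediateField.adjoin_le_iff.2 ?_
      rintro _ ⟨y, rfl⟩
      exact h1 y
    rw [h.adjoin_eq_top] at h2
    exact h2 (IntermediateField.mem_top (x := x))
  · rintro _ ⟨x, -, rfl⟩
    exact ⟨f x, rfl⟩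

lemma isSeparable_of_mem (h : IsCompletion F O E f v) [Algebra.IsSeparable F N]
    {x : AlgebraicClosure L} (hx : x ∈ closureRange E) : IsSeparable E x := by
  have h1 : Algebra.IsSeparable E (IntermediateField.adjoin E (Set.range f)) := by
    rw [IntermediateField.isSeparable_adjoin_iff_isSeparable]
    rintro _ ⟨y, rfl⟩
    let φ : F →+* E := (f.comp (algebraMap F N)).codRestrict E.toSubring h.map_mem
    have hsep : (minpoly F y).Separable := Algebra.IsSeparable.isSeparable F y
    have h2 : ((minpoly F y).map φ).Separable := hsep.map
    refine h2.of_dvd (minpoly.dvd E _ ?_)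
    have h3 := congrArg f (minpoly.aeval F y)
    rw [Polynomial.aeval_def, Polynomial.hom_eval₂, map_zero] at h3
    rw [Polynomial.aeval_def, Polynomial.eval₂_map]
    exact h3
  rw [h.adjoin_eq_top] at h1
  obtain ⟨y, rfl⟩ := hx
  have h2 : Algebra.IsSeparable E L := AlgEquiv.Algebra.isSeparable IntermediateField.topEquiv
  have h3 : IsSeparable E y := Algebra.IsSeparable.isSeparable E y
  exact h3.map (IsScalarTower.toAlgHom E L (AlgebraicClosure L)) (algebraMap L _).injective

end IsCompletion

end CompletionValues

/-! ### The local generator in the completion -/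

section CompletionGenerator

open scoped NNReal

variable {C F N L : Type*} [Field C] [Field F] [Field N] [Field L] [Algebra C F] [Algebra C N]
  [Algebra F N] [IsScalarTower C F N] {O : ValuationSubring N} {E : Subfield L} {f : N →+* L}
  {v : Valuation (AlgebraicClosure L) ℝ≥0} {t w : F}

/-- The extension `N / F` is generated by the conjugates of the elements `α j` of a chain of `l`
steps of the tower that starts at `t`, and it contains the roots of a step polynomial. -/
structure IsTowerClosure (p q a b l : ℕ) (N : Type*) [Field N] [Algebra F N] (t : F) : Prop where
  finite : FiniteDimensional F N
  isGalois : IsGalois F N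
  exists_chain : ∃ ζ α : ℕ → N, ζ 0 = algebraMap F N t ∧
    (∀ j < l, TowerStep q a b (ζ j) (α j) (ζ (j + 1))) ∧
    IntermediateField.adjoin F {x | ∃ j < l, ∃ σ : Gal(N/F), x = σ (α j)} = ⊤
  exists_splits : ∃ u u' : ℤ, (p : ℤ) ∣ a * u + b * u' - 1 ∧
    ((stepPoly q a b u u' t).map (algebraMap F N)).Splits

namespace IsCompletion

variable {K : Type*} [Field K] [Algebra K (AlgebraicClosure L)] [IsAlgClosed K]
  {p r q a b l m : ℕ} [Fact p.Prime] [CharP (AlgebraicClosure L) p]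

/-- The completion of `N` is governed by a local generator, with all the conjugates of the `α j` as
the set `A`. -/
theorem exists_isLocalGenerator (hN : IsTowerClosure p q a b l N t)
    (hK : HasConstantResidues v K) (hq : q = p ^ r) (hr : 1 ≤ r) (ha : 1 ≤ a) (hb : 1 ≤ b)
    (hab : Nat.gcd a b = 1) {w' : AlgebraicClosure L}
    (hw : IsLocalParameter v q a b (closureEmbedding f (algebraMap F N t)) w' m) :
    ∃ A : Set N, IntermediateField.adjoin F A = ⊤ ∧ ∃ Y₀ j Y,
      IsLocalGenerator v K p m w' (closureRange E) (closureEmbedding f '' A) Y₀ j Y := by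
  obtain ⟨ζ, α, hζ, hstep, hgen⟩ := hN.exists_chain
  obtain ⟨u, u', huu, hsplit⟩ := hN.exists_splits
  have := hN.finite
  have : CharP N p := (closureEmbedding f).charP (closureEmbedding f).injective p
  refine ⟨_, hgen, ?_⟩
  obtain ⟨Y₀, j, Y, hY⟩ := GaloisTower.exists_isLocalGenerator hK hq hr ha hb hab hw huu
    (ι := Gal(N/F)) (fun σ j => closureEmbedding f (σ (ζ j)))
    (fun σ j => closureEmbedding f (σ (α j))) l
    (fun σ => by rw [hζ, AlgEquiv.commutes])
    (fun σ j hj => ((hstep j hj).map (σ : N →+* N)).map (closureEmbedding f))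
    (closureRange E).toSubfield fun x hx => by
      rw [← map_stepPoly, ← map_stepPoly] at hx
      obtain ⟨y, rfl⟩ := hsplit.mem_range_of_isRoot (fun h0 => by
        rw [map_stepPoly] at h0
        have h1 := coeff_one_stepPoly (b := b) (u := u) (w := u') (ζ := algebraMap F N t) hq hr ha
        rw [h0] at h1
        simp at h1) hx
      exact ⟨f y, rfl⟩
  refine ⟨Y₀, j, Y, ?_⟩
  have hA : closureEmbedding f '' {x | ∃ j < l, ∃ σ : Gal(N/F), x = σ (α j)} =
      {x | ∃ σ : Gal(N/F), ∃ j < l, x = closureEmbedding f (σ (α j))} := by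
    ext x
    constructor
    · rintro ⟨_, ⟨j, hj, σ, rfl⟩, rfl⟩
      exact ⟨σ, j, hj, rfl⟩
    · rintro ⟨σ, j, hj, rfl⟩
      exact ⟨_, ⟨j, hj, σ, rfl⟩, rfl⟩
  rw [hA]
  exact hY

/-- An automorphism in the second ramification group of a place that lies above the zero or the
pole of `t` is trivial. -/
theorem eq_one_of_map_sub_le (h : IsCompletion F O E f v) (hC : IsPlace C O)
    (hN : IsTowerClosure p q a b l N t)
    (hw : IsPole C t (v.comap ((closureEmbedding f).comp (algebraMap F N))) w)
    [Algebra C (AlgebraicClosure L)]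
    (hCL : ∀ c, algebraMap C (AlgebraicClosure L) c = closureEmbedding f (algebraMap C N c))
    [Algebra C K] [Algebra.IsAlgebraic C K] [Algebra.IsSeparable C K]
    [IsScalarTower C K (AlgebraicClosure L)]
    (hq : q = p ^ r) (hr : 1 ≤ r) (ha : 1 ≤ a) (hb : 1 ≤ b) (hab : Nat.gcd a b = 1)
    (hw' : IsLocalParameter v q a b (closureEmbedding f (algebraMap F N t))
      (closureEmbedding f (algebraMap F N w)) m) (σ : Gal(N/F))
    (hσ : ∀ ϖ : N, ϖ ≠ 0 → O.valuation ϖ < 1 →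
      (∀ x, O.valuation x < 1 → O.valuation x ≤ O.valuation ϖ) →
      ∀ x ∈ O, O.valuation (σ x - x) ≤ O.valuation (ϖ ^ 3)) : σ = 1 := by
  have := hN.finite
  have := hN.isGalois
  have := h.finite
  have : Algebra.IsAlgebraic E (AlgebraicClosure L) := Algebra.IsAlgebraic.trans E L _
  let _ : Algebra C E :=
    (((f.comp (algebraMap F N)).codRestrict E.toSubring h.map_mem).comp (algebraMap C F)).toAlgebra
  have htow := IsScalarTower.of_algebraMap_eq (R := C) (S := E)
      (A := AlgebraicClosure L) fun c => by
    rw [hCL, IsScalarTower.algebraMap_apply C F N]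
    rfl
  have hK : HasConstantResidues v K := h.hasConstantResidues hC hw hCL K
  obtain ⟨ϖ, hϖ0, hϖ1, hϖ⟩ := h.exists_uniformizer hC hw
  have hO := h.isEquiv
  have hvϖ : v (closureEmbedding f ϖ) ≠ 0 := v.ne_zero_iff.2 ((map_ne_zero _).2 hϖ0)
  have hσ' : ∀ x, v (closureEmbedding f x) ≤ 1 →
      v (closureEmbedding f (σ x) - closureEmbedding f x) ≤ v (closureEmbedding f ϖ) ^ 3 := by
    intro x hx
    rw [← map_sub, ← map_pow, ← map_pow]
    refine (hO _ _).1 (hσ ϖ hϖ0 (hO.lt_one_iff_lt_one.2 hϖ1) (fun y hy => (hO _ _).2 ?_) x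
      ((h.le_one_iff x).1 hx))
    obtain rfl | hy0 := eq_or_ne y 0
    · simp
    obtain ⟨n, hn⟩ := hϖ (f y) ((map_ne_zero _).2 hy0)
    have hy1 : v (closureEmbedding f y) < 1 := hO.lt_one_iff_lt_one.1 hy
    change v (closureEmbedding f y) = _ at hn
    rw [hn] at hy1
    change v (closureEmbedding f y) ≤ v (closureEmbedding f ϖ)
    have h1 : 0 < n := by
      by_contra! hn0
      exact absurd hy1 (not_lt.2 (one_le_zpow_of_nonpos₀ (zero_lt_iff.2 hvϖ) hϖ1.le hn0))
    rw [hn]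
    conv_rhs => rw [← zpow_one (v (closureEmbedding f ϖ))]
    exact zpow_le_zpow_right_of_le_one₀ (zero_lt_iff.2 hvϖ) hϖ1.le h1
  have h3 : v (closureEmbedding f ϖ) ^ 3 < v (closureEmbedding f ϖ) :=
    pow_lt_self_of_lt_one₀ (zero_lt_iff.2 hvϖ) hϖ1 (by norm_num)
  have hσϖ : v (closureEmbedding f (σ ϖ)) = v (closureEmbedding f ϖ) :=
    v.map_eq_of_sub_lt ((hσ' ϖ hϖ1.le).trans_lt h3)
  have hσv : ∀ x, v (closureEmbedding f (σ x)) = v (closureEmbedding f x) := by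
    intro x
    obtain rfl | hx0 := eq_or_ne x 0
    · simp
    obtain ⟨n, hn⟩ := hϖ (f x) ((map_ne_zero _).2 hx0)
    change v (closureEmbedding f x) = _ at hn
    have h1 : v (closureEmbedding f (x / ϖ ^ n)) = 1 := by
      rw [map_div₀, map_zpow₀, map_div₀, map_zpow₀, hn, div_self (zpow_ne_zero _ hvϖ)]
    have h2 : v (closureEmbedding f (σ (x / ϖ ^ n))) = 1 := by
      rw [← h1]
      exact v.map_eq_of_sub_lt (((hσ' _ h1.le).trans_lt (h3.trans hϖ1)).trans_eq h1.symm)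
    rw [map_div₀, map_zpow₀, map_div₀, map_zpow₀, map_div₀, map_zpow₀, hσϖ,
      div_eq_one_iff_eq (zpow_ne_zero _ hvϖ)] at h2
    rw [h2, hn]
  -- `σ` preserves the place, so it extends to the completion and to its algebraic closure
  obtain ⟨σ₁, hσ₁⟩ := h.exists_extension σ fun x =>
    (Valuation.IsEquiv.eq_iff hO).2 (hσv x)
  have : Normal E (AlgebraicClosure L) := normal_of_isAlgClosed E _
  let τ : Gal(AlgebraicClosure L/E) := σ₁.liftNormal (AlgebraicClosure L)
  have hτ : ∀ y : L, τ (algebraMap L _ y) = algebraMap L _ (σ₁ y) :=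
    fun y => σ₁.liftNormal_commutes _ y
  have hτv : ∀ x, v (τ x) = v x := fun x => h.invariant τ.toRingEquiv τ.commutes x
  obtain ⟨A, hA, Y₀, j, Y, hY⟩ := exists_isLocalGenerator (E := E) hN hK hq hr ha hb hab hw'
  have hm := hw'.degree hq hr ha hb
  have key := map_eq_of_sub_le_pow_three (C := C) (E := E) hK h.invariant (fun e he => by
      obtain ⟨c, hc⟩ := h.exists_const hC hw he
      exact ⟨c, by rwa [hCL]⟩) (fun e he => h.exists_map_eq_zpow hC hw he)
    ⟨⟨_, h.map_mem w⟩, rfl⟩ hm.1 hm.2 hY (closureRange E) (fun x hx => hx)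
    (h.closureRange_eq_adjoin hA) (fun x hx => h.isSeparable_of_mem hx)
    (ϖ := closureEmbedding f ϖ) ⟨f ϖ, rfl⟩ ((map_ne_zero _).2 hϖ0) hϖ1
    (by
      rintro _ ⟨y, rfl⟩ hy
      exact hϖ y fun h0 => hy (by rw [h0]; exact map_zero _)) τ
    (by
      rintro _ ⟨y, rfl⟩ hy
      change v (τ (algebraMap L _ y) - algebraMap L _ y) ≤ _
      change v (algebraMap L _ y) ≤ 1 at hy
      obtain ⟨x, hx⟩ := h.exists_sub_lt y _ (pow_pos (zero_lt_iff.2 hvϖ) 3)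
      have hx1 : v (closureEmbedding f x) ≤ 1 := by
        have h4 := v.map_sub_le hy (hx.le.trans (pow_le_one₀ zero_le hϖ1.le))
        rwa [map_sub (algebraMap L (AlgebraicClosure L)), sub_sub_cancel] at h4
      have h5 := hσ' x hx1
      rw [show τ (algebraMap L _ y) - algebraMap L _ y = τ (algebraMap L _ (y - f x)) -
        algebraMap L _ (y - f x) + (closureEmbedding f (σ x) - closureEmbedding f x) by
          rw [map_sub (algebraMap L (AlgebraicClosure L)), map_sub τ, hτ (f x), hσ₁,
            closureEmbedding_apply, closureEmbedding_apply]
          ring]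
      refine v.map_add_le (v.map_sub_le ?_ hx.le) h5
      rw [hτv]
      exact hx.le)
  ext x
  have h6 : τ (closureEmbedding f x) = closureEmbedding f x := key _ ⟨f x, rfl⟩
  rw [closureEmbedding_apply, hτ, hσ₁] at h6
  exact f.injective ((algebraMap L _).injective h6)

end IsCompletion

end CompletionGenerator

/-! ### Two-bounded extensions of discretely valued fields -/

section TwoBoundedCriterion

variable {F E Γ₀ : Type*} [Field F] [Field E] [Algebra F E] [LinearOrderedCommGroupWithZero Γ₀]
  {B : ValuationSubring E} {v : Valuation E Γ₀}

lemma dvd_of_map_le (hB : ∀ x, x ∈ B ↔ v x ≤ 1) {x y : B} (h : v (y : E) ≤ v (x : E)) : x ∣ y := by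
  obtain hx | hx := eq_or_ne x 0
  · have : (y : E) = 0 := by simpa [hx] using h
    exact ⟨0, by rw [mul_zero]; exact Subtype.ext this⟩
  have hx' : (x : E) ≠ 0 := fun h0 => hx (Subtype.ext h0)
  refine ⟨⟨y / x, (hB _).2 ?_⟩, Subtype.ext (mul_div_cancel₀ _ hx').symm⟩
  rwa [map_div₀, div_le_one₀ (zero_lt_iff.2 (v.ne_zero_iff.2 hx'))]

lemma mem_maximalIdeal_iff_map_lt_one (hB : ∀ x, x ∈ B ↔ v x ≤ 1) {x : B} :
    x ∈ IsLocalRing.maximalIdeal B ↔ v (x : E) < 1 := by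
  rw [IsLocalRing.mem_maximalIdeal, mem_nonunits_iff, ← not_iff_not, not_not, not_lt]
  constructor
  · rintro ⟨u, rfl⟩
    have h1 := (hB _).1 (↑u⁻¹ : B).2
    have h2 : ((u : B) : E) * ((↑u⁻¹ : B) : E) = 1 := congrArg Subtype.val u.mul_inv
    have h3 : v ((u : B) : E) * v ((↑u⁻¹ : B) : E) = 1 := by rw [← map_mul, h2, map_one]
    rw [← h3]
    exact mul_le_of_le_one_right' h1
  · intro h
    exact isUnit_of_dvd_one (dvd_of_map_le hB (by simpa using h))

lemma le_of_lt_one_of_zpow {x π : E} (hπ0 : π ≠ 0) (hπ1 : v π < 1) (hx : v x < 1)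
    (h : x ≠ 0 → ∃ m : ℤ, v x = v π ^ m) : v x ≤ v π := by
  obtain rfl | hx0 := eq_or_ne x 0
  · simp
  obtain ⟨m, hm⟩ := h hx0
  have hπ : 0 < v π := zero_lt_iff.2 (v.ne_zero_iff.2 hπ0)
  have hm1 : 0 < m := by
    by_contra! hn0
    rw [hm] at hx
    exact absurd hx (not_lt.2 (one_le_zpow_of_nonpos₀ hπ hπ1.le hn0))
  rw [hm]
  conv_rhs => rw [← zpow_one (v π)]
  exact zpow_le_zpow_right_of_le_one₀ hπ hπ1.le hm1

variable {π : E} (hB : ∀ x, x ∈ B ↔ v x ≤ 1) (hπ0 : π ≠ 0) (hπ1 : v π < 1)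
  (hval : ∀ x, x ≠ 0 → ∃ m : ℤ, v x = v π ^ m)
include hB hπ0 hπ1 hval

lemma maximalIdeal_eq_span :
    IsLocalRing.maximalIdeal B = Ideal.span {⟨π, (hB π).2 hπ1.le⟩} := by
  refine le_antisymm (fun x hx => ?_) ?_
  · rw [mem_maximalIdeal_iff_map_lt_one hB] at hx
    exact Ideal.mem_span_singleton.2
      (dvd_of_map_le hB (le_of_lt_one_of_zpow hπ0 hπ1 hx (hval _)))
  · rw [Ideal.span_singleton_le_iff_mem, mem_maximalIdeal_iff_map_lt_one hB]
    exact hπ1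

lemma isDiscreteValuationRing_of_zpow : IsDiscreteValuationRing B := by
  have := isRankOneDiscrete_of_zpow v hπ0 hπ1 hval
  have hBv : B = v.valuationSubring := by ext x; exact hB x
  rw [hBv]
  infer_instance

variable {τ : F} {e : ℕ} (he : e ≠ 0) (hτ : v (algebraMap F E τ) = v π ^ e)
  (hF : ∀ x : F, x ≠ 0 → ∃ m : ℤ, v (algebraMap F E x) = v (algebraMap F E τ) ^ m)
include he hτ hF

omit hval in
/-- If `e` is the degree of a uniformizer `π` and the ramification index, then `π` generates the
integers. -/
lemma adjoin_eq_top_of_uniformizer {G : Polynomial F} (hG : G.Monic) (hGe : G.natDegree = e)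
    (hGπ : Polynomial.aeval π G = 0) (hgen : IntermediateField.adjoin F {π} = ⊤) :
    Algebra.adjoin (restrictRing F B) {(⟨π, (hB π).2 hπ1.le⟩ : B)} = ⊤ := by
  have hvπ : 0 < v π := zero_lt_iff.2 (v.ne_zero_iff.2 hπ0)
  have hint : IsIntegral F π := ⟨G, hG, hGπ⟩
  rw [eq_top_iff]
  rintro b -
  have hb : (b : E) ∈ Algebra.adjoin F {π} := by
    rw [← IntermediateField.adjoin_simple_toSubalgebra_of_isAlgebraic hint.isAlgebraic, hgen]
    exact Algebra.mem_top
  rw [Algebra.adjoin_singleton_eq_range_aeval] at hb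
  obtain ⟨P, hP⟩ := hb
  have hR : Polynomial.aeval π (P %ₘ G) = b := by
    rw [Polynomial.aeval_modByMonic_eq_self_of_root hGπ]; exact hP
  have hRe : (P %ₘ G).natDegree < e := by
    rw [← hGe]
    exact Polynomial.natDegree_modByMonic_lt _ hG fun h1 => he (by simp [← hGe, h1])
  set R := P %ₘ G
  rw [Polynomial.aeval_eq_sum_range' hRe] at hR
  have hterm : ∀ i, R.coeff i ≠ 0 → ∃ m : ℤ, v (algebraMap F E (R.coeff i)) = v π ^ (e * m) ∧
      v (R.coeff i • π ^ i) = v π ^ (e * m + i) := by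
    intro i hi
    obtain ⟨m, hm⟩ := hF _ hi
    rw [hτ, ← zpow_natCast, ← zpow_mul] at hm
    refine ⟨m, hm, ?_⟩
    rw [Algebra.smul_def, map_mul, hm, map_pow, zpow_add₀ hvπ.ne', zpow_natCast]
  obtain ⟨i, -, h1, h2⟩ := exists_map_sum_eq v (Finset.range e) (by simpa using he)
    (fun i => R.coeff i • π ^ i) (by
      intro i hi j hj h0 hij
      have h0' : R.coeff j • π ^ j ≠ 0 := by
        rw [← v.ne_zero_iff, ← hij]; exact v.ne_zero_iff.2 h0
      obtain ⟨m, -, hm⟩ := hterm i (left_ne_zero_of_smul h0)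
      obtain ⟨m', -, hm'⟩ := hterm j (left_ne_zero_of_smul h0')
      rw [hm, hm'] at hij
      have h3 := zpow_right_injective₀ hvπ hπ1.ne hij
      have hi' := Finset.mem_range.1 hi
      have hj' := Finset.mem_range.1 hj
      have h4 : (i : ℤ) % e = (j : ℤ) % e := by
        have := congrArg (· % (e : ℤ)) h3
        simpa using this
      rw [Int.emod_eq_of_lt (by omega) (by omega), Int.emod_eq_of_lt (by omega) (by omega)] at h4
      exact_mod_cast h4)
  have hcoeff : ∀ j ∈ Finset.range e, R.coeff j ∈ restrictRing F B := by
    intro j hj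
    change algebraMap F E (R.coeff j) ∈ B
    rw [hB]
    by_cases h0 : R.coeff j = 0
    · simp [h0]
    obtain ⟨m, hm, hm'⟩ := hterm j h0
    have h3 : v (R.coeff j • π ^ j) ≤ 1 := by
      refine (h2 j hj).trans ?_
      rw [← h1, hR]
      exact (hB _).1 b.2
    rw [hm', zpow_le_one_iff_right_of_lt_one₀ hvπ hπ1] at h3
    rw [hm, zpow_le_one_iff_right_of_lt_one₀ hvπ hπ1]
    have hj' := Finset.mem_range.1 hj
    have h5 : -1 < m := by
      by_contra! hcon
      have : (e : ℤ) * m ≤ e * (-1) := mul_le_mul_of_nonneg_left hcon (by omega)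
      omega
    exact mul_nonneg (by omega) (by omega)
  have hb : b = ∑ j ∈ (Finset.range e).attach,
      (⟨R.coeff j, hcoeff j j.2⟩ : restrictRing F B) • (⟨π, (hB π).2 hπ1.le⟩ : B) ^ (j : ℕ) := by
    refine Subtype.ext ?_
    rw [← hR, ← Finset.sum_attach]
    have : ∀ s : Finset (Finset.range e), ((∑ j ∈ s, (⟨R.coeff j, hcoeff j j.2⟩ :
        restrictRing F B) • (⟨π, (hB π).2 hπ1.le⟩ : B) ^ (j : ℕ) : B) : E) =
        ∑ j ∈ s, R.coeff j • π ^ (j : ℕ) := by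
      intro s
      rw [← B.subtype_apply, map_sum]
      refine Finset.sum_congr rfl fun j _ => ?_
      rw [Algebra.smul_def, Algebra.smul_def, map_mul, map_pow]
      rfl
    exact (this _).symm
  rw [hb]
  exact Subalgebra.sum_mem _ fun j _ =>
    Subalgebra.smul_mem _ (Subalgebra.pow_mem _ (Algebra.self_mem_adjoin_singleton _ _) _) _

lemma ramificationIdx_eq_of_uniformizer :
    (IsLocalRing.maximalIdeal B).ramificationIdx (restrictRing F B) = e := by
  have := isDiscreteValuationRing_of_zpow hB hπ0 hπ1 hval
  have hτ0 : τ ≠ 0 := by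
    rintro rfl
    rw [map_zero, map_zero] at hτ
    exact pow_ne_zero _ (v.ne_zero_iff.2 hπ0) hτ.symm
  have hτ1 : v (algebraMap F E τ) < 1 := hτ ▸ pow_lt_one₀ zero_le hπ1 he
  have hmap : Ideal.map (algebraMap (restrictRing F B) B)
      ((IsLocalRing.maximalIdeal B).under (restrictRing F B)) =
      IsLocalRing.maximalIdeal B ^ e := by
    rw [maximalIdeal_eq_span hB hπ0 hπ1 hval, Ideal.span_singleton_pow]
    refine le_antisymm ?_ ?_
    · rw [Ideal.map_le_iff_le_comap]
      intro x hx
      have hx1 : v (algebraMap F E x) < 1 := by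
        rw [← maximalIdeal_eq_span hB hπ0 hπ1 hval] at hx
        exact (mem_maximalIdeal_iff_map_lt_one hB).1 hx
      refine Ideal.mem_span_singleton.2 (dvd_of_map_le hB ?_)
      change v (algebraMap F E x) ≤ v (π ^ e)
      rw [map_pow, ← hτ]
      exact le_of_lt_one_of_zpow ((map_ne_zero _).2 hτ0) hτ1 hx1 fun h0 =>
        hF _ fun h => h0 (by rw [h, map_zero])
    · rw [Ideal.span_singleton_le_iff_mem]
      have hτB : τ ∈ restrictRing F B := (hB _).2 hτ1.le
      have h1 : (⟨τ, hτB⟩ : restrictRing F B) ∈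
          (Ideal.span {(⟨π, (hB π).2 hπ1.le⟩ : B)}).under (restrictRing F B) := by
        rw [← maximalIdeal_eq_span hB hπ0 hπ1 hval]
        exact (mem_maximalIdeal_iff_map_lt_one hB).2 hτ1
      refine Ideal.mem_of_dvd _ (dvd_of_map_le hB ?_) (Ideal.mem_map_of_mem _ h1)
      change v (π ^ e) ≤ v (algebraMap F E τ)
      rw [map_pow, hτ]
  have h0 := IsDiscreteValuationRing.not_a_field B
  rw [Ideal.IsDedekindDomain.ramificationIdx_eq_multiplicity
    ((IsLocalRing.maximalIdeal B).under (restrictRing F B)) _ (by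
      rw [hmap]; exact pow_ne_zero e h0), hmap]
  exact multiplicity_pow_self_of_prime (Ideal.prime_of_isPrime h0 inferInstance) e

/-- The different exponent is read off from the derivative of the equation of a uniformizer. -/
theorem isTwoBounded_of_uniformizer [FiniteDimensional F E] [Algebra.IsSeparable F E]
    {G : Polynomial F} (hG : G.Monic) (hGe : G.natDegree = e)
    (hGπ : Polynomial.aeval π G = 0) (hgen : IntermediateField.adjoin F {π} = ⊤)
    (hG1 : ∀ i, v (algebraMap F E (G.coeff i)) ≤ 1) (hfin : Module.finrank F E = e)
    (hder : v (Polynomial.aeval π (Polynomial.derivative G)) = v π ^ (2 * (e - 1))) :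
    IsTwoBounded F B := by
  have hdvr := isDiscreteValuationRing_of_zpow hB hπ0 hπ1 hval
  refine ⟨hdvr, e, 2 * (e - 1), ramificationIdx_eq_of_uniformizer hB hπ0 hπ1 hval he hτ hF, ?_,
    Nat.one_le_iff_ne_zero.2 he, rfl⟩
  have htow : IsScalarTower (restrictRing F B) B E := IsScalarTower.of_algebraMap_eq fun _ => rfl
  have hadj := adjoin_eq_top_of_uniformizer hB hπ0 hπ1 he hτ hF hG hGe hGπ hgen
  set π' : B := ⟨π, (hB π).2 hπ1.le⟩ with hπ'
  have hint : IsIntegral (restrictRing F B) π' := by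
    obtain ⟨G', hG', -, hG'm⟩ := Polynomial.lifts_and_natDegree_eq_and_monic
      (f := algebraMap (restrictRing F B) F) (p := G) ((Polynomial.lifts_iff_coeff_lifts G).2
        fun i => ⟨⟨G.coeff i, (hB _).2 (hG1 i)⟩, rfl⟩) hG
    refine ⟨G', hG'm, ?_⟩
    refine Subtype.val_injective ?_
    change algebraMap B E (Polynomial.eval₂ _ _ _) = algebraMap B E 0
    rw [Polynomial.hom_eval₂, ← IsScalarTower.algebraMap_eq, map_zero, ← hGπ, ← hG',
      Polynomial.aeval_map_algebraMap]
    rfl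
  have hintB : Algebra.IsIntegral (restrictRing F B) B := ⟨fun b => by
    have h1 := adjoin_le_integralClosure hint
    rw [hadj] at h1
    exact h1 (Algebra.mem_top (x := b))⟩
  have : IsIntegralClosure B (restrictRing F B) E := inferInstance
  have hmin : minpoly F π = G := by
    refine (Polynomial.eq_of_monic_of_dvd_of_natDegree_le (minpoly.monic ⟨G, hG, hGπ⟩) hG
      (minpoly.dvd F π hGπ) ?_).symm
    rw [← IntermediateField.adjoin.finrank ⟨G, hG, hGπ⟩, hgen, IntermediateField.finrank_top',
      hfin, hGe]
  have key := conductor_mul_differentIdeal (restrictRing F B) F E π' (by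
    change Algebra.adjoin F {π} = ⊤
    rw [← IntermediateField.adjoin_simple_toSubalgebra_of_isAlgebraic
      (Algebra.IsAlgebraic.isAlgebraic π), hgen, IntermediateField.top_toSubalgebra])
  rw [conductor_eq_top_of_adjoin_eq_top hadj, Ideal.top_mul] at key
  rw [key, maximalIdeal_eq_span hB hπ0 hπ1 hval, Ideal.span_singleton_pow]
  have hval' : v ((Polynomial.aeval π' (Polynomial.derivative (minpoly (restrictRing F B) π')) : B)
      : E) = v π ^ (2 * (e - 1)) := by
    have h1 : minpoly F π = (minpoly (restrictRing F B) π').map (algebraMap _ F) := by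
      rw [← minpoly.algebraMap_eq (A := restrictRing F B) (B' := E) Subtype.val_injective π']
      exact minpoly.isIntegrallyClosed_eq_field_fractions' F (hint.algebraMap (B := E))
    rw [← hder, ← hmin, h1, Polynomial.derivative_map, Polynomial.aeval_map_algebraMap]
    exact congrArg v (Polynomial.aeval_algebraMap_apply E π' _).symm
  refine le_antisymm ?_ ?_
  · rw [Ideal.span_singleton_le_span_singleton]
    refine dvd_of_map_le hB ?_
    rw [hval', ← map_pow]
    rfl
  · rw [Ideal.span_singleton_le_span_singleton]
    refine dvd_of_map_le hB ?_
    rw [hval', ← map_pow]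
    rfl

end TwoBoundedCriterion

/-! ### Kummer extensions and extensions by additive polynomials -/

section LocalExtensions

open Polynomial IntermediateField

lemma adjoin_gen_eq_top {F E : Type*} [Field F] [Field E] [Algebra F E] (x : E) :
    adjoin F {AdjoinSimple.gen F x} = ⊤ := by
  apply IntermediateField.map_injective (adjoin F {x}).val
  rw [adjoin_map, ← AlgHom.fieldRange_eq_map, fieldRange_val, Set.image_singleton]
  rfl

/-- An extension generated by an `m`-th root, where `m` is the degree, is cyclic if the base field
contains an algebraically closed field in which `m ≠ 0`. -/
lemma isCyclic_of_pow_mem {F E K : Type*} [Field F] [Field E] [Field K] [Algebra F E]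
    [FiniteDimensional F E] [IsAlgClosed K] (φ : K →+* F) {m : ℕ} (hm : (m : K) ≠ 0)
    (hfin : Module.finrank F E = m) {x : E} (hx : x ^ m ∈ Set.range (algebraMap F E))
    (hgen : adjoin F {x} = ⊤) : IsGalois F E ∧ IsCyclic Gal(E/F) := by
  have : NeZero (m : K) := ⟨hm⟩
  obtain ⟨ζ, hζ⟩ := HasEnoughRootsOfUnity.exists_primitiveRoot K m
  have hm0 : 0 < m := Nat.pos_of_ne_zero fun h => hm (by rw [h, Nat.cast_zero])
  have h1 : (primitiveRoots (Module.finrank F E) F).Nonempty :=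
    ⟨φ ζ, by rw [hfin, mem_primitiveRoots hm0]; exact hζ.map_of_injective φ.injective⟩
  have h2 : ∃ α : E, α ^ Module.finrank F E ∈ Set.range (algebraMap F E) ∧ adjoin F {α} = ⊤ :=
    ⟨x, by rwa [hfin], hgen⟩
  exact ((isCyclic_tfae F E h1).out 0 2).2 h2

variable {F E : Type*} [Field F] [Field E] [Algebra F E] {p j : ℕ} [hp : Fact p.Prime] {d : ℕ → F}

lemma isGalois_of_addPoly [CharP F p] (hd : d 0 ≠ 0) (hdj : d j ≠ 0) {c : F} {x : E}
    (hsplit : ((addPoly p j d - C c).map (algebraMap F E)).Splits)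
    (hx : aeval x (addPoly p j d - C c) = 0) (hgen : adjoin F {x} = ⊤) : IsGalois F E := by
  have : IsSplittingField F E (addPoly p j d - C c) := by
    refine isSplittingField_iff_intermediateField.2 ⟨hsplit, ?_⟩
    rw [eq_top_iff, ← hgen]
    exact adjoin.mono F _ _ (Set.singleton_subset_iff.2
      ((mem_rootSet_of_ne (addPoly_sub_ne_zero hdj c)).2 hx))
  exact IsGalois.of_separable_splitting_field (separable_addPoly_sub (j := j) hd c)

/-- The equation of the inverse of a root of `∑ d i X ^ p ^ i - c`. -/
def reversedAddPoly (p j : ℕ) (d : ℕ → F) (c : F) : F[X] :=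
  X ^ p ^ j - ∑ i ∈ Finset.range (j + 1), C (c⁻¹ * d i) * X ^ (p ^ j - p ^ i)

lemma degree_reversedAddPoly_aux (c : F) :
    (∑ i ∈ Finset.range (j + 1), C (c⁻¹ * d i) * X ^ (p ^ j - p ^ i)).degree <
      ((p ^ j : ℕ) : WithBot ℕ) := by
  rw [← mem_degreeLT]
  refine Submodule.sum_mem _ fun i hi => mem_degreeLT.2 ?_
  refine (degree_C_mul_X_pow_le _ _).trans_lt ?_
  have := pow_pos hp.out.pos i
  have := pow_pos hp.out.pos j
  exact_mod_cast (by omega : p ^ j - p ^ i < p ^ j)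

lemma monic_reversedAddPoly (c : F) : (reversedAddPoly p j d c).Monic :=
  monic_X_pow_sub (degree_reversedAddPoly_aux c)

lemma natDegree_reversedAddPoly (c : F) : (reversedAddPoly p j d c).natDegree = p ^ j := by
  rw [reversedAddPoly, natDegree_eq_of_degree_eq (q := (X ^ p ^ j : F[X])), natDegree_X_pow]
  exact degree_sub_eq_left_of_degree_lt ((degree_reversedAddPoly_aux c).trans_eq
    (degree_X_pow _).symm)

lemma aeval_reversedAddPoly {c : F} (hc : c ≠ 0) {x : E} (hx0 : x ≠ 0)
    (hx : aeval x (addPoly p j d - C c) = 0) : aeval x⁻¹ (reversedAddPoly p j d c) = 0 := by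
  rw [map_sub, aeval_addPoly, aeval_C, sub_eq_zero] at hx
  have hc' : algebraMap F E c ≠ 0 := (_root_.map_ne_zero _).2 hc
  have h1 : ∀ i ∈ Finset.range (j + 1), aeval x⁻¹ (C (c⁻¹ * d i) * X ^ (p ^ j - p ^ i)) =
      x⁻¹ ^ p ^ j * (algebraMap F E c)⁻¹ * (algebraMap F E (d i) * x ^ p ^ i) := by
    intro i hi
    have hle : p ^ i ≤ p ^ j := Nat.pow_le_pow_right hp.out.pos
      (Nat.lt_succ_iff.1 (Finset.mem_range.1 hi))
    rw [map_mul, aeval_C, map_pow, aeval_X, map_mul, map_inv₀, pow_sub₀ _ (inv_ne_zero hx0) hle]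
    rw [inv_pow x (p ^ i), inv_inv]
    ring
  rw [reversedAddPoly, map_sub, map_pow, aeval_X, map_sum, Finset.sum_congr rfl h1,
    ← Finset.mul_sum, hx, inv_mul_cancel_right₀ hc', sub_self]

variable [CharP F p]

lemma derivative_reversedAddPoly (c : F) : derivative (reversedAddPoly p j d c) =
    if j = 0 then 1 else C (c⁻¹ * d 0) * X ^ (p ^ j - 2) := by
  have hsum : derivative (∑ i ∈ Finset.range (j + 1), C (c⁻¹ * d i) * X ^ (p ^ j - p ^ i) : F[X]) =
      C (c⁻¹ * d 0 * ((p ^ j - 1 : ℕ) : F)) * X ^ (p ^ j - 2) := by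
    rw [Finset.sum_range_succ', map_add, map_sum, Finset.sum_eq_zero, zero_add,
      derivative_C_mul_X_pow, pow_zero, Nat.sub_sub]
    intro i hi
    have hle : p ^ (i + 1) ≤ p ^ j := Nat.pow_le_pow_right hp.out.pos (Finset.mem_range.1 hi)
    have hdvd : p ∣ p ^ j - p ^ (i + 1) := Nat.dvd_sub
      (dvd_pow_self p (by have := Finset.mem_range.1 hi; omega)) (dvd_pow_self p (by omega))
    rw [derivative_C_mul_X_pow, (CharP.cast_eq_zero_iff F p _).2 hdvd, mul_zero, C_0, zero_mul]
  rw [reversedAddPoly, map_sub, hsum, derivative_X_pow]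
  split_ifs with hj
  · simp [hj]
  · have h1 : ((p ^ j : ℕ) : F) = 0 :=
      (CharP.cast_eq_zero_iff F p _).2 (dvd_pow_self p hj)
    rw [Nat.cast_sub (Nat.one_le_pow _ _ hp.out.pos), h1]
    simp

variable {Γ₀ : Type*} [LinearOrderedCommGroupWithZero Γ₀] {v : Valuation E Γ₀}

/-- The extension of degree `p ^ j` generated by a root `x` of `∑ d i X ^ p ^ i - c` is `2`-bounded
if the `d i` are integral, `d 0` is a unit, and `c` and `x` are the inverses of uniformizers of `F`
and `E`: the derivative of the equation of the uniformizer `x⁻¹` is, up to a unit,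
`c⁻¹ * x⁻¹ ^ (p ^ j - 2)`, of value `2 * (p ^ j - 1)`, as the exponents `p ^ j - p ^ i` with
`0 < i` are divisible by `p`. -/
theorem isTwoBounded_of_addPoly [FiniteDimensional F E] [Algebra.IsSeparable F E]
    {B : ValuationSubring E} (hB : ∀ x, x ∈ B ↔ v x ≤ 1)
    {c : F} {x : E} (hx : aeval x (addPoly p j d - C c) = 0) (hgen : adjoin F {x} = ⊤)
    (hx1 : 1 < v x) (hval : ∀ y, y ≠ 0 → ∃ m : ℤ, v y = v x ^ m)
    (hc : v (algebraMap F E c) = v x ^ p ^ j)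
    (hF : ∀ y : F, y ≠ 0 → ∃ m : ℤ, v (algebraMap F E y) = v (algebraMap F E c) ^ m)
    (hd0 : v (algebraMap F E (d 0)) = 1) (hd : ∀ i, v (algebraMap F E (d i)) ≤ 1)
    (hfin : Module.finrank F E = p ^ j) : IsTwoBounded F B := by
  have hx0 : v x ≠ 0 := (zero_lt_one.trans hx1).ne'
  have hxne : x ≠ 0 := v.ne_zero_iff.1 hx0
  have hcne : c ≠ 0 := by
    rintro rfl
    rw [map_zero, map_zero] at hc
    exact pow_ne_zero _ hx0 hc.symm
  have hcoef : ∀ i, v (algebraMap F E (c⁻¹ * d i)) ≤ 1 := fun i => by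
    rw [map_mul, map_mul, map_inv₀, map_inv₀, hc]
    exact mul_le_one' (inv_le_one_of_one_le₀ (one_le_pow_of_one_le' hx1.le _)) (hd i)
  refine isTwoBounded_of_uniformizer (π := x⁻¹) (τ := c⁻¹) (e := p ^ j) hB (inv_ne_zero hxne) ?_ ?_
    (pow_pos hp.out.pos j).ne' ?_ ?_ (monic_reversedAddPoly c)
    (natDegree_reversedAddPoly (d := d) c)
    (aeval_reversedAddPoly hcne hxne hx) ?_ ?_ hfin ?_
  · rw [map_inv₀]
    exact inv_lt_one_of_one_lt₀ hx1
  · intro y hy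
    obtain ⟨m, hm⟩ := hval y hy
    exact ⟨-m, by rw [hm, map_inv₀, inv_zpow, zpow_neg, inv_inv]⟩
  · rw [map_inv₀, map_inv₀, map_inv₀, inv_pow, hc]
  · intro y hy
    obtain ⟨m, hm⟩ := hF y hy
    exact ⟨-m, by rw [hm, map_inv₀, map_inv₀, inv_zpow, zpow_neg, inv_inv]⟩
  · rw [eq_top_iff, ← hgen, adjoin_simple_le_iff, ← inv_mem_iff]
    exact mem_adjoin_simple_self F _
  · intro i
    rw [reversedAddPoly, coeff_sub, finsetSum_coeff, map_sub, map_sum]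
    refine v.map_sub_le ?_ (v.map_sum_le fun k _ => ?_)
    · rw [coeff_X_pow]
      split_ifs <;> simp
    · rw [coeff_C_mul, coeff_X_pow]
      split_ifs
      · rw [mul_one]; exact hcoef k
      · simp
  · rw [derivative_reversedAddPoly]
    split_ifs with hj
    · simp [hj]
    · have h2 : 2 ≤ p ^ j := hp.out.two_le.trans (Nat.le_self_pow hj p)
      rw [map_mul, aeval_C, map_mul, map_mul, map_mul, hd0, mul_one, map_inv₀, map_inv₀, hc,
        map_pow, aeval_X, map_pow, map_inv₀, ← inv_pow, ← pow_add]
      congr 1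
      omega

end LocalExtensions

/-! ### The structure of the completion -/

section Decomposition

open scoped NNReal
open IntermediateField

variable {K F N L : Type*} [Field K] [Field F] [Field N] [Field L] [Algebra K F] [Algebra K N]
  [Algebra F N] [IsScalarTower K F N] {O : ValuationSubring N} {E : Subfield L} {f : N →+* L}
  {v : Valuation (AlgebraicClosure L) ℝ≥0} {t w : F} [IsAlgClosed K]
  {p r q a b l m : ℕ} [hp : Fact p.Prime] [CharP (AlgebraicClosure L) p]

/-- The roots of `∑ d i X ^ p ^ i - Y₀` differ by constants. -/
lemma splits_addPoly_sub {Γ M : Type*} [Field Γ] [IsAlgClosed Γ] [CharP Γ p] [Algebra K Γ]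
    [Field M] [Algebra M Γ] {κ : K →+* M} (hκ : ∀ c, algebraMap M Γ (κ c) = algebraMap K Γ c)
    {j : ℕ} {c : ℕ → K} (hcj : c j ≠ 0) {y₀ y : M}
    (hy : Polynomial.aeval y (addPoly p j fun i => κ (c i)) = y₀) :
    (addPoly p j (fun i => κ (c i)) - Polynomial.C y₀).Splits := by
  refine Polynomial.Splits.of_splits_map (algebraMap M Γ) (IsAlgClosed.splits _) fun x hx => ?_
  have hx0 : Polynomial.aeval x (addPoly p j (fun i => κ (c i)) - Polynomial.C y₀) = 0 := by
    rw [← Polynomial.eval_map_algebraMap]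
    exact Polynomial.isRoot_of_mem_roots hx
  rw [map_sub, aeval_addPoly, Polynomial.aeval_C] at hx0
  have hy' := congrArg (algebraMap M Γ) hy
  rw [aeval_addPoly, map_sum] at hy'
  obtain ⟨e, he⟩ := exists_algebraMap_eq_of_aeval_eq_zero (K := K) (P := addPoly p j c)
    (fun h0 => (pow_pos hp.out.pos j).ne (by rw [← natDegree_addPoly (p := p) hcj, h0]; simp))
    (x := x - algebraMap M Γ y) (by
      rw [aeval_addPoly]
      rw [← hy', ← Finset.sum_sub_distrib] at hx0
      rw [← hx0]
      refine Finset.sum_congr rfl fun i _ => ?_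
      rw [sub_pow_expChar_pow, map_mul, map_pow, mul_sub, ← hκ]
      rfl)
  refine ⟨y + κ e, ?_⟩
  rw [map_add, hκ, he, add_sub_cancel]

/-- With `y₀` and `y` the elements of the completion that correspond to the local generator, the
tame part `E(y₀)` is a Kummer extension of degree `m`, as `y₀ ^ m = 1 + w`, and the completion is
generated over `E(y₀)` by `y`, a root of an additive polynomial with constant coefficients. -/
theorem IsCompletion.exists_cyclic_twoBounded (h : IsCompletion F O E f v) (hC : IsPlace K O)
    (hN : IsTowerClosure p q a b l N t)
    (hw : IsPole K t (v.comap ((closureEmbedding f).comp (algebraMap F N))) w)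
    (hq : q = p ^ r) (hr : 1 ≤ r) (ha : 1 ≤ a) (hb : 1 ≤ b) (hab : Nat.gcd a b = 1)
    (hw' : IsLocalParameter v q a b (closureEmbedding f (algebraMap F N t))
      (closureEmbedding f (algebraMap F N w)) m) {B : ValuationSubring L}
    (hB : ∀ x : L, v (algebraMap L _ x) ≤ 1 ↔ x ∈ B) :
    ∃ M : IntermediateField E L, IsGalois E M ∧ IsCyclic Gal(M/E) ∧ Module.finrank E M = m ∧
      IsTwoBoundedPExtension M B p := by
  have := hN.finite
  have := hN.isGalois
  have := h.finite
  have halg : Algebra.IsAlgebraic E (AlgebraicClosure L) := Algebra.IsAlgebraic.trans E L _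
  let κ : K →+* E :=
    ((f.comp (algebraMap F N)).codRestrict E.toSubring h.map_mem).comp (algebraMap K F)
  let _ : Algebra K (AlgebraicClosure L) := ((closureEmbedding f).comp (algebraMap K N)).toAlgebra
  have hκ : ∀ c, algebraMap E (AlgebraicClosure L) (κ c) = algebraMap K _ c := fun c => by
    change algebraMap L _ (f (algebraMap F N (algebraMap K F c))) = _
    rw [← IsScalarTower.algebraMap_apply K F N]
    rfl
  have hK : HasConstantResidues v K := h.hasConstantResidues hC hw (fun c => rfl) K
  obtain ⟨A, hA, Y₀, j, Y, hY⟩ :=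
    IsCompletion.exists_isLocalGenerator (E := E) hN hK hq hr ha hb hab hw'
  have hm := hw'.degree hq hr ha hb
  set g := closureEmbedding f with hg
  obtain ⟨⟨y₀, hy₀⟩, ⟨y, hy⟩⟩ := hY.mem_range (E := E) (B := L) hK h.invariant hm.1 hm.2
    (fun c => ⟨_, hκ c⟩) (fun e => ⟨e, rfl⟩) ⟨_, rfl⟩ (fun x hx => hx)
    (by rintro _ ⟨x, -, rfl⟩; exact ⟨f x, rfl⟩)
  have hy1 := hY.one_lt
  have hYY := hY.map_eq₀
  have hwY := hY.map_eq
  have hpow := hY.pow_eq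
  obtain ⟨c, hc0, hcj, -, hsum⟩ := hY.isAddRoot
  -- the completion is generated by `y`
  have hgen : adjoin E {y} = ⊤ := by
    have : Algebra.IsAlgebraic (adjoin E {y}) (AlgebraicClosure L) :=
      Algebra.IsAlgebraic.tower_top (K := E) _
    have h1 := hY.mem_range_of_mem (E := E) (B := adjoin E {y}) h.invariant
      (fun c => ⟨algebraMap E _ (κ c), hκ c⟩) (fun e => ⟨algebraMap E _ e, rfl⟩)
      ⟨algebraMap E _ ⟨_, h.map_mem w⟩, rfl⟩
      ⟨⟨y, mem_adjoin_simple_self E y⟩, hy⟩ (by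
        rintro _ ⟨x, -, rfl⟩
        exact (h.isSeparable_of_mem (x := g x) ⟨f x, rfl⟩).tower_top _)
    rw [eq_top_iff]
    rintro x -
    have h2 : closureRange E ≤ (adjoin E {y}).map (IsScalarTower.toAlgHom E L _) := by
      rw [h.closureRange_eq_adjoin hA, adjoin_le_iff]
      intro z hz
      obtain ⟨z', hz'⟩ := h1 z hz
      exact ⟨z', z'.2, hz'⟩
    obtain ⟨x', hx', hxx⟩ := h2 ⟨x, rfl⟩
    rwa [← (algebraMap L (AlgebraicClosure L)).injective hxx]
  let u : Valuation L ℝ≥0 := v.comap (algebraMap L _)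
  have huy : 1 < u y := by rw [← hy] at hy1; exact hy1
  have huy₀ : u y₀ = u y ^ p ^ j := by rw [← hy, ← hy₀] at hYY; exact hYY
  have huy₀1 : 1 < u y₀ := huy₀ ▸ one_lt_pow₀ huy (pow_pos hp.out.pos j).ne'
  have huw : u (f (algebraMap F N w)) = u y₀ ^ m := by rw [← hy₀] at hwY; exact hwY
  have hE : ∀ e : E, e ≠ 0 → ∃ k : ℤ, u (algebraMap E L e) = u (f (algebraMap F N w)) ^ k :=
    fun e he => h.exists_map_eq_zpow hC hw he
  -- the tame part is generated by the `m`-th root `y₀`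
  have hy₀m : y₀ ^ m = algebraMap E L (1 + ⟨_, h.map_mem w⟩) := by
    refine (algebraMap L (AlgebraicClosure L)).injective ?_
    rw [map_pow, hy₀, hpow]
    simp only [map_add, map_one]
    rfl
  obtain ⟨hfin₀, hval₀⟩ := finrank_eq_and_map_eq_of_root (v := u) hE huy₀1 huw
    (P := Polynomial.X ^ m - Polynomial.C (1 + ⟨_, h.map_mem w⟩))
    (Polynomial.X_pow_sub_C_ne_zero (Nat.pos_of_ne_zero hm.1) _)
    (by rw [map_sub, map_pow, Polynomial.aeval_X, Polynomial.aeval_C, hy₀m, sub_self])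
    (Polynomial.natDegree_X_pow_sub_C).le
  let M := adjoin E {y₀}
  have hmK : (m : K) ≠ 0 := by
    have : CharP K p := charP_of_algebra K (AlgebraicClosure L) p
    intro h0
    rw [CharP.cast_eq_zero_iff K p] at h0
    have h1 : (p : ℤ) ∣ 1 := by
      have := dvd_sub hm.2 (Int.natCast_dvd_natCast.2 h0)
      rwa [add_sub_cancel_left] at this
    exact hp.out.one_lt.ne' (Nat.dvd_one.1 (by exact_mod_cast h1))
  obtain ⟨hgal, hcyc⟩ := isCyclic_of_pow_mem (E := M) κ hmK hfin₀ (x := AdjoinSimple.gen E y₀)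
    ⟨_, Subtype.ext hy₀m.symm⟩ (adjoin_gen_eq_top y₀)
  refine ⟨M, hgal, hcyc, hfin₀, ?_⟩
  -- the wild part is generated by the root `y` of an additive polynomial
  let y₀' : M := AdjoinSimple.gen E y₀
  let κ' : K →+* M := (algebraMap E M).comp κ
  let d : ℕ → M := fun i => κ' (c i)
  have : CharP M p := charP_of_algebra M (AlgebraicClosure L) p
  have hd0 : d 0 ≠ 0 := (map_ne_zero κ').2 hc0
  have hdj : d j ≠ 0 := (map_ne_zero κ').2 hcj
  have hM : ∀ x : M, x ≠ 0 → ∃ k : ℤ, u (algebraMap M L x) = u y₀ ^ k := fun x hx =>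
    hval₀ x x.2 fun h0 => hx (Subtype.ext h0)
  have hyd : Polynomial.aeval y (addPoly p j d) = algebraMap M L y₀' := by
    refine (algebraMap L (AlgebraicClosure L)).injective ?_
    rw [aeval_addPoly, map_sum]
    refine Eq.trans ?_ ((hy₀.trans hsum).symm)
    refine Finset.sum_congr rfl fun i _ => ?_
    rw [map_mul, map_pow, hy, Algebra.smul_def, ← hκ]
    rfl
  have hyd' : Polynomial.aeval y (addPoly p j d - Polynomial.C y₀') = 0 := by
    rw [map_sub, hyd, Polynomial.aeval_C, sub_self]
  obtain ⟨hfin₁, hval₁⟩ := finrank_eq_and_map_eq_of_root (v := u) hM huy huy₀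
    (addPoly_sub_ne_zero hdj y₀') hyd' (natDegree_addPoly_sub hdj y₀').le
  have hgenM : adjoin M {y} = ⊤ := by
    rw [← restrictScalars_eq_top_iff (K := E), eq_top_iff, ← hgen, adjoin_simple_le_iff]
    exact mem_adjoin_simple_self M y
  rw [hgenM, finrank_top'] at hfin₁
  have hgalM : IsGalois M L := by
    refine isGalois_of_addPoly hd0 hdj (c := y₀') ?_ hyd' hgenM
    have h1 := splits_addPoly_sub (p := p) (Γ := AlgebraicClosure L) (M := L)
      (κ := (algebraMap M L).comp κ') (fun c => hκ c) hcj (y₀ := y₀) (y := y) (by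
        rw [aeval_addPoly] at hyd ⊢
        exact hyd)
    have h2 : (addPoly p j d - Polynomial.C y₀').map (algebraMap M L) =
        addPoly p j (fun i => (algebraMap M L).comp κ' (c i)) - Polynomial.C y₀ := by
      simp only [addPoly, Polynomial.map_sub, Polynomial.map_sum, Polynomial.map_mul,
        Polynomial.map_pow, Polynomial.map_X, Polynomial.map_C]
      rfl
    rw [h2]
    exact h1
  have hud : ∀ i, c i ≠ 0 → u (algebraMap M L (d i)) = 1 := fun i hi => by
    have := hK.map_const (c i) hi
    rw [← hκ] at this
    exact this
  refine ⟨inferInstance, hgalM, ⟨j, hfin₁⟩, ?_⟩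
  refine isTwoBounded_of_addPoly (v := u) (fun x => (hB x).symm) hyd' hgenM huy
    (fun x hx => hval₁ x (hgenM ▸ mem_top) hx) huy₀ hM (hud 0 hc0) (fun i => ?_) hfin₁
  by_cases hi : c i = 0
  · have : d i = 0 := by change κ' (c i) = 0; rw [hi, map_zero]
    rw [this, map_zero, map_zero]
    exact zero_le_one
  · exact (hud i hi).le

end Decomposition

/-! ### Places of the tower -/

section PlacesOfTower

open scoped NNReal

variable {C F N : Type*} [Field C] [Field F] [Field N] [Algebra C F] [Algebra C N]
  [Algebra F N] [IsScalarTower C F N] {O : ValuationSubring N} {t w : F}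

/-- Triviality of the second ramification group in terms of values; the second assumption on `σ` in
`H` says that `σ` acts trivially on residues. -/
lemma ramificationGroup_two_eq_bot (H : ∀ σ : Gal(N/F),
    (∀ ϖ : N, ϖ ≠ 0 → O.valuation ϖ < 1 →
      (∀ x, O.valuation x < 1 → O.valuation x ≤ O.valuation ϖ) →
      ∀ x ∈ O, O.valuation (σ x - x) ≤ O.valuation (ϖ ^ 3)) →
    (∀ x ∈ O, O.valuation (σ x - x) < 1) → σ = 1) : ramificationGroup F O 2 = ⊥ := by
  rw [Subgroup.eq_bot_iff_forall]
  intro σ hσ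
  have hmem : ∀ x : O, σ • x - x ∈ IsLocalRing.maximalIdeal O ^ 3 := hσ
  have hB : ∀ x, x ∈ O ↔ O.valuation x ≤ 1 := fun x => (O.valuation_le_one_iff x).symm
  refine Subtype.ext (H σ.1 (fun ϖ hϖ0 hϖ1 hϖ x hx => ?_) fun x hx => ?_)
  · have hmax : IsLocalRing.maximalIdeal O ≤ Ideal.span {⟨ϖ, (hB ϖ).2 hϖ1.le⟩} := fun y hy =>
      Ideal.mem_span_singleton.2
        (dvd_of_map_le hB (hϖ y ((mem_maximalIdeal_iff_map_lt_one hB).1 hy)))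
    have h1 := Ideal.pow_right_mono hmax 3 (hmem ⟨x, hx⟩)
    rw [Ideal.span_singleton_pow, Ideal.mem_span_singleton] at h1
    obtain ⟨y, hy⟩ := h1
    have hy' : σ.1 x - x = ϖ ^ 3 * y := congrArg Subtype.val hy
    rw [hy', map_mul]
    exact mul_le_of_le_one_right' ((hB _).1 y.2)
  · exact (mem_maximalIdeal_iff_map_lt_one hB).1
      (Ideal.pow_le_self (by norm_num) (hmem ⟨x, hx⟩))

lemma eq_one_of_adjoin_eq_top [FiniteDimensional F N] {A : Set N}
    (hA : IntermediateField.adjoin F A = ⊤) {σ : Gal(N/F)} (hσ : ∀ x ∈ A, σ x = x) : σ = 1 := by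
  have h1 : IntermediateField.adjoin F A ≤
      IntermediateField.fixedField (Subgroup.zpowers σ) := by
    refine IntermediateField.adjoin_le_iff.2 fun x hx => ?_
    rw [SetLike.mem_coe, IntermediateField.mem_fixedField_iff]
    intro τ hτ
    have h2 : Subgroup.zpowers σ ≤ MulAction.stabilizer Gal(N/F) x := by
      rw [Subgroup.zpowers_le]
      exact hσ x hx
    exact h2 hτ
  rw [hA] at h1
  ext x
  exact (IntermediateField.mem_fixedField_iff _ _).1 (h1 IntermediateField.mem_top (x := x)) σ
    (Subgroup.mem_zpowers σ)

/-- Above a place where `t` is a unit the inertia group is trivial. -/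
lemma eq_one_of_valuation_eq_one {p r q a b l : ℕ} [Fact p.Prime] [CharP N p]
    (hq : q = p ^ r) (hr : 1 ≤ r) (ha : 1 ≤ a) (hb : 1 ≤ b)
    [FiniteDimensional F N] {ζ α : ℕ → N} (hζ : ζ 0 = algebraMap F N t)
    (hstep : ∀ j < l, TowerStep q a b (ζ j) (α j) (ζ (j + 1)))
    (hgen : IntermediateField.adjoin F {x | ∃ j < l, ∃ σ : Gal(N/F), x = σ (α j)} = ⊤)
    (ht : O.valuation (algebraMap F N t) = 1) {σ : Gal(N/F)}
    (hσ : ∀ x ∈ O, O.valuation (σ x - x) < 1) : σ = 1 := by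
  refine eq_one_of_adjoin_eq_top hgen ?_
  rintro _ ⟨j, hj, τ, rfl⟩
  have hres : ∀ x, O.valuation x ≤ 1 → O.valuation (σ x - x) < 1 := fun x hx =>
    hσ x ((O.valuation_le_one_iff x).1 hx)
  have hstep' : ∀ j < l, TowerStep q a b (τ (ζ j)) (τ (α j)) (τ (ζ (j + 1))) := fun j hj =>
    (hstep j hj).map (τ : N →+* N)
  have key : ∀ j ≤ l, O.valuation (τ (ζ j)) = 1 ∧ σ (τ (ζ j)) = τ (ζ j) := by
    intro j
    induction j with
    | zero => exact fun _ => by simp [hζ, ht]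
    | succ j ih =>
      intro hj
      obtain ⟨h1, h2⟩ := ih (by omega)
      obtain ⟨h3, h4⟩ := (hstep' j hj).map_eq_of_unit hq hr ha hb h1 (σ : N →+* N) h2 hres
      refine ⟨h4, ?_⟩
      change σ (τ (α j)) = τ (α j) at h3
      rw [(hstep' j hj).next_eq_mul hq, map_mul, map_pow, map_pow, h2, h3]
  obtain ⟨h1, h2⟩ := key j hj.le
  exact ((hstep' j hj).map_eq_of_unit hq hr ha hb h1 (σ : N →+* N) h2 hres).1

/-- The completion of `N` at a place above the zero or the pole of `t`. -/
theorem exists_isCompletion_of_isPlace [FiniteDimensional F N] (hC : IsPlace C O)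
    (htop : IntermediateField.adjoin C {t} = ⊤) (hwt : w = t ∨ w = t⁻¹)
    (hw : 1 < O.valuation (algebraMap F N w)) :
    ∃ v : Valuation (AlgebraicClosure (Completed O)) ℝ≥0,
      IsCompletion F O (completedBase F O) (toCompleted O) v ∧
      (∀ x : Completed O, v (algebraMap (Completed O) _ x) ≤ 1 ↔ x ∈ completedIntegers O) ∧
      IsPole C t (v.comap ((closureEmbedding (toCompleted O)).comp (algebraMap F N))) w := by
  obtain ⟨ϖ, h0, h1, h2⟩ := exists_uniformizer_of_finite (F := F) (v := O.valuation)
    (w := algebraMap F N w) (fun x hx => exists_map_eq_zpow_of_mem_adjoin (C := C)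
      (v := O.valuation.comap (algebraMap F N)) (t := t) (w := w) (fun c hc => by
        have := hC.valuation_eq_one hc
        rwa [IsScalarTower.algebraMap_apply C F N] at this) hw hwt
      (htop ▸ IntermediateField.mem_top) hx) hw
  obtain ⟨v, hv, hv'⟩ := exists_isCompletion O h0 h1 h2 hw
  exact ⟨v, hv, hv', htop, hwt, hv.isEquiv.one_lt_iff_one_lt.1 hw⟩

end PlacesOfTower

section Steps

open scoped NNReal

variable {Ω : Type*} [Field Ω] [IsAlgClosed Ω] {p r q a b : ℕ} [hp : Fact p.Prime] [CharP Ω p]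
  {z α : ℕ → Ω}

lemma adjoin_baseGen_eq_top (C : Type*) [Field C] [Algebra C Ω] (z : ℕ → Ω) :
    IntermediateField.adjoin C {baseGen C z} = ⊤ := adjoin_gen_eq_top (F := C) (z 1)

lemma isTowerClosure_galoisStep {C : Type*} [Field C] [Algebra C Ω]
    (hz : Transcendental C (z 1)) (hstep : ∀ j, 1 ≤ j → TowerStep q a b (z j) (α j) (z (j + 1)))
    (hq : q = p ^ r) (hr : 1 ≤ r) (ha : 1 ≤ a) (hb : 1 ≤ b) (hab : Nat.gcd a b = 1)
    {i : ℕ} (hi : 2 ≤ i) :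
    IsTowerClosure p q a b (i - 1) (galoisStep C z i) (baseGen C z) := by
  obtain ⟨h1, h2, h3, h4⟩ := galoisStep_structure hz hstep hq hr ha hb hab i
  exact ⟨h1, h2, h3, h4 hi⟩

lemma charP_closure {C : Type*} [Field C] [Algebra C Ω] {i : ℕ}
    (O : ValuationSubring (galoisStep C z i)) : CharP (AlgebraicClosure (Completed O)) p := by
  have : CharP (galoisStep C z i) p := charP_of_algebra _ Ω p
  exact charP_of_injective_ringHom (closureEmbedding (toCompleted O)).injective p

lemma exists_isCompletion_of_lt_one {C : Type*} [Field C] [Algebra C Ω] {i : ℕ}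
    {O : ValuationSubring (galoisStep C z i)} (hz : Transcendental C (z 1)) (hC : IsPlace C O)
    (hfin : FiniteDimensional (baseField C z) (galoisStep C z i))
    (ht : O.valuation (algebraMap _ _ (baseGen C z)) < 1) :
    ∃ v : Valuation (AlgebraicClosure (Completed O)) ℝ≥0,
      IsCompletion (baseField C z) O (completedBase (baseField C z) O) (toCompleted O) v ∧
      (∀ x : Completed O, v (algebraMap (Completed O) _ x) ≤ 1 ↔ x ∈ completedIntegers O) ∧
      IsPole C (baseGen C z) (v.comap ((closureEmbedding (toCompleted O)).comp
        (algebraMap (baseField C z) (galoisStep C z i)))) (baseGen C z)⁻¹ ∧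
      ∀ q a b : ℕ, IsLocalParameter v q a b
        (closureEmbedding (toCompleted O) (algebraMap (baseField C z) _ (baseGen C z)))
        (closureEmbedding (toCompleted O) (algebraMap (baseField C z) _ (baseGen C z)⁻¹))
        (q ^ b - 1) := by
  have h0 : baseGen C z ≠ 0 := fun h => hz (by
    rw [show z 1 = 0 from congrArg Subtype.val h]; exact isAlgebraic_zero)
  have h0' : algebraMap (baseField C z) (galoisStep C z i) (baseGen C z) ≠ 0 :=
    (map_ne_zero _).2 h0
  obtain ⟨v, hv, hv', hw⟩ := exists_isCompletion_of_isPlace hC (adjoin_baseGen_eq_top C z)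
    (Or.inr rfl) (by
      rw [map_inv₀, map_inv₀]
      exact (one_lt_inv₀ (zero_lt_iff.2 (O.valuation.ne_zero_iff.2 h0'))).2 ht)
  exact ⟨v, hv, hv', hw, fun q a b => Or.inl ⟨(map_ne_zero _).2 h0',
    hv.isEquiv.lt_one_iff_lt_one.1 ht, by rw [map_inv₀, map_inv₀], rfl⟩⟩

/-- Either there are no steps at all, or `z 1` is a unit at the place and the place is unramified,
or the place lies above the zero or the pole of `z 1`, and the completion is known. -/
theorem isWeaklyRamified_galoisStep {C K : Type*} [Field C] [Algebra C Ω] [Field K] [Algebra C K]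
    [Algebra.IsAlgebraic C K] [Algebra.IsSeparable C K] [IsAlgClosed K]
    (hz : Transcendental C (z 1)) (hstep : ∀ j, 1 ≤ j → TowerStep q a b (z j) (α j) (z (j + 1)))
    (hq : q = p ^ r) (hr : 1 ≤ r) (ha : 1 ≤ a) (hb : 1 ≤ b) (hab : Nat.gcd a b = 1) (i : ℕ) :
    IsWeaklyRamified C (baseField C z) (galoisStep C z i) := by
  obtain ⟨h1, h2, ⟨ζ, β, hζ, hstep', hgen⟩, -⟩ := galoisStep_structure hz hstep hq hr ha hb hab i
  refine ⟨h1, h2, fun O hC => ramificationGroup_two_eq_bot fun σ hσ hσ' => ?_⟩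
  have : CharP (galoisStep C z i) p := charP_of_algebra _ Ω p
  obtain hi | hi := Nat.lt_or_ge i 2
  · refine eq_one_of_adjoin_eq_top hgen ?_
    rintro _ ⟨j, hj, -⟩
    omega
  by_cases ht : O.valuation (algebraMap _ _ (baseGen C z)) = 1
  · exact eq_one_of_valuation_eq_one hq hr ha hb hζ hstep' hgen ht hσ'
  have hN := isTowerClosure_galoisStep hz hstep hq hr ha hb hab hi
  have htop := adjoin_baseGen_eq_top C z
  have := charP_closure (p := p) O
  let _ : Algebra C (AlgebraicClosure (Completed O)) :=
    ((closureEmbedding (toCompleted O)).comp (algebraMap C _)).toAlgebra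
  let φ : K →ₐ[C] AlgebraicClosure (Completed O) := IsAlgClosed.lift
  let _ : Algebra K (AlgebraicClosure (Completed O)) := φ.toRingHom.toAlgebra
  have : IsScalarTower C K (AlgebraicClosure (Completed O)) :=
    IsScalarTower.of_algebraMap_eq fun c => (φ.commutes c).symm
  obtain ht | ht := lt_or_gt_of_ne ht
  · obtain ⟨v, hv, -, hw, hloc⟩ := exists_isCompletion_of_lt_one hz hC h1 ht
    exact hv.eq_one_of_map_sub_le (K := K) hC hN hw (fun _ => rfl) hq hr ha hb hab
      (hloc q a b) σ hσ
  · obtain ⟨v, hv, -, hw⟩ := exists_isCompletion_of_isPlace hC htop (Or.inl rfl) ht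
    exact hv.eq_one_of_map_sub_le (K := K) hC hN hw (fun _ => rfl) hq hr ha hb hab
      (Or.inr ⟨hw.one_lt, rfl, rfl⟩) σ hσ

section Decompositions

variable {K : Type*} [Field K] [IsAlgClosed K] [Algebra K Ω] {i : ℕ}
  {O : ValuationSubring (galoisStep K z i)}

theorem hasCyclicTwoBoundedDecomposition_of_lt_one (hz : Transcendental K (z 1))
    (hstep : ∀ j, 1 ≤ j → TowerStep q a b (z j) (α j) (z (j + 1)))
    (hq : q = p ^ r) (hr : 1 ≤ r) (ha : 1 ≤ a) (hb : 1 ≤ b) (hab : Nat.gcd a b = 1)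
    (hi : 2 ≤ i) (hC : IsPlace K O) (ht : O.valuation (algebraMap _ _ (baseGen K z)) < 1) :
    HasCyclicTwoBoundedDecomposition p (q ^ b - 1) (baseField K z) O := by
  have hN := isTowerClosure_galoisStep hz hstep hq hr ha hb hab hi
  have := charP_closure (p := p) O
  obtain ⟨v, hv, hB, hw, hloc⟩ := exists_isCompletion_of_lt_one hz hC hN.finite ht
  exact hv.exists_cyclic_twoBounded hC hN hw hq hr ha hb hab (hloc q a b) hB

theorem hasCyclicTwoBoundedDecomposition_of_one_lt (hz : Transcendental K (z 1))
    (hstep : ∀ j, 1 ≤ j → TowerStep q a b (z j) (α j) (z (j + 1)))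
    (hq : q = p ^ r) (hr : 1 ≤ r) (ha : 1 ≤ a) (hb : 1 ≤ b) (hab : Nat.gcd a b = 1)
    (hi : 2 ≤ i) (hC : IsPlace K O) (ht : 1 < O.valuation (algebraMap _ _ (baseGen K z))) :
    HasCyclicTwoBoundedDecomposition p (q ^ a - 1) (baseField K z) O := by
  have hN := isTowerClosure_galoisStep hz hstep hq hr ha hb hab hi
  have := hN.finite
  have := charP_closure (p := p) O
  obtain ⟨v, hv, hB, hw⟩ := exists_isCompletion_of_isPlace hC (adjoin_baseGen_eq_top K z)
    (Or.inl rfl) ht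
  exact hv.exists_cyclic_twoBounded hC hN hw hq hr ha hb hab (Or.inr ⟨hw.one_lt, rfl, rfl⟩) hB

end Decompositions

end Steps

end GaloisTower

end

theorem mainTheorem3
    (p : ℕ) [Fact p.Prime] (r : ℕ) (hr : 1 ≤ r) (q : ℕ) (hq : q = p ^ r)
    (n k : ℕ) (hk : 1 ≤ k) (hkn : k < n) (hcop : Nat.gcd k (n - k) = 1)
    -- `𝔽` is the finite field with `q ^ n` elements, `K` its algebraic closure
    (𝔽 : Type*) [Field 𝔽] [Finite 𝔽] (hcard : Nat.card 𝔽 = q ^ n)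
    (K : Type*) [Field K] [Algebra 𝔽 K] [IsAlgClosure 𝔽 K]
    -- an algebraically closed field in which the tower is constructed
    (Ω : Type*) [Field Ω] [IsAlgClosed Ω] [Algebra 𝔽 Ω] [Algebra K Ω] [IsScalarTower 𝔽 K Ω]
    (x : ℕ → Ω) (hx₁ : Transcendental 𝔽 (x 1))
    (hx : ∀ i, 1 ≤ i → GaloisTower.TowerEquation q n k (x i) (x (i + 1))) :
    -- local structure over the constant field `K`
    (∀ i, 2 ≤ i → ∀ O : ValuationSubring (GaloisTower.galoisStep K (GaloisTower.z q n x) i),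
      GaloisTower.IsPlace K O →
        -- above the zero of `z₁`
        (O.valuation (algebraMap _ _ (GaloisTower.baseGen K (GaloisTower.z q n x))) < 1 →
          GaloisTower.HasCyclicTwoBoundedDecomposition p (q ^ k - 1)
            (GaloisTower.baseField K (GaloisTower.z q n x)) O) ∧
        -- above the pole of `z₁`
        (1 < O.valuation (algebraMap _ _ (GaloisTower.baseGen K (GaloisTower.z q n x))) →
          GaloisTower.HasCyclicTwoBoundedDecomposition p (q ^ (n - k) - 1)
            (GaloisTower.baseField K (GaloisTower.z q n x)) O)) ∧
    -- weak ramification, over the constant field `K` as well as over `𝔽`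
    (∀ i, 1 ≤ i →
      GaloisTower.IsWeaklyRamified K (GaloisTower.baseField K (GaloisTower.z q n x))
        (GaloisTower.galoisStep K (GaloisTower.z q n x) i) ∧
      GaloisTower.IsWeaklyRamified 𝔽 (GaloisTower.baseField 𝔽 (GaloisTower.z q n x))
        (GaloisTower.galoisStep 𝔽 (GaloisTower.z q n x) i)) := by
  have hp : p.Prime := Fact.out
  have hp0 : (p : 𝔽) = 0 := by
    have := Fintype.ofFinite 𝔽
    have h1 : ((Nat.card 𝔽 : ℕ) : 𝔽) = 0 := by
      rw [Nat.card_eq_fintype_card]; exact Nat.cast_card_eq_zero 𝔽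
    rw [hcard, hq, ← pow_mul, Nat.cast_pow] at h1
    exact eq_zero_of_pow_eq_zero h1
  have : CharP 𝔽 p := (CharP.charP_iff_prime_eq_zero hp).2 hp0
  have : CharP Ω p := charP_of_injective_algebraMap (algebraMap 𝔽 Ω).injective p
  have hK : IsAlgClosed K := IsAlgClosure.isAlgClosed 𝔽
  have halg : Algebra.IsAlgebraic 𝔽 K := IsAlgClosure.isAlgebraic
  have hstep : ∀ j, 1 ≤ j → GaloisTower.TowerStep q (n - k) k (GaloisTower.z q n x j)
      (x (j + 1) / x j ^ q ^ k) (GaloisTower.z q n x (j + 1)) := fun j hj =>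
    ((hx j hj).towerStep hq hkn).2
  have hcop' : Nat.gcd (n - k) k = 1 := by rwa [Nat.gcd_comm]
  have hz : Transcendental 𝔽 (GaloisTower.z q n x 1) := by
    have hpos : 0 < q ^ n - 1 := by
      have : 1 < Nat.card 𝔽 := Finite.one_lt_card
      omega
    intro h
    refine hx₁.pow hpos ?_
    have := h.neg
    rwa [GaloisTower.z, neg_neg] at this
  have hzK : Transcendental K (GaloisTower.z q n x 1) := fun h => hz (h.restrictScalars 𝔽)
  have ha : 1 ≤ n - k := by omega
  exact ⟨fun i hi O hO =>
      ⟨GaloisTower.hasCyclicTwoBoundedDecomposition_of_lt_one hzK hstep hq hr ha hk hcop' hi hO,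
        GaloisTower.hasCyclicTwoBoundedDecomposition_of_one_lt hzK hstep hq hr ha hk hcop' hi hO⟩,
    fun i _ =>
      ⟨GaloisTower.isWeaklyRamified_galoisStep (K := K) hzK hstep hq hr ha hk hcop' i,
        GaloisTower.isWeaklyRamified_galoisStep (K := K) hz hstep hq hr ha hk hcop' i⟩⟩
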